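/- Let $d\ge 0$, $T>0$, $\beta>0$. Let $\mathcal P_2(\mathbb R^d)$ be the set of probability densities on $\mathbb R^d$ with finite second moment, and let $\rho_0\in\mathcal P_2(\mathbb R^d)$. **Regularized proximal density.** Let $D\subseteq\mathcal P_2(\mathbb R^d)$ and $\mathcal F\colon D\to\mathbb R$ (for example $D=\mathcal P_2(\mathbb R^d)$; outside $D$ the energy is regarded as $+\infty$). A density $\rho_T\in D$ is called a *regularized Wasserstein proximal density* of $\rho_0$ for $\mathcal F$ if it is the terminal density $q=\rho_T$ of a minimizer $(\rho,v,q)$ of $$\int_0^T\!\!\int_{\mathbb R^d}\tfrac12\|v(t,x)\|^2\rho(t,x)\,dx\,dt+\mathcal F(q)$$ among all triples consisting of a measurable curve of probability densities $\rho(t,\cdot)$, a measurable vector field $v(t,x)\in\mathbb R^d$ with $\int_0^T\!\int\|v\|^2\rho\,dx\,dt<\infty$, and $q\in D$, which satisfy $$\partial_t\rho+\nabla\cdot(\rho v)=\beta\Delta\rho\ \text{ on }(0,T)\times\mathbb R^d,\qquad \rho(0,\cdot)=\rho_0,\qquad \rho(T,\cdot)=q$$ in the weak sense: for all $\varphi\in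 C_c^\infty(\mathbb R\times\mathbb R^d)$, $\int\varphi(T,x)q(x)dx-\int\varphi(0,x)\rho_0(x)dx=\int_0^T\!\int(\partial_t\varphi+v\cdot\nabla\varphi+\beta\Delta\varphi)\rho\,dx\,dt$. **First variation.** A measurable function $f$ on $\mathbb R^d$ is an $L^2$ first variation of $\mathcal F$ at $\rho\in D$ if for every bounded $q\in\mathcal P_2(\mathbb R^d)$ the functions $f\rho$ and $fq$ are integrable, $(1-\varepsilon)\rho+\varepsilon q\in D$ for all sufficiently small $\varepsilon>0$, and $$\frac{d}{d\varepsilon}\Big|_{\varepsilon=0^+}\mathcal F\big(\rho+\varepsilon(q-\rho)\big)=\int_{\mathbb R^d}f(x)\,(q(x)-\rho(x))\,dx .$$ **(1) General energies.** Let $\rho_T$ be a regularized Wasserstein proximal density of $\rho_0$ for $\mathcal F$, let $F(\cdot,\rho_T)$ be an $L^2$ first variation of $\mathcal F$ at $\rho_T$, and assume $\int_{\mathbb R^d}e^{-\frac1{2\beta}(F(z,\rho_T)+\frac{\|z-y\|^2}{2T})}dz<\infty$ for every $y\in\mathbb R^d$. Put $$K(x,y,\beta,T,\rho_T)=\frac{e^{-\frac1{2\beta}\left(F(x,\rho_T)+\frac{\|x-y\|^2}{2T}\right)}}{\int_{\mathbb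 R^d}e^{-\frac1{2\beta}\left(F(z,\rho_T)+\frac{\|z-y\|^2}{2T}\right)}dz}.$$ Then for almost every $x\in\mathbb R^d$ the function $y\mapsto K(x,y,\beta,T,\rho_T)\rho_0(y)$ is integrable and $$\rho_T(x)=\int_{\mathbb R^d}K(x,y,\beta,T,\rho_T)\,\rho_0(y)\,dy .$$ **(2) Potential, interaction and internal energies.** Let $V,W\in C^1(\mathbb R^d)$ with $W(-z)=W(z)$ and $|V(x)|,|W(x)|\le C(1+\|x\|^2)$, let $U\in C^1(\mathbb R)$ with $U(0)=0$ and $|U'(s)|\le C(1+s^p)$ for $s\ge0$, where $p\ge0$, and let $D=\{\rho\in\mathcal P_2(\mathbb R^d):\int\rho^{p+1}dx<\infty\}$ (so $D=\mathcal P_2(\mathbb R^d)$ if $p=0$). For the energy $$\mathcal F(\rho)=\int V\rho\,dx+\frac12\iint W(x-y)\rho(x)\rho(y)\,dx\,dy+\int U(\rho(x))\,dx$$ on $D$, the function $F(x,\rho)=V(x)+(W*\rho)(x)+U'(\rho(x))$ is an $L^2$ first variation at every $\rho\in D$. If $\rho_T$ is a regularized Wasserstein proximal density of $\rho_0$ for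 this energy, and $\int e^{-\frac1{2\beta}(F(z,\rho_T)+\frac{\|z-y\|^2}{2T})}dz<\infty$ for every $y$, then for almost every $x$ the integral below converges and $$\rho_T(x)=\int_{\mathbb R^d}\frac{e^{-\frac1{2\beta}\left(V(x)+(W*\rho_T)(x)+U'(\rho_T(x))+\frac{\|x-y\|^2}{2T}\right)}}{\int_{\mathbb R^d}e^{-\frac1{2\beta}\left(V(z)+(W*\rho_T)(z)+U'(\rho_T(z))+\frac{\|z-y\|^2}{2T}\right)}dz}\,\rho_0(y)\,dy .$$ -/

import Mathlib

open MeasureTheory Set Filter Topology InnerProductSpace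
open scoped ContDiff

noncomputable section

namespace WProx

/-- Euclidean space of dimension `d`, with the Euclidean norm. -/
abbrev Rd (d : ℕ) := EuclideanSpace ℝ (Fin d)

/-- Probability density functions with respect to Lebesgue measure. -/
structure IsDensity {d : ℕ} (ρ : Rd d → ℝ) : Prop where
  nonneg : ∀ x, 0 ≤ ρ x
  integrable : Integrable ρ
  integral_eq_one : ∫ x, ρ x = 1

/-- (Borel) probability densities with finite second moment. -/
def P2 (d : ℕ) : Set (Rd d → ℝ) :=
  {ρ | Measurable ρ ∧ IsDensity ρ ∧ Integrable (fun x => ‖x‖ ^ 2 * ρ x)}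

/-- Lebesgue measure on the space-time slab `[0, T] × ℝᵈ`. -/
def slab (d : ℕ) (T : ℝ) : Measure (ℝ × Rd d) :=
  (volume.restrict (Icc 0 T)).prod volume

/-- `ρ` solves `∂ₜρ + ∇·(ρ v) = β Δρ` on `(0, T) × ℝᵈ` with `ρ(0, ·) = ρ₀` and `ρ(T, ·) = q`,
in the sense of distributions: the equation is tested against all smooth compactly supported
functions of `(t, x)`, which need not vanish at `t = 0` and `t = T`, so that the boundary terms
encode the initial and the terminal condition. -/
def SolvesFokkerPlanck {d : ℕ} (T β : ℝ) (ρ₀ q : Rd d → ℝ)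
    (ρ : ℝ → Rd d → ℝ) (v : ℝ → Rd d → Rd d) : Prop :=
  ∀ φ : ℝ → Rd d → ℝ, ContDiff ℝ ∞ (Function.uncurry φ) →
    HasCompactSupport (Function.uncurry φ) →
    (∫ x, φ T x * q x) - ∫ x, φ 0 x * ρ₀ x =
      ∫ p, (deriv (fun s => φ s p.2) p.1
            + inner ℝ (v p.1 p.2) (gradient (φ p.1) p.2)
            + β * Laplacian.laplacian (φ p.1) p.2) * ρ p.1 p.2 ∂(slab d T)

/-- Admissible triples `(ρ, v, q)` of the mean-field control problem: a curve of densities and a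
vector field of finite kinetic energy, joined by the Fokker-Planck equation. -/
structure IsAdmissible {d : ℕ} (T β : ℝ) (ρ₀ q : Rd d → ℝ)
    (ρ : ℝ → Rd d → ℝ) (v : ℝ → Rd d → Rd d) : Prop where
  measurable_density : Measurable (Function.uncurry ρ)
  measurable_field : Measurable (Function.uncurry v)
  isDensity : ∀ t ∈ Ioo 0 T, IsDensity (ρ t)
  finite_energy : Integrable (fun p : ℝ × Rd d => ‖v p.1 p.2‖ ^ 2 * ρ p.1 p.2) (slab d T)
  equation : SolvesFokkerPlanck T β ρ₀ q ρ v

/-- The kinetic energy `∫₀ᵀ ∫ ½ ‖v(t,x)‖² ρ(t,x) dx dt`. -/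
def kineticEnergy {d : ℕ} (T : ℝ) (ρ : ℝ → Rd d → ℝ) (v : ℝ → Rd d → Rd d) : ℝ :=
  ∫ p, (1 / 2) * ‖v p.1 p.2‖ ^ 2 * ρ p.1 p.2 ∂(slab d T)

/-- `ρT` is a regularized Wasserstein proximal density of `ρ₀` for the energy `𝓕` with domain `D`
(the energy counts as `+∞` off `D`; a real-valued energy on `P2 d` has `D = P2 d`): it is the
terminal density of a minimizer `(ρ, v, ρT)` of the mean-field control problem
`inf ∫₀ᵀ ∫ ½ ‖v‖² ρ dx dt + 𝓕(q)`. -/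
def IsRegWProx {d : ℕ} (T β : ℝ) (ρ₀ : Rd d → ℝ) (D : Set (Rd d → ℝ))
    (𝓕 : (Rd d → ℝ) → ℝ) (ρT : Rd d → ℝ) : Prop :=
  ρT ∈ D ∧ ∃ (ρ : ℝ → Rd d → ℝ) (v : ℝ → Rd d → Rd d),
    IsAdmissible T β ρ₀ ρT ρ v ∧
    ∀ (q : Rd d → ℝ) (ρ' : ℝ → Rd d → ℝ) (v' : ℝ → Rd d → Rd d),
      q ∈ D → IsAdmissible T β ρ₀ q ρ' v' →
      kineticEnergy T ρ v + 𝓕 ρT ≤ kineticEnergy T ρ' v' + 𝓕 q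

/-- `f` is an `L²` first variation `δ𝓕/δρ (ρ)` of `𝓕 : D → ℝ` at `ρ`: for each bounded `q` in
`P2 d`, the segment from `ρ` to `q` stays in `D` for a short time, and
`d/dε 𝓕(ρ + ε (q - ρ)) = ∫ f (q - ρ) dx` at `ε = 0⁺`. -/
structure IsFirstVariation {d : ℕ} (D : Set (Rd d → ℝ)) (𝓕 : (Rd d → ℝ) → ℝ)
    (ρ : Rd d → ℝ) (f : Rd d → ℝ) : Prop where
  measurable : Measurable f
  integrable_self : Integrable (fun x => f x * ρ x)
  integrable : ∀ q ∈ P2 d, (∃ M, ∀ x, q x ≤ M) → Integrable (fun x => f x * q x)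
  segment_mem : ∀ q ∈ P2 d, (∃ M, ∀ x, q x ≤ M) →
    ∀ᶠ ε in 𝓝[>] (0 : ℝ), (fun x => (1 - ε) * ρ x + ε * q x) ∈ D
  hasDeriv : ∀ q ∈ P2 d, (∃ M, ∀ x, q x ≤ M) →
    HasDerivWithinAt (fun ε : ℝ => 𝓕 (fun x => (1 - ε) * ρ x + ε * q x))
      (∫ x, f x * (q x - ρ x)) (Ici 0) 0

/-- The unnormalized Gibbs weight `exp (-(F(x, ρ) + ‖x - y‖² / (2T)) / (2β))`. -/
def gibbsWeight {d : ℕ} (F : Rd d → (Rd d → ℝ) → ℝ) (x y : Rd d) (β T : ℝ)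
    (ρ : Rd d → ℝ) : ℝ :=
  Real.exp (-(1 / (2 * β)) * (F x ρ + ‖x - y‖ ^ 2 / (2 * T)))

/-- The Gibbs kernel `K(x, y, β, T, ρ)`. -/
def gibbsKernel {d : ℕ} (F : Rd d → (Rd d → ℝ) → ℝ) (x y : Rd d) (β T : ℝ)
    (ρ : Rd d → ℝ) : ℝ :=
  gibbsWeight F x y β T ρ / ∫ z, gibbsWeight F z y β T ρ

/-- Sum of a potential, an interaction and an internal energy. -/
def pwuEnergy {d : ℕ} (V W : Rd d → ℝ) (U : ℝ → ℝ) (ρ : Rd d → ℝ) : ℝ :=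
  (∫ x, V x * ρ x) + (1 / 2) * (∫ x, ∫ y, W (x - y) * ρ x * ρ y) + ∫ x, U (ρ x)

/-- The function `V(x) + (W * ρ)(x) + U'(ρ(x))`. -/
def pwuVariation {d : ℕ} (V W : Rd d → ℝ) (U : ℝ → ℝ) (x : Rd d) (ρ : Rd d → ℝ) : ℝ :=
  V x + (∫ y, W (x - y) * ρ y) + deriv U (ρ x)

/-- Densities in `P2 d` that lie in `L^(p+1)`; for `p = 0` this is all of `P2 d`. -/
def P2Lp (d : ℕ) (p : ℝ) : Set (Rd d → ℝ) :=
  {ρ | ρ ∈ P2 d ∧ Integrable (fun x => ρ x ^ (p + 1))}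

end WProx

end

/-!
The argument is a duality argument for the control problem, with the Hopf-Cole transform in the
place of an optimal pair of multipliers; no existence theory for curves of measures is needed.

*Lower bound.* For a positive trigonometric polynomial `w`, the bounded solution `h` of
`∂ₜh + β Δh = 0` with `h(T) = w` is explicit, and `φ = 2β log h` solves the Hamilton-Jacobi equation
`∂ₜφ + ½ ‖∇φ‖² + β Δφ = 0`. Testing the Fokker-Planck equation of an arbitrary admissible triple
`(ρ, v, q)` with `φ` and using `⟪v, ∇φ⟫ ≤ ½ ‖v‖² + ½ ‖∇φ‖²` gives
`∫ φ(T) q - ∫ φ(0) ρ₀ ≤ ∫∫ ½ ‖v‖² ρ` (`IsAdmissible.le_kineticEnergy`). Cutoff functions extend the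
weak formulation to such bounded test functions (`SolvesFokkerPlanck.integral_testOp`).

*Competitor.* The curve `h(t) · e^{tβΔ}(ρ₀ / h(0))` with the field `∇φ` is admissible, ends at the
Gibbs density of `w`, and attains the bound (`exists_isAdmissible_gibbsDensity`).

*First-order condition.* Mixing a minimizer with a competitor, `(1 - ε) ρ + ε ρ'` with the averaged
momentum, keeps the Fokker-Planck equation and does not raise the kinetic energy above the convex
combination (`IsAdmissible.exists_mix`). Hence the minimizer also minimizes the kinetic energy plus
`∫ f q`, with `f` the first variation (`first_order_condition`). Together with the lower bound for a
weight `w'` and the competitor for a weight `w` this is an inequality between two weights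
(`TwoWeightBound`), which passes by approximation to all measurable weights that are bounded and
bounded away from zero (`TwoWeightBound.of_trigPoly`).

*Identification.* The formula says that `ρT` is the Gibbs density `π` of `exp (-f / (2β))`, which
need be neither bounded nor bounded away from zero. Let `g_N` be `-f / (2β)` clipped to `[-N, N]`,
and compare `w = exp g_N` with `w' = exp (g_N + s 1_A)`. As `N → ∞` the terms with `f + 2β g_N`
vanish, and then `s → 0` gives `∫_A ρT ≤ ∫_A π` (`setIntegral_le_of_twoWeightBound`). Since both are
probability densities, they agree almost everywhere (`ae_eq_of_twoWeightBound`). The clipping from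
below matters: where `f + 2β g_N > 0` the weight equals its minimum, so that the Gibbs density of
`w` is at most the heat flow of `ρ₀`, against which `f` is integrable.

For potential, interaction and internal energies the first variation is computed directly, the
internal energy by dominated convergence (`hasDerivWithinAt_internal`).
-/

noncomputable section

namespace WProx

/-! ### The Gaussian density and the heat kernel -/

/-- The fundamental solution of `∂ₜu = β Δu` at time `1`: the centred Gaussian density with
covariance `2 β` times the identity. -/
def gaussDensity {d : ℕ} (β : ℝ) (z : Rd d) : ℝ :=
  Real.exp (-(1 / (4 * β)) * ‖z‖ ^ 2) / ∫ y : Rd d, Real.exp (-(1 / (4 * β)) * ‖y‖ ^ 2)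

/-- The fundamental solution of `∂ₜu = β Δu` at time `t > 0`, obtained from time `1` by
parabolic scaling. -/
def heatKernel {d : ℕ} (β t : ℝ) (x : Rd d) : ℝ :=
  (√t ^ d)⁻¹ * gaussDensity β ((√t)⁻¹ • x)

section Gauss

variable {d : ℕ} {β : ℝ}

lemma integrable_exp_neg_mul_sq_norm {b : ℝ} (hb : 0 < b) :
    Integrable (fun z : Rd d => Real.exp (-b * ‖z‖ ^ 2)) := by
  have h := (GaussianFourier.integrable_cexp_neg_mul_sq_norm_add (V := Rd d)
    (b := (b : ℂ)) (by simpa using hb) 0 0).norm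
  refine h.congr (Eventually.of_forall fun z => ?_)
  simp only [Complex.norm_exp]
  congr 1
  simp [← Complex.ofReal_pow]

lemma integral_exp_neg_mul_sq_norm_pos {b : ℝ} (hb : 0 < b) :
    0 < ∫ z : Rd d, Real.exp (-b * ‖z‖ ^ 2) := by
  rw [GaussianFourier.integral_rexp_neg_mul_sq_norm hb]
  positivity

lemma gaussDensity_pos (hβ : 0 < β) (z : Rd d) : 0 < gaussDensity β z :=
  div_pos (Real.exp_pos _) (integral_exp_neg_mul_sq_norm_pos (by positivity))

lemma continuous_gaussDensity : Continuous (gaussDensity β : Rd d → ℝ) := by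
  unfold gaussDensity
  fun_prop

lemma integrable_gaussDensity (hβ : 0 < β) : Integrable (gaussDensity β : Rd d → ℝ) :=
  (integrable_exp_neg_mul_sq_norm (by positivity)).div_const _

lemma integral_gaussDensity (hβ : 0 < β) : ∫ z : Rd d, gaussDensity β z = 1 := by
  unfold gaussDensity
  rw [integral_div]
  exact div_self (integral_exp_neg_mul_sq_norm_pos (by positivity)).ne'

lemma gaussDensity_le (hβ : 0 < β) (z : Rd d) : gaussDensity β z ≤ gaussDensity β (0 : Rd d) := by
  unfold gaussDensity
  refine div_le_div_of_nonneg_right ?_ (integral_exp_neg_mul_sq_norm_pos (by positivity)).le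
  apply Real.exp_le_exp.2
  have : 0 ≤ 1 / (4 * β) * ‖z‖ ^ 2 := by positivity
  simpa using this

lemma gaussDensity_neg (z : Rd d) : gaussDensity β (-z) = gaussDensity β z := by
  simp [gaussDensity]

lemma integrable_sq_norm_mul_gaussDensity (hβ : 0 < β) :
    Integrable (fun z : Rd d => ‖z‖ ^ 2 * gaussDensity β z) := by
  set b : ℝ := 1 / (4 * β) with hb
  have hbpos : 0 < b := by positivity
  have h := (integrable_exp_neg_mul_sq_norm (d := d) (half_pos hbpos)).const_mul
    (2 / b / ∫ y : Rd d, Real.exp (-b * ‖y‖ ^ 2))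
  refine h.mono' (by
    have := continuous_gaussDensity (d := d) (β := β)
    exact (by fun_prop : Continuous fun z : Rd d => ‖z‖ ^ 2 * gaussDensity β z).aestronglyMeasurable)
    (Eventually.of_forall fun z => ?_)
  have hI := integral_exp_neg_mul_sq_norm_pos (d := d) hbpos
  rw [Real.norm_of_nonneg (mul_nonneg (by positivity) (gaussDensity_pos hβ z).le)]
  unfold gaussDensity
  rw [← hb, ← mul_div_assoc, div_mul_eq_mul_div]
  refine div_le_div_of_nonneg_right ?_ hI.le
  have h1 : Real.exp (-b * ‖z‖ ^ 2)
      = Real.exp (-(b / 2) * ‖z‖ ^ 2) * Real.exp (-(b / 2) * ‖z‖ ^ 2) := by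
    rw [← Real.exp_add]; congr 1; ring
  rw [h1, ← mul_assoc]
  refine mul_le_mul_of_nonneg_right ?_ (Real.exp_pos _).le
  have h2 := Real.add_one_le_exp (b / 2 * ‖z‖ ^ 2)
  have h3 : Real.exp (-(b / 2) * ‖z‖ ^ 2) * Real.exp (b / 2 * ‖z‖ ^ 2) = 1 := by
    rw [← Real.exp_add]; simp
  have h4 := Real.exp_pos (-(b / 2) * ‖z‖ ^ 2)
  have h5 : (b / 2 * ‖z‖ ^ 2) * Real.exp (-(b / 2) * ‖z‖ ^ 2) ≤ 1 := by nlinarith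
  have h6 : ‖z‖ ^ 2 * Real.exp (-(b / 2) * ‖z‖ ^ 2)
      = 2 / b * ((b / 2 * ‖z‖ ^ 2) * Real.exp (-(b / 2) * ‖z‖ ^ 2)) := by
    field_simp
  rw [h6]
  have : 0 < 2 / b := by positivity
  nlinarith

lemma integrable_norm_mul_gaussDensity (hβ : 0 < β) :
    Integrable (fun z : Rd d => ‖z‖ * gaussDensity β z) := by
  have h := (integrable_gaussDensity (d := d) hβ).add (integrable_sq_norm_mul_gaussDensity hβ)
  refine h.mono' (by
    have := continuous_gaussDensity (d := d) (β := β)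
    exact (by fun_prop : Continuous fun z : Rd d => ‖z‖ * gaussDensity β z).aestronglyMeasurable)
    (Eventually.of_forall fun z => ?_)
  have hp := gaussDensity_pos hβ z
  rw [Real.norm_of_nonneg (by positivity)]
  simp only [Pi.add_apply]
  nlinarith [sq_nonneg (‖z‖ - 1), mul_nonneg (sq_nonneg (‖z‖ - 1)) hp.le, norm_nonneg z]

lemma hasFDerivAt_gaussDensity (z : Rd d) :
    HasFDerivAt (gaussDensity β : Rd d → ℝ)
      ((-(1 / (2 * β)) * gaussDensity β z) • innerSL ℝ z) z := by
  have h := (((hasStrictFDerivAt_norm_sq z).hasFDerivAt.const_mul (-(1 / (4 * β)))).exp).mul_const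
    (∫ y : Rd d, Real.exp (-(1 / (4 * β)) * ‖y‖ ^ 2))⁻¹
  refine (h.congr_fderiv ?_).congr_of_eventuallyEq (Eventually.of_forall fun y => ?_)
  · ext y
    simp only [gaussDensity, smul_apply, smul_eq_mul, nsmul_eq_mul]
    simp only [innerSL_apply_apply]
    push_cast
    generalize (∫ y : Rd d, Real.exp (-(1 / (4 * β)) * ‖y‖ ^ 2)) = I
    by_cases hβ : β = 0
    · simp [hβ]
    · field_simp
      ring_nf
  · simp [gaussDensity, div_eq_mul_inv]

lemma heatKernel_pos (hβ : 0 < β) {t : ℝ} (ht : 0 < t) (x : Rd d) : 0 < heatKernel β t x :=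
  mul_pos (by positivity) (gaussDensity_pos hβ _)

lemma heatKernel_nonneg (hβ : 0 < β) (t : ℝ) (x : Rd d) : 0 ≤ heatKernel β t x :=
  mul_nonneg (by positivity) (gaussDensity_pos hβ _).le

lemma continuous_heatKernel (t : ℝ) : Continuous (heatKernel β t : Rd d → ℝ) := by
  have := continuous_gaussDensity (d := d) (β := β)
  unfold heatKernel
  fun_prop

lemma measurable_heatKernel :
    Measurable (fun p : ℝ × Rd d => heatKernel β p.1 p.2) := by
  have := (continuous_gaussDensity (d := d) (β := β)).measurable
  unfold heatKernel
  fun_prop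

lemma heatKernel_le (hβ : 0 < β) (t : ℝ) (x : Rd d) :
    heatKernel β t x ≤ (√t ^ d)⁻¹ * gaussDensity β (0 : Rd d) :=
  mul_le_mul_of_nonneg_left (gaussDensity_le hβ _) (by positivity)

lemma heatKernel_sub_comm (t : ℝ) (x y : Rd d) :
    heatKernel β t (x - y) = heatKernel β t (y - x) := by
  unfold heatKernel
  rw [← neg_sub y x, smul_neg, gaussDensity_neg]

/-- The affine substitution `x = y + √t z` turns the heat kernel into the fixed density
`gaussDensity β`. -/
lemma integral_mul_heatKernel {t : ℝ} (ht : 0 < t) (f : Rd d → ℝ) (y : Rd d) :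
    ∫ x, f x * heatKernel β t (x - y) = ∫ z, f (y + √t • z) * gaussDensity β z := by
  have hs : 0 < √t := Real.sqrt_pos.2 ht
  have h1 := integral_add_right_eq_self (μ := (volume : Measure (Rd d)))
    (fun x => f x * heatKernel β t (x - y)) y
  have h2 := Measure.integral_comp_smul (volume : Measure (Rd d))
    (fun x => f (x + y) * heatKernel β t (x + y - y)) (√t)
  rw [← h1]
  simp only [finrank_euclideanSpace, Fintype.card_fin, smul_eq_mul] at h2
  have hp : 0 < √t ^ d := by positivity
  rw [abs_of_pos (by positivity)] at h2
  have h3 : ∫ z, f (y + √t • z) * gaussDensity β z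
      = √t ^ d * ∫ x, f (√t • x + y) * heatKernel β t (√t • x + y - y) := by
    rw [← integral_const_mul]
    congr 1 with z
    simp only [heatKernel, add_sub_cancel_right, smul_smul, inv_mul_cancel₀ hs.ne', one_smul,
      add_comm y]
    field_simp
  rw [h3, h2, ← mul_assoc, mul_inv_cancel₀ hp.ne', one_mul]

lemma integrable_mul_heatKernel_iff {t : ℝ} (ht : 0 < t) (f : Rd d → ℝ) (y : Rd d) :
    Integrable (fun x => f x * heatKernel β t (x - y)) ↔
      Integrable (fun z => f (y + √t • z) * gaussDensity β z) := by
  have hs : 0 < √t := Real.sqrt_pos.2 ht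
  rw [← (measurePreserving_add_right (volume : Measure (Rd d)) y).integrable_comp_emb
      (measurableEmbedding_addRight y),
    ← integrable_comp_smul_iff (volume : Measure (Rd d)) _ hs.ne',
    ← integrable_const_mul_iff (c := √t ^ d) (isUnit_iff_ne_zero.2 (by positivity))]
  refine iff_of_eq (congrArg (fun g => Integrable g volume) ?_)
  ext z
  simp only [heatKernel, Function.comp_apply, add_sub_cancel_right, smul_smul,
    inv_mul_cancel₀ hs.ne', one_smul, add_comm y]
  field_simp

lemma integrable_heatKernel (hβ : 0 < β) {t : ℝ} (ht : 0 < t) (y : Rd d) :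
    Integrable (fun x : Rd d => heatKernel β t (x - y)) := by
  have := (integrable_mul_heatKernel_iff (β := β) ht (fun _ => 1) y).2
    (by simpa using integrable_gaussDensity hβ)
  simpa using this

lemma integral_heatKernel (hβ : 0 < β) {t : ℝ} (ht : 0 < t) (y : Rd d) :
    ∫ x : Rd d, heatKernel β t (x - y) = 1 := by
  have := integral_mul_heatKernel (β := β) ht (fun _ => 1) y
  simpa [integral_gaussDensity hβ] using this

end Gauss

/-! ### Derivatives of smooth functions of time and space -/

section SpaceTime

variable {d : ℕ} {φ : ℝ → Rd d → ℝ}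

lemma contDiff_slice_space (h : ContDiff ℝ ∞ (Function.uncurry φ)) (t : ℝ) :
    ContDiff ℝ ∞ (φ t) :=
  h.comp (contDiff_const.prodMk contDiff_id)

lemma contDiff_slice_time (h : ContDiff ℝ ∞ (Function.uncurry φ)) (x : Rd d) :
    ContDiff ℝ ∞ (fun s => φ s x) :=
  h.comp (contDiff_id.prodMk contDiff_const)

lemma fderiv_slice_space (h : ContDiff ℝ ∞ (Function.uncurry φ)) (t : ℝ) (x v : Rd d) :
    fderiv ℝ (φ t) x v = fderiv ℝ (Function.uncurry φ) (t, x) (0, v) := by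
  have h1 := (h.differentiable (by simp) (t, x)).hasFDerivAt
  have h2 : HasFDerivAt (fun y : Rd d => (t, y)) (ContinuousLinearMap.inr ℝ ℝ (Rd d)) x :=
    hasFDerivAt_prodMk_right t x
  have h3 := h1.comp x h2
  rw [show (φ t) = Function.uncurry φ ∘ fun y => (t, y) from rfl, h3.fderiv]
  simp

lemma deriv_slice_time (h : ContDiff ℝ ∞ (Function.uncurry φ)) (t : ℝ) (x : Rd d) :
    deriv (fun s => φ s x) t = fderiv ℝ (Function.uncurry φ) (t, x) (1, 0) := by
  have h1 := (h.differentiable (by simp) (t, x)).hasFDerivAt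
  have h2 : HasDerivAt (fun s : ℝ => (s, x)) ((1 : ℝ), (0 : Rd d)) t :=
    (hasDerivAt_id t).prodMk (hasDerivAt_const t x)
  exact (h1.comp_hasDerivAt t h2).deriv

lemma inner_gradient_eq_fderiv (g : Rd d → ℝ) (x v : Rd d) :
    inner ℝ v (gradient g x) = fderiv ℝ g x v := by
  rw [real_inner_comm, gradient, InnerProductSpace.toDual_symm_apply]

lemma norm_gradient (g : Rd d → ℝ) (x : Rd d) : ‖gradient g x‖ = ‖fderiv ℝ g x‖ := by
  rw [gradient, LinearIsometryEquiv.norm_map]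

/-- The Laplacian as the sum of the pure second partial derivatives. -/
lemma laplacian_eq_sum_fderiv {g : Rd d → ℝ} (hg : ContDiff ℝ ∞ g) (x : Rd d) :
    Laplacian.laplacian g x = ∑ i, fderiv ℝ
      (fun y => fderiv ℝ g y (EuclideanSpace.basisFun (Fin d) ℝ i)) x
        (EuclideanSpace.basisFun (Fin d) ℝ i) := by
  rw [laplacian_eq_iteratedFDeriv_orthonormalBasis g (EuclideanSpace.basisFun (Fin d) ℝ)]
  refine Finset.sum_congr rfl fun i _ => ?_
  rw [iteratedFDeriv_two_apply]
  have hd : DifferentiableAt ℝ (fderiv ℝ g) x :=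
    (hg.fderiv_right (m := ∞) (by simp)).differentiable (by simp) x
  simp only [Matrix.cons_val_zero, Matrix.cons_val_one]
  rw [fderiv_clm_apply hd (differentiableAt_const _)]
  simp

lemma contDiff_fderiv_apply {E : Type*} [NormedAddCommGroup E] [NormedSpace ℝ E] {g : E → ℝ}
    (hg : ContDiff ℝ ∞ g) (v : E) : ContDiff ℝ ∞ (fun y => fderiv ℝ g y v) :=
  (hg.fderiv_right (m := ∞) (by simp)).clm_apply contDiff_const

lemma contDiff_deriv_time (h : ContDiff ℝ ∞ (Function.uncurry φ)) :
    ContDiff ℝ ∞ (fun p : ℝ × Rd d => deriv (fun s => φ s p.2) p.1) := by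
  simp_rw [deriv_slice_time h]
  exact contDiff_fderiv_apply h _

lemma contDiff_fderiv_space_apply (h : ContDiff ℝ ∞ (Function.uncurry φ)) (v : Rd d) :
    ContDiff ℝ ∞ (Function.uncurry fun t x => fderiv ℝ (φ t) x v) := by
  simp_rw [fderiv_slice_space h]
  exact contDiff_fderiv_apply h _

lemma continuous_fderiv_space (h : ContDiff ℝ ∞ (Function.uncurry φ)) :
    Continuous (fun p : ℝ × Rd d => fderiv ℝ (φ p.1) p.2) := by
  have h1 : (fun p : ℝ × Rd d => fderiv ℝ (φ p.1) p.2) = fun p =>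
      (fderiv ℝ (Function.uncurry φ) p).comp (ContinuousLinearMap.inr ℝ ℝ (Rd d)) := by
    ext p v
    simp [fderiv_slice_space h]
  rw [h1]
  exact (h.continuous_fderiv (by simp)).clm_comp continuous_const

lemma continuous_gradient_space (h : ContDiff ℝ ∞ (Function.uncurry φ)) :
    Continuous (fun p : ℝ × Rd d => gradient (φ p.1) p.2) :=
  (InnerProductSpace.toDual ℝ (Rd d)).symm.continuous.comp (continuous_fderiv_space h)

lemma continuous_laplacian_space (h : ContDiff ℝ ∞ (Function.uncurry φ)) :
    Continuous (fun p : ℝ × Rd d => Laplacian.laplacian (φ p.1) p.2) := by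
  simp_rw [laplacian_eq_sum_fderiv (contDiff_slice_space h _)]
  refine continuous_finsetSum _ fun i _ => ?_
  exact (contDiff_fderiv_space_apply
    (contDiff_fderiv_space_apply h (EuclideanSpace.basisFun (Fin d) ℝ i)) _).continuous

/-- A smooth compactly supported function of time and space is bounded together with its time
derivative, its spatial derivative, its pure second spatial derivatives and its Laplacian. -/
lemma exists_bound_of_hasCompactSupport (h : ContDiff ℝ ∞ (Function.uncurry φ))
    (hc : HasCompactSupport (Function.uncurry φ)) :
    ∃ M, ∀ t x, |φ t x| ≤ M ∧ |deriv (fun s => φ s x) t| ≤ M ∧ ‖fderiv ℝ (φ t) x‖ ≤ M ∧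
      |Laplacian.laplacian (φ t) x| ≤ M ∧
      ∀ i, |fderiv ℝ (fun y => fderiv ℝ (φ t) y (EuclideanSpace.basisFun (Fin d) ℝ i)) x
        (EuclideanSpace.basisFun (Fin d) ℝ i)| ≤ M := by
  obtain ⟨M₁, h₁⟩ := hc.exists_bound_of_continuous h.continuous
  obtain ⟨M₂, h₂⟩ := (hc.fderiv (𝕜 := ℝ)).exists_bound_of_continuous
    (h.continuous_fderiv (by simp))
  have key : ∀ v : Rd d, HasCompactSupport (Function.uncurry fun t x => fderiv ℝ (φ t) x v) := by
    intro v
    have : (Function.uncurry fun t x => fderiv ℝ (φ t) x v)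
        = fun p => fderiv ℝ (Function.uncurry φ) p (0, v) := by
      ext p; simp [Function.uncurry_def, fderiv_slice_space h]
    rw [this]
    exact hc.fderiv_apply (𝕜 := ℝ) _
  have key2 : ∀ i, ∃ M, ∀ t x, |fderiv ℝ
      (fun y => fderiv ℝ (φ t) y (EuclideanSpace.basisFun (Fin d) ℝ i)) x
        (EuclideanSpace.basisFun (Fin d) ℝ i)| ≤ M := by
    intro i
    have hs := contDiff_fderiv_space_apply h (EuclideanSpace.basisFun (Fin d) ℝ i)
    obtain ⟨M, hM⟩ := ((key (EuclideanSpace.basisFun (Fin d) ℝ i)).fderiv_apply (𝕜 := ℝ)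
      (0, EuclideanSpace.basisFun (Fin d) ℝ i)).exists_bound_of_continuous
        (contDiff_fderiv_apply hs _).continuous
    refine ⟨M, fun t x => ?_⟩
    rw [fderiv_slice_space (φ := fun t y => fderiv ℝ (φ t) y _) hs]
    exact hM (t, x)
  choose M₃ h₃ using key2
  have hM₃ : ∀ i, 0 ≤ M₃ i := fun i => (abs_nonneg _).trans (h₃ i 0 0)
  have hM₁ : 0 ≤ M₁ := (norm_nonneg _).trans (h₁ (0, 0))
  have hM₂ : 0 ≤ M₂ := (norm_nonneg _).trans (h₂ (0, 0))
  have hS : 0 ≤ ∑ i, M₃ i := Finset.sum_nonneg fun i _ => hM₃ i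
  refine ⟨M₁ + M₂ + ∑ i, M₃ i, fun t x => ⟨?_, ?_, ?_, ?_, ?_⟩⟩
  · have := h₁ (t, x)
    simp only [Function.uncurry_apply_pair, Real.norm_eq_abs] at this
    linarith
  · rw [deriv_slice_time h]
    have h4 := (fderiv ℝ (Function.uncurry φ) (t, x)).le_of_opNorm_le (h₂ (t, x)) (1, 0)
    simp only [Prod.norm_mk, norm_zero, norm_one, Real.norm_eq_abs] at h4
    norm_num at h4
    linarith
  · refine (ContinuousLinearMap.opNorm_le_bound _ hM₂ fun v => ?_).trans
      (by linarith : M₂ ≤ _)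
    rw [fderiv_slice_space h]
    have h4 := (fderiv ℝ (Function.uncurry φ) (t, x)).le_of_opNorm_le (h₂ (t, x)) (0, v)
    simpa [Prod.norm_mk] using h4
  · rw [laplacian_eq_sum_fderiv (contDiff_slice_space h _)]
    refine (Finset.abs_sum_le_sum_abs _ _).trans ?_
    have := Finset.sum_le_sum fun i (_ : i ∈ Finset.univ) => h₃ i t x
    linarith
  · intro i
    have h5 := Finset.single_le_sum (fun i _ => hM₃ i) (Finset.mem_univ i)
    exact (h₃ i t x).trans (by linarith)

end SpaceTime

/-! ### The heat kernel is a weak solution of the heat equation -/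

section Heat

variable {d : ℕ} {β T : ℝ}

/-- Gaussian integration by parts. -/
lemma integral_fderiv_apply_self_mul_gaussDensity (hβ : 0 < β) {g : Rd d → ℝ}
    (hg : ContDiff ℝ ∞ g) {M : ℝ} (h1 : ∀ x, ‖fderiv ℝ g x‖ ≤ M)
    (h2 : ∀ x i, |fderiv ℝ (fun y => fderiv ℝ g y (EuclideanSpace.basisFun (Fin d) ℝ i)) x
        (EuclideanSpace.basisFun (Fin d) ℝ i)| ≤ M) (y : Rd d) (s : ℝ) :
    ∫ z, fderiv ℝ g (y + s • z) z * gaussDensity β z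
      = 2 * β * s * ∫ z, Laplacian.laplacian g (y + s • z) * gaussDensity β z := by
  set e := EuclideanSpace.basisFun (Fin d) ℝ with he
  have hne : ∀ i, ‖e i‖ = 1 := fun i => e.orthonormal.norm_eq_one i
  set a : Fin d → Rd d → ℝ := fun i z => fderiv ℝ g (y + s • z) (e i) with ha
  have hcg : Continuous (gaussDensity β : Rd d → ℝ) := continuous_gaussDensity
  have hG := integrable_gaussDensity (d := d) hβ
  have hnG := integrable_norm_mul_gaussDensity (d := d) hβ
  have hb : ∀ i, ContDiff ℝ ∞ fun x => fderiv ℝ g x (e i) := fun i => contDiff_fderiv_apply hg _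
  have haff : ContDiff ℝ ∞ fun z : Rd d => y + s • z := by fun_prop
  have hac : ∀ i, ContDiff ℝ ∞ (a i) := fun i => (hb i).comp haff
  have habd : ∀ i z, |a i z| ≤ M := fun i z => by
    have := (fderiv ℝ g (y + s • z)).le_of_opNorm_le (h1 _) (e i)
    simpa [hne] using this
  have hda : ∀ i z, fderiv ℝ (a i) z (e i)
      = s * fderiv ℝ (fun x => fderiv ℝ g x (e i)) (y + s • z) (e i) := by
    intro i z
    have h3 : HasFDerivAt (fun z : Rd d => y + s • z) (s • ContinuousLinearMap.id ℝ (Rd d)) z :=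
      ((hasFDerivAt_id z).const_smul s).const_add y
    have h4 := (((hb i).differentiable (by simp) (y + s • z)).hasFDerivAt.comp z h3).fderiv
    change fderiv ℝ (a i) z = _ at h4
    rw [h4]
    simp
  have hdg : ∀ i (z : Rd d), fderiv ℝ (gaussDensity β) z (e i)
      = -(1 / (2 * β)) * (gaussDensity β z * z i) := by
    intro i z
    rw [(hasFDerivAt_gaussDensity z).fderiv]
    simp only [smul_apply, innerSL_apply_apply, smul_eq_mul, he,
      EuclideanSpace.basisFun_apply]
    rw [EuclideanSpace.inner_single_right]
    simp
    ring
  have hzi : ∀ (z : Rd d) i, |z i| ≤ ‖z‖ := fun z i => PiLp.norm_apply_le z i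
  have hM : 0 ≤ M := (norm_nonneg _).trans (h1 0)
  have hint1 : ∀ i, Integrable (fun z => a i z * (gaussDensity β z * z i)) := by
    intro i
    refine (hnG.const_mul M).mono' ?_ (Eventually.of_forall fun z => ?_)
    · have := (hac i).continuous
      exact (by fun_prop : Continuous fun z => a i z * (gaussDensity β z * z i)).aestronglyMeasurable
    · have hp := gaussDensity_pos hβ z
      rw [norm_mul, norm_mul, Real.norm_of_nonneg hp.le, mul_comm (gaussDensity β z)]
      refine mul_le_mul (habd i z) (mul_le_mul_of_nonneg_right (hzi z i) hp.le) (by positivity) hM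
  have hint2 : ∀ i, Integrable (fun z => fderiv ℝ (fun x => fderiv ℝ g x (e i)) (y + s • z) (e i)
      * gaussDensity β z) := by
    intro i
    refine (hG.const_mul M).mono' ?_ (Eventually.of_forall fun z => ?_)
    · have := ((contDiff_fderiv_apply (hb i) (e i)).comp haff).continuous
      exact (this.mul hcg).aestronglyMeasurable
    · have hp := gaussDensity_pos hβ z
      rw [norm_mul, Real.norm_of_nonneg hp.le]
      exact mul_le_mul_of_nonneg_right (h2 _ i) hp.le
  have hint3 : ∀ i, Integrable (fun z => a i z * gaussDensity β z) := by
    intro i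
    refine (hG.const_mul M).mono' ((hac i).continuous.mul hcg).aestronglyMeasurable
      (Eventually.of_forall fun z => ?_)
    have hp := gaussDensity_pos hβ z
    rw [norm_mul, Real.norm_of_nonneg hp.le]
    exact mul_le_mul_of_nonneg_right (habd i z) hp.le
  have hibp : ∀ i, ∫ z, a i z * (gaussDensity β z * z i)
      = 2 * β * s * ∫ z, fderiv ℝ (fun x => fderiv ℝ g x (e i)) (y + s • z) (e i)
        * gaussDensity β z := by
    intro i
    have h3 := integral_mul_fderiv_eq_neg_fderiv_mul_of_integrable (μ := (volume : Measure (Rd d)))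
      (f := a i) (g := gaussDensity β) (v := e i)
      (by simp_rw [hda, mul_assoc]; exact (hint2 i).const_mul s)
      (by simp_rw [hdg, mul_left_comm (a i _) (-(1 / (2 * β)))]; exact (hint1 i).const_mul _)
      (hint3 i) (fun z _ => (hac i).differentiable (by simp) z)
      (fun z _ => (hasFDerivAt_gaussDensity z).differentiableAt)
    simp_rw [hda, hdg, mul_left_comm (a i _) (-(1 / (2 * β))), mul_assoc s] at h3
    rw [integral_const_mul, integral_const_mul] at h3
    have h4 : ∫ z, a i z * (gaussDensity β z * z i)
        = -(2 * β) * (-(1 / (2 * β)) * ∫ z, a i z * (gaussDensity β z * z i)) := by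
      field_simp
    rw [h4, h3]
    ring
  have hexp : ∀ z, fderiv ℝ g (y + s • z) z * gaussDensity β z
      = ∑ i, a i z * (gaussDensity β z * z i) := by
    intro z
    have hz : z = ∑ i, z i • e i := by
      conv_lhs => rw [← e.sum_repr z]
      simp [he]
    conv_lhs => rw [show fderiv ℝ g (y + s • z) z
      = fderiv ℝ g (y + s • z) (∑ i, z i • e i) from by rw [← hz]]
    rw [map_sum, Finset.sum_mul]
    refine Finset.sum_congr rfl fun i _ => ?_
    simp only [map_smul, smul_eq_mul, ha]
    ring
  simp_rw [hexp, laplacian_eq_sum_fderiv hg, Finset.sum_mul]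
  rw [integral_finsetSum _ fun i _ => hint1 i, integral_finsetSum _ fun i _ => hint2 i,
    Finset.mul_sum]
  exact Finset.sum_congr rfl fun i _ => hibp i

lemma integrable_heatKernel_slab (hβ : 0 < β) (y : Rd d) :
    Integrable (fun p : ℝ × Rd d => heatKernel β p.1 (p.2 - y)) (slab d T) := by
  have hm : Measurable (fun p : ℝ × Rd d => heatKernel β p.1 (p.2 - y)) :=
    measurable_heatKernel.comp (measurable_fst.prodMk (measurable_snd.sub_const y))
  have hae : ∀ᵐ t ∂(volume.restrict (Icc (0 : ℝ) T)), 0 < t := by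
    rw [ae_restrict_iff' measurableSet_Icc]
    have : ∀ᵐ t : ℝ, t ≠ 0 := by simp [ae_iff, measure_singleton]
    filter_upwards [this] with t h0 ht using lt_of_le_of_ne ht.1 (Ne.symm h0)
  rw [slab, integrable_prod_iff hm.aestronglyMeasurable]
  refine ⟨?_, ?_⟩
  · filter_upwards [hae] with t ht using integrable_heatKernel hβ ht y
  · refine (integrable_const (1 : ℝ)).congr ?_
    filter_upwards [hae] with t ht
    simp_rw [Real.norm_of_nonneg (heatKernel_nonneg hβ _ _)]
    exact (integral_heatKernel hβ ht y).symm

/-- The heat flow issued from a point mass solves the heat equation in the weak sense. -/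
lemma heatKernel_weak_solution (hβ : 0 < β) (hT : 0 < T) {θ : ℝ → Rd d → ℝ}
    (h : ContDiff ℝ ∞ (Function.uncurry θ)) (hc : HasCompactSupport (Function.uncurry θ))
    (y : Rd d) :
    (∫ x, θ T x * heatKernel β T (x - y)) - θ 0 y =
      ∫ p, (deriv (fun s => θ s p.2) p.1 + β * Laplacian.laplacian (θ p.1) p.2)
        * heatKernel β p.1 (p.2 - y) ∂(slab d T) := by
  obtain ⟨M, hM⟩ := exists_bound_of_hasCompactSupport h hc
  have hM0 : 0 ≤ M := (abs_nonneg _).trans (hM 0 0).1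
  have hG := integrable_gaussDensity (d := d) hβ
  have hnG := integrable_norm_mul_gaussDensity (d := d) hβ
  have hcg : Continuous (gaussDensity β : Rd d → ℝ) := continuous_gaussDensity
  have hgp := fun z : Rd d => gaussDensity_pos hβ z
  -- the substitution `x = y + √t z` removes the singularity of the heat kernel at `t = 0`
  set J : ℝ → ℝ := fun t => ∫ z, θ t (y + √t • z) * gaussDensity β z with hJ
  set D : ℝ × Rd d → ℝ := fun p =>
    deriv (fun s => θ s p.2) p.1 + β * Laplacian.laplacian (θ p.1) p.2 with hD
  have hDc : Continuous D :=
    (contDiff_deriv_time h).continuous.add (continuous_const.mul (continuous_laplacian_space h))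
  have hDb : ∀ p, |D p| ≤ M + β * M := fun p => by
    refine (abs_add_le _ _).trans (add_le_add (hM _ _).2.1 ?_)
    rw [abs_mul, abs_of_pos hβ]
    exact mul_le_mul_of_nonneg_left (hM _ _).2.2.2.1 hβ.le
  have hθc : Continuous (Function.uncurry θ) := h.continuous
  have hJc : Continuous J := by
    refine continuous_of_dominated (bound := fun z => M * gaussDensity β z) ?_ ?_
      (hG.const_mul M) ?_
    · intro t
      have : Continuous fun z : Rd d => θ t (y + √t • z) :=
        hθc.comp (by fun_prop : Continuous fun z : Rd d => (t, y + √t • z))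
      exact (this.mul hcg).aestronglyMeasurable
    · intro t
      refine Eventually.of_forall fun z => ?_
      rw [norm_mul, Real.norm_of_nonneg (hgp z).le]
      exact mul_le_mul_of_nonneg_right (hM _ _).1 (hgp z).le
    · refine Eventually.of_forall fun z => ?_
      have : Continuous fun t : ℝ => θ t (y + √t • z) :=
        hθc.comp (by fun_prop : Continuous fun t : ℝ => (t, y + √t • z))
      exact this.mul continuous_const
  -- the derivative of `√t` produces the term `(2√t)⁻¹ ⟪z, ∇θ⟫`, which Gaussian integration by parts
  -- turns into `β Δθ`
  have hJd : ∀ t ∈ Ioo 0 T, HasDerivAt J (∫ x, D (t, x) * heatKernel β t (x - y)) t := by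
    intro t ht
    have ht0 := ht.1
    set F' : ℝ → Rd d → ℝ := fun s z =>
      (deriv (fun r => θ r (y + √s • z)) s + 1 / (2 * √s) * fderiv ℝ (θ s) (y + √s • z) z)
        * gaussDensity β z with hF'
    have hsl : ∀ s, Continuous fun z : Rd d => (s, y + √s • z) := fun s => by fun_prop
    have hc1 : ∀ s, Continuous fun z : Rd d => deriv (fun r => θ r (y + √s • z)) s := fun s =>
      (contDiff_deriv_time h).continuous.comp (hsl s)
    have hc2 : ∀ s, Continuous fun z : Rd d => fderiv ℝ (θ s) (y + √s • z) z := fun s =>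
      ((continuous_fderiv_space h).comp (hsl s)).clm_apply continuous_id
    have hb2 : ∀ s (z : Rd d), |fderiv ℝ (θ s) (y + √s • z) z| ≤ M * ‖z‖ := fun s z =>
      (fderiv ℝ (θ s) (y + √s • z)).le_of_opNorm_le (hM _ _).2.2.1 z
    have hder := hasDerivAt_integral_of_dominated_loc_of_deriv_le (μ := (volume : Measure (Rd d)))
      (F := fun s z => θ s (y + √s • z) * gaussDensity β z) (F' := F') (x₀ := t)
      (s := Ioi (t / 2)) (bound := fun z => M * gaussDensity β z
        + 1 / (2 * √(t / 2)) * M * (‖z‖ * gaussDensity β z))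
      (Ioi_mem_nhds (by linarith)) (Eventually.of_forall fun s => ?_) ?_ ?_ ?_ ?_ ?_
    · have h4 := hder.2
      refine h4.congr_deriv ?_
      rw [integral_mul_heatKernel ht0 (fun x => D (t, x)) y]
      simp only [hF', hD, add_mul]
      have i1 : Integrable fun z : Rd d =>
          deriv (fun r => θ r (y + √t • z)) t * gaussDensity β z := by
        refine (hG.const_mul M).mono' ((hc1 t).mul hcg).aestronglyMeasurable
          (Eventually.of_forall fun z => ?_)
        rw [norm_mul, Real.norm_of_nonneg (hgp z).le]
        exact mul_le_mul_of_nonneg_right (hM _ _).2.1 (hgp z).le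
      have i2 : Integrable fun z : Rd d =>
          1 / (2 * √t) * fderiv ℝ (θ t) (y + √t • z) z * gaussDensity β z := by
        simp_rw [mul_assoc]
        refine Integrable.const_mul ?_ _
        refine (hnG.const_mul M).mono' ((hc2 t).mul hcg).aestronglyMeasurable
          (Eventually.of_forall fun z => ?_)
        rw [norm_mul, Real.norm_of_nonneg (hgp z).le, ← mul_assoc]
        exact mul_le_mul_of_nonneg_right (hb2 _ _) (hgp z).le
      have i3 : Integrable fun z : Rd d =>
          β * Laplacian.laplacian (θ t) (y + √t • z) * gaussDensity β z := by
        simp_rw [mul_assoc]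
        refine Integrable.const_mul ?_ _
        refine (hG.const_mul M).mono' (((continuous_laplacian_space h).comp
          (hsl t)).mul hcg).aestronglyMeasurable (Eventually.of_forall fun z => ?_)
        rw [norm_mul, Real.norm_of_nonneg (hgp z).le]
        exact mul_le_mul_of_nonneg_right (hM _ _).2.2.2.1 (hgp z).le
      rw [integral_add i1 i2, integral_add i1 i3]
      congr 1
      simp_rw [mul_assoc]
      rw [integral_const_mul, integral_const_mul,
        integral_fderiv_apply_self_mul_gaussDensity hβ (contDiff_slice_space h t)
          (fun x => (hM t x).2.2.1) (fun x i => (hM t x).2.2.2.2 i) y (√t)]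
      have : √t ≠ 0 := (Real.sqrt_pos.2 ht0).ne'
      field_simp
    · exact ((hθc.comp (hsl s)).mul hcg).aestronglyMeasurable
    · refine (hG.const_mul M).mono' ((hθc.comp (hsl t)).mul hcg).aestronglyMeasurable
        (Eventually.of_forall fun z => ?_)
      rw [norm_mul, Real.norm_of_nonneg (hgp z).le]
      exact mul_le_mul_of_nonneg_right (hM _ _).1 (hgp z).le
    · exact (((hc1 t).add (continuous_const.mul (hc2 t))).mul hcg).aestronglyMeasurable
    · refine Eventually.of_forall fun z s hs => ?_
      have hs' : 0 < √(t / 2) := Real.sqrt_pos.2 (by linarith)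
      have hss : √(t / 2) ≤ √s := Real.sqrt_le_sqrt (le_of_lt hs)
      rw [hF', norm_mul, Real.norm_of_nonneg (hgp z).le]
      have h5 : ‖deriv (fun r => θ r (y + √s • z)) s
          + 1 / (2 * √s) * fderiv ℝ (θ s) (y + √s • z) z‖
          ≤ M + 1 / (2 * √(t / 2)) * (M * ‖z‖) := by
        refine (norm_add_le _ _).trans (add_le_add (hM _ _).2.1 ?_)
        rw [norm_mul, Real.norm_of_nonneg (by positivity)]
        refine mul_le_mul ?_ (hb2 s z) (norm_nonneg _) (by positivity)
        gcongr
      calc _ ≤ (M + 1 / (2 * √(t / 2)) * (M * ‖z‖)) * gaussDensity β z :=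
            mul_le_mul_of_nonneg_right h5 (hgp z).le
        _ = _ := by ring
    · exact (hG.const_mul M).add (hnG.const_mul _)
    · refine Eventually.of_forall fun z s hs => ?_
      have hs0 : 0 < s := lt_trans (by linarith) (mem_Ioi.1 hs)
      have h6 : HasDerivAt (fun r : ℝ => (r, y + √r • z)) ((1 : ℝ), (1 / (2 * √s)) • z) s :=
        (hasDerivAt_id s).prodMk
          (((Real.hasDerivAt_sqrt hs0.ne').smul_const z).const_add y)
      have h7 := ((h.differentiable (by simp) (s, y + √s • z)).hasFDerivAt.comp_hasDerivAt s
        h6).mul_const (gaussDensity β z)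
      refine h7.congr_deriv ?_
      simp only [hF']
      rw [deriv_slice_time h, fderiv_slice_space h]
      congr 1
      rw [← smul_eq_mul (1 / (2 * √s)), ← map_smul, ← map_add]
      simp
  have hint := integrable_heatKernel_slab (T := T) hβ y
  have hDint : Integrable (fun p : ℝ × Rd d => D p * heatKernel β p.1 (p.2 - y)) (slab d T) :=
    hint.bdd_mul hDc.aestronglyMeasurable (c := M + β * M) (Eventually.of_forall hDb)
  have hDint' := hDint
  rw [slab] at hDint'
  have hFTC := intervalIntegral.integral_eq_sub_of_hasDerivAt_of_le hT.le hJc.continuousOn hJd (by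
    rw [intervalIntegrable_iff_integrableOn_Icc_of_le hT.le]
    exact hDint'.integral_prod_left)
  rw [slab, integral_prod _ hDint', integral_Icc_eq_integral_Ioc,
    ← intervalIntegral.integral_of_le hT.le, hFTC, hJ]
  simp only
  rw [integral_mul_heatKernel hT (θ T) y]
  simp [integral_const_mul, integral_gaussDensity hβ]

end Heat

/-! ### Product and chain rules for the Laplacian -/

section Calculus

variable {d : ℕ}

lemma inner_gradient_gradient (f g : Rd d → ℝ) (x : Rd d) :
    inner ℝ (gradient f x) (gradient g x) = ∑ i,
      fderiv ℝ f x (EuclideanSpace.basisFun (Fin d) ℝ i)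
        * fderiv ℝ g x (EuclideanSpace.basisFun (Fin d) ℝ i) := by
  rw [← (EuclideanSpace.basisFun (Fin d) ℝ).sum_inner_mul_inner]
  refine Finset.sum_congr rfl fun i _ => ?_
  rw [inner_gradient_eq_fderiv, real_inner_comm, inner_gradient_eq_fderiv]

lemma laplacian_mul {f g : Rd d → ℝ} (hf : ContDiff ℝ ∞ f) (hg : ContDiff ℝ ∞ g) (x : Rd d) :
    Laplacian.laplacian (fun y => f y * g y) x = f x * Laplacian.laplacian g x
      + 2 * inner ℝ (gradient f x) (gradient g x) + g x * Laplacian.laplacian f x := by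
  have hfd : Differentiable ℝ f := hf.differentiable (by simp)
  have hgd : Differentiable ℝ g := hg.differentiable (by simp)
  rw [laplacian_eq_sum_fderiv (hf.mul hg), laplacian_eq_sum_fderiv hf, laplacian_eq_sum_fderiv hg,
    inner_gradient_gradient, Finset.mul_sum, Finset.mul_sum, Finset.mul_sum,
    ← Finset.sum_add_distrib, ← Finset.sum_add_distrib]
  refine Finset.sum_congr rfl fun i _ => ?_
  set e := EuclideanSpace.basisFun (Fin d) ℝ i
  have h1 : (fun y => fderiv ℝ (fun y => f y * g y) y e)
      = fun y => f y * fderiv ℝ g y e + g y * fderiv ℝ f y e := by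
    ext y
    rw [fderiv_fun_mul (hfd y) (hgd y)]
    simp
  have hfe : Differentiable ℝ fun y => fderiv ℝ f y e :=
    (contDiff_fderiv_apply hf e).differentiable (by simp)
  have hge : Differentiable ℝ fun y => fderiv ℝ g y e :=
    (contDiff_fderiv_apply hg e).differentiable (by simp)
  rw [h1, fderiv_fun_add ((hfd x).fun_mul (hge x)) ((hgd x).fun_mul (hfe x)),
    fderiv_fun_mul (hfd x) (hge x), fderiv_fun_mul (hgd x) (hfe x)]
  simp
  ring

lemma gradient_mul {f g : Rd d → ℝ} (hf : ContDiff ℝ ∞ f) (hg : ContDiff ℝ ∞ g) (x : Rd d) :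
    gradient (fun y => f y * g y) x = f x • gradient g x + g x • gradient f x := by
  refine ext_inner_left ℝ fun v => ?_
  rw [inner_gradient_eq_fderiv, fderiv_fun_mul (hf.differentiable (by simp) x)
    (hg.differentiable (by simp) x), inner_add_right, inner_smul_right, inner_smul_right,
    inner_gradient_eq_fderiv, inner_gradient_eq_fderiv]
  simp

lemma gradient_comp_real {L : ℝ → ℝ} {f : Rd d → ℝ} (hL : ContDiff ℝ ∞ L) (hf : ContDiff ℝ ∞ f)
    (x : Rd d) : gradient (fun y => L (f y)) x = deriv L (f x) • gradient f x := by
  refine ext_inner_left ℝ fun v => ?_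
  rw [inner_gradient_eq_fderiv, inner_smul_right, inner_gradient_eq_fderiv]
  have := ((hL.differentiable (by simp) (f x)).hasDerivAt.comp_hasFDerivAt x
    (hf.differentiable (by simp) x).hasFDerivAt).fderiv
  change fderiv ℝ (fun y => L (f y)) x = _ at this
  rw [this]
  simp

lemma laplacian_comp_real {L : ℝ → ℝ} {f : Rd d → ℝ} (hL : ContDiff ℝ ∞ L) (hf : ContDiff ℝ ∞ f)
    (x : Rd d) : Laplacian.laplacian (fun y => L (f y)) x
      = deriv L (f x) * Laplacian.laplacian f x + deriv (deriv L) (f x) * ‖gradient f x‖ ^ 2 := by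
  have hfd : Differentiable ℝ f := hf.differentiable (by simp)
  have hL' : ContDiff ℝ ∞ (deriv L) := hL.deriv'
  change Laplacian.laplacian (L ∘ f) x = _
  rw [laplacian_eq_sum_fderiv (hL.comp hf), laplacian_eq_sum_fderiv hf, ← real_inner_self_eq_norm_sq,
    inner_gradient_gradient, Finset.mul_sum, Finset.mul_sum, ← Finset.sum_add_distrib]
  refine Finset.sum_congr rfl fun i _ => ?_
  set e := EuclideanSpace.basisFun (Fin d) ℝ i
  have h1 : (fun y => fderiv ℝ (L ∘ f) y e) = fun y => deriv L (f y) * fderiv ℝ f y e := by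
    ext y
    rw [((hL.differentiable (by simp) (f y)).hasDerivAt.comp_hasFDerivAt y
      (hfd y).hasFDerivAt).fderiv]
    simp
  have hfe : Differentiable ℝ fun y => fderiv ℝ f y e :=
    (contDiff_fderiv_apply hf e).differentiable (by simp)
  have h2 := (hL'.differentiable (by simp) (f x)).hasDerivAt.comp_hasFDerivAt x
    (hfd x).hasFDerivAt
  have h3 := (h2.mul (hfe x).hasFDerivAt).fderiv
  change fderiv ℝ (fun y => deriv L (f y) * fderiv ℝ f y e) x = _ at h3
  rw [h1, h3]
  simp
  ring

end Calculus

/-! ### Bounded solutions of the backward heat equation -/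

/-- A smooth solution `h` of the backward heat equation `∂ₜh + β Δh = 0`, defined for all times,
which is bounded with its first derivatives up to time `T` and is transported backwards by the
heat semigroup: `h(s, ·)` is the Gaussian average of `h(s + τ, ·)`. -/
structure IsCaloric {d : ℕ} (β T : ℝ) (h : ℝ → Rd d → ℝ) : Prop where
  smooth : ContDiff ℝ ∞ (Function.uncurry h)
  heat : ∀ t x, deriv (fun s => h s x) t + β * Laplacian.laplacian (h t) x = 0
  bound : ∃ M, ∀ t ≤ T, ∀ x, |h t x| ≤ M ∧ |deriv (fun s => h s x) t| ≤ M ∧ ‖fderiv ℝ (h t) x‖ ≤ M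
  semigroup : ∀ s τ, 0 ≤ τ → s + τ ≤ T → ∀ y,
    ∫ z, h (s + τ) (y + √τ • z) * gaussDensity β z = h s y

/-- Trigonometric polynomials on `ℝᵈ` (with arbitrary real frequencies and phases). -/
def trigPoly (d : ℕ) : Submodule ℝ (Rd d → ℝ) :=
  Submodule.span ℝ (range fun k : Rd d × ℝ => fun x => Real.cos (inner ℝ k.1 x + k.2))

section Caloric

variable {d : ℕ} {β T : ℝ}

lemma IsCaloric.integrable (hβ : 0 < β) {h : ℝ → Rd d → ℝ} (hh : IsCaloric β T h) {t : ℝ}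
    (ht : t ≤ T) (y : Rd d) (c : ℝ) : Integrable fun z => h t (y + c • z) * gaussDensity β z := by
  obtain ⟨M, hM⟩ := hh.bound
  refine (integrable_gaussDensity hβ).bdd_mul (c := M) ?_ (Eventually.of_forall fun z =>
    (hM t ht _).1)
  exact ((contDiff_slice_space hh.smooth t).continuous.comp
    (by fun_prop : Continuous fun z : Rd d => y + c • z)).aestronglyMeasurable

lemma IsCaloric.add (hβ : 0 < β) {h g : ℝ → Rd d → ℝ} (hh : IsCaloric β T h)
    (hg : IsCaloric β T g) : IsCaloric β T (fun t x => h t x + g t x) where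
  smooth := hh.smooth.add hg.smooth
  heat t x := by
    have h1 := (contDiff_slice_time hh.smooth x).differentiable (by simp) t
    have h2 := (contDiff_slice_time hg.smooth x).differentiable (by simp) t
    rw [deriv_fun_add h1 h2]
    have h3 := (((contDiff_slice_space hh.smooth t).of_le (WithTop.coe_le_coe.2 le_top)).contDiffAt
      (x := x)).laplacian_add ((contDiff_slice_space hg.smooth t).of_le (WithTop.coe_le_coe.2 le_top)).contDiffAt
    have h4 : Laplacian.laplacian (fun x => h t x + g t x) x = _ := h3
    rw [h4]
    linear_combination hh.heat t x + hg.heat t x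
  bound := by
    obtain ⟨M, hM⟩ := hh.bound
    obtain ⟨N, hN⟩ := hg.bound
    refine ⟨M + N, fun t ht x => ⟨?_, ?_, ?_⟩⟩
    · exact (abs_add_le _ _).trans (add_le_add (hM t ht x).1 (hN t ht x).1)
    · rw [deriv_fun_add ((contDiff_slice_time hh.smooth x).differentiable (by simp) t)
        ((contDiff_slice_time hg.smooth x).differentiable (by simp) t)]
      exact (abs_add_le _ _).trans (add_le_add (hM t ht x).2.1 (hN t ht x).2.1)
    · rw [fderiv_fun_add ((contDiff_slice_space hh.smooth t).differentiable (by simp) x)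
        ((contDiff_slice_space hg.smooth t).differentiable (by simp) x)]
      exact (norm_add_le _ _).trans (add_le_add (hM t ht x).2.2 (hN t ht x).2.2)
  semigroup s τ h0 h1 y := by
    simp only [add_mul]
    rw [integral_add (hh.integrable hβ h1 y _) (hg.integrable hβ h1 y _), hh.semigroup s τ h0 h1,
      hg.semigroup s τ h0 h1]

lemma IsCaloric.const_mul {h : ℝ → Rd d → ℝ} (hh : IsCaloric β T h) (c : ℝ) :
    IsCaloric β T (fun t x => c * h t x) where
  smooth := contDiff_const.mul hh.smooth
  heat t x := by
    rw [deriv_const_mul_field]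
    have h3 := laplacian_smul c ((contDiff_slice_space hh.smooth t).of_le (WithTop.coe_le_coe.2 le_top)).contDiffAt
      (x := x)
    have h4 : Laplacian.laplacian (fun x => c * h t x) x = c * _ := h3
    rw [h4]
    linear_combination c * hh.heat t x
  bound := by
    obtain ⟨M, hM⟩ := hh.bound
    refine ⟨|c| * M, fun t ht x => ⟨?_, ?_, ?_⟩⟩
    · rw [abs_mul]
      exact mul_le_mul_of_nonneg_left (hM t ht x).1 (abs_nonneg c)
    · rw [deriv_const_mul_field, abs_mul]
      exact mul_le_mul_of_nonneg_left (hM t ht x).2.1 (abs_nonneg c)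
    · rw [fderiv_const_mul ((contDiff_slice_space hh.smooth t).differentiable (by simp) x),
        norm_smul]
      exact mul_le_mul_of_nonneg_left (hM t ht x).2.2 (abs_nonneg c)
  semigroup s τ h0 h1 y := by
    simp only [mul_assoc]
    rw [integral_const_mul, hh.semigroup s τ h0 h1]

/-- The Gaussian average of a plane wave. -/
lemma integral_cos_mul_gaussDensity (hβ : 0 < β) (k : Rd d) (a : ℝ) :
    ∫ z, Real.cos (inner ℝ k z + a) * gaussDensity β z
      = Real.exp (-β * ‖k‖ ^ 2) * Real.cos a := by
  have hb : 0 < ((1 / (4 * β) : ℝ) : ℂ).re := by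
    rw [Complex.ofReal_re]; positivity
  have h1 := GaussianFourier.integral_cexp_neg_mul_sq_norm_add (V := Rd d) hb Complex.I k
  have h0 := GaussianFourier.integral_cexp_neg_mul_sq_norm (V := Rd d) hb
  rw [← h0] at h1
  have hint := GaussianFourier.integrable_cexp_neg_mul_sq_norm_add (V := Rd d) hb Complex.I k
  have h2 : ∫ v : Rd d, Complex.exp (-((1 / (4 * β) : ℝ) : ℂ) * (‖v‖ : ℂ) ^ 2)
      = ((∫ v : Rd d, Real.exp (-(1 / (4 * β)) * ‖v‖ ^ 2) : ℝ) : ℂ) := by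
    rw [← integral_complex_ofReal]
    congr 1 with v
    push_cast
    rfl
  have hpos := integral_exp_neg_mul_sq_norm_pos (d := d) (b := 1 / (4 * β)) (by positivity)
  have h3 : ∀ v : Rd d, Real.cos (inner ℝ k v + a) * Real.exp (-(1 / (4 * β)) * ‖v‖ ^ 2)
      = (Complex.exp (a * Complex.I) * Complex.exp (-((1 / (4 * β) : ℝ) : ℂ) * (‖v‖ : ℂ) ^ 2
        + Complex.I * (inner ℝ k v : ℝ))).re := by
    intro v
    rw [← Complex.exp_add]
    have : (a : ℂ) * Complex.I + (-((1 / (4 * β) : ℝ) : ℂ) * (‖v‖ : ℂ) ^ 2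
        + Complex.I * (inner ℝ k v : ℝ))
        = ((-(1 / (4 * β)) * ‖v‖ ^ 2 : ℝ) : ℂ) + ((inner ℝ k v + a : ℝ) : ℂ) * Complex.I := by
      push_cast; ring
    rw [this, Complex.exp_add, ← Complex.ofReal_exp, Complex.re_ofReal_mul,
      Complex.exp_ofReal_mul_I_re, mul_comm]
  simp only [gaussDensity, ← mul_div_assoc]
  rw [integral_div]
  simp_rw [h3]
  have h4 := integral_re (𝕜 := ℂ) (hint.const_mul (Complex.exp (a * Complex.I)))
  simp only [RCLike.re_to_complex] at h4
  rw [h4, integral_const_mul, h1, h2]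
  have h5 : Complex.I ^ 2 * (‖k‖ : ℂ) ^ 2 / (4 * ((1 / (4 * β) : ℝ) : ℂ))
      = ((-β * ‖k‖ ^ 2 : ℝ) : ℂ) := by
    have : (β : ℂ) ≠ 0 := by exact_mod_cast hβ.ne'
    push_cast
    rw [Complex.I_sq]
    field_simp
  rw [h5, ← Complex.ofReal_exp, ← Complex.ofReal_mul, mul_comm, Complex.re_ofReal_mul,
    Complex.exp_ofReal_mul_I_re]
  generalize (∫ v : Rd d, Real.exp (-(1 / (4 * β)) * ‖v‖ ^ 2)) = I at hpos ⊢
  field_simp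

lemma contDiff_inner_add (k : Rd d) (a : ℝ) {n : WithTop ℕ∞} :
    ContDiff ℝ n (fun x => inner ℝ k x + a) :=
  (innerSL ℝ k).contDiff.add contDiff_const

lemma hasFDerivAt_inner_add (k : Rd d) (a : ℝ) (x : Rd d) :
    HasFDerivAt (fun x => inner ℝ k x + a) (innerSL ℝ k) x :=
  (innerSL ℝ k).hasFDerivAt.add_const a

lemma laplacian_cos (k : Rd d) (a : ℝ) (x : Rd d) :
    Laplacian.laplacian (fun x => Real.cos (inner ℝ k x + a)) x
      = -‖k‖ ^ 2 * Real.cos (inner ℝ k x + a) := by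
  have hs : ContDiff ℝ ∞ fun x : Rd d => inner ℝ k x + a := contDiff_inner_add k a
  rw [laplacian_comp_real Real.contDiff_cos hs]
  have h1 : gradient (fun x : Rd d => inner ℝ k x + a) x = k := by
    refine ext_inner_left ℝ fun v => ?_
    rw [inner_gradient_eq_fderiv, (hasFDerivAt_inner_add k a x).fderiv, innerSL_apply_apply,
      real_inner_comm]
  have h2 : Laplacian.laplacian (fun x : Rd d => inner ℝ k x + a) x = 0 := by
    rw [laplacian_eq_sum_fderiv hs]
    refine Finset.sum_eq_zero fun i _ => ?_
    simp_rw [(hasFDerivAt_inner_add k a _).fderiv]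
    simp
  rw [h1, h2]
  simp [Real.deriv_cos']
  ring

lemma isCaloric_planeWave (hβ : 0 < β) (k : Rd d) (a : ℝ) :
    IsCaloric β T (fun t x => Real.exp (β * ‖k‖ ^ 2 * (t - T)) * Real.cos (inner ℝ k x + a)) := by
  have hdt : ∀ t (x : Rd d), deriv (fun s => Real.exp (β * ‖k‖ ^ 2 * (s - T))
      * Real.cos (inner ℝ k x + a)) t = β * ‖k‖ ^ 2 * (Real.exp (β * ‖k‖ ^ 2 * (t - T))
      * Real.cos (inner ℝ k x + a)) := by
    intro t x
    have h1 : HasDerivAt (fun s : ℝ => β * ‖k‖ ^ 2 * (s - T)) (β * ‖k‖ ^ 2) t := by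
      simpa using ((hasDerivAt_id t).sub_const T).const_mul (β * ‖k‖ ^ 2)
    rw [(h1.exp.mul_const _).deriv]
    ring
  have hE : ∀ t ≤ T, Real.exp (β * ‖k‖ ^ 2 * (t - T)) ≤ 1 := fun t ht => by
    rw [Real.exp_le_one_iff]
    exact mul_nonpos_of_nonneg_of_nonpos (by positivity) (by linarith)
  have hw : ∀ t ≤ T, ∀ x : Rd d, |Real.exp (β * ‖k‖ ^ 2 * (t - T))
      * Real.cos (inner ℝ k x + a)| ≤ 1 := fun t ht x => by
    rw [abs_mul, Real.abs_exp]
    exact mul_le_one₀ (hE t ht) (abs_nonneg _) (Real.abs_cos_le_one _)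
  refine ⟨?_, ?_, ?_, ?_⟩
  · have : ContDiff ℝ ∞ fun p : ℝ × Rd d => Real.exp (β * ‖k‖ ^ 2 * (p.1 - T))
      * Real.cos (inner ℝ k p.2 + a) :=
      (by fun_prop : ContDiff ℝ ∞ fun p : ℝ × Rd d => Real.exp (β * ‖k‖ ^ 2 * (p.1 - T))).mul
        (Real.contDiff_cos.comp ((contDiff_inner_add k a).comp contDiff_snd))
    exact this
  · intro t x
    rw [hdt]
    have h3 := laplacian_smul (Real.exp (β * ‖k‖ ^ 2 * (t - T)))
      (f := fun x : Rd d => Real.cos (inner ℝ k x + a)) (x := x)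
      (Real.contDiff_cos.comp (contDiff_inner_add k a)).contDiffAt
    have h4 : Laplacian.laplacian (fun x : Rd d => Real.exp (β * ‖k‖ ^ 2 * (t - T))
      * Real.cos (inner ℝ k x + a)) x = _ := h3
    rw [h4, laplacian_cos, smul_eq_mul]
    ring
  · refine ⟨1 + β * ‖k‖ ^ 2 + ‖k‖, fun t ht x => ⟨?_, ?_, ?_⟩⟩
    · have : 0 ≤ β * ‖k‖ ^ 2 := by positivity
      linarith [hw t ht x, norm_nonneg k]
    · rw [hdt, abs_mul, abs_of_nonneg (by positivity : 0 ≤ β * ‖k‖ ^ 2)]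
      have := mul_le_mul_of_nonneg_left (hw t ht x) (by positivity : 0 ≤ β * ‖k‖ ^ 2)
      linarith [norm_nonneg k]
    · have h1 : HasFDerivAt (fun x : Rd d => Real.exp (β * ‖k‖ ^ 2 * (t - T))
          * Real.cos (inner ℝ k x + a)) _ x :=
        ((hasFDerivAt_inner_add k a x).cos).const_mul (Real.exp (β * ‖k‖ ^ 2 * (t - T)))
      rw [h1.fderiv, norm_smul, norm_smul, innerSL_apply_norm, norm_neg, Real.norm_eq_abs,
        Real.norm_eq_abs, Real.abs_exp, ← mul_assoc]
      have h2 := mul_le_one₀ (hE t ht) (abs_nonneg _) (Real.abs_sin_le_one (inner ℝ k x + a))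
      have h3 : 0 ≤ β * ‖k‖ ^ 2 := by positivity
      nlinarith [norm_nonneg k]
  · intro s τ h0 _ y
    have h1 : ∀ z : Rd d, Real.exp (β * ‖k‖ ^ 2 * (s + τ - T))
        * Real.cos (inner ℝ k (y + √τ • z) + a) * gaussDensity β z
        = Real.exp (β * ‖k‖ ^ 2 * (s + τ - T))
          * (Real.cos (inner ℝ (√τ • k) z + (inner ℝ k y + a)) * gaussDensity β z) := by
      intro z
      rw [inner_add_right, real_inner_smul_left, real_inner_smul_right, mul_assoc]
      congr 3
      ring
    simp_rw [h1]
    rw [integral_const_mul, integral_cos_mul_gaussDensity hβ, ← mul_assoc, ← Real.exp_add,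
      norm_smul, mul_pow, Real.norm_eq_abs, sq_abs, Real.sq_sqrt h0]
    congr 2
    ring

/-- Every trigonometric polynomial is the value at time `T` of a bounded solution of the backward
heat equation. -/
lemma exists_isCaloric_of_mem_trigPoly (hβ : 0 < β) {w : Rd d → ℝ} (hw : w ∈ trigPoly d) :
    ∃ h : ℝ → Rd d → ℝ, IsCaloric β T h ∧ h T = w := by
  unfold trigPoly at hw
  induction hw using Submodule.span_induction with
  | mem w hw =>
    obtain ⟨⟨k, a⟩, rfl⟩ := hw
    exact ⟨_, isCaloric_planeWave hβ k a, by simp⟩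
  | zero =>
    refine ⟨_, (isCaloric_planeWave hβ 0 0).const_mul 0, ?_⟩
    ext; simp
  | add u v _ _ hu hv =>
    obtain ⟨g, hg, rfl⟩ := hu
    obtain ⟨h, hh, rfl⟩ := hv
    exact ⟨_, hg.add hβ hh, rfl⟩
  | smul c u _ hu =>
    obtain ⟨g, hg, rfl⟩ := hu
    exact ⟨_, hg.const_mul c, rfl⟩

/-- A lower bound at time `T` propagates to earlier times. -/
lemma IsCaloric.le_of_le (hβ : 0 < β) {h : ℝ → Rd d → ℝ} (hh : IsCaloric β T h) {c : ℝ}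
    (hc : ∀ x, c ≤ h T x) {t : ℝ} (ht : t ≤ T) (x : Rd d) : c ≤ h t x := by
  have h1 := hh.semigroup t (T - t) (by linarith) (by linarith) x
  rw [← h1, add_sub_cancel]
  have h2 : c = ∫ z : Rd d, c * gaussDensity β z := by
    rw [integral_const_mul, integral_gaussDensity hβ, mul_one]
  rw [h2]
  refine integral_mono ((integrable_gaussDensity hβ).const_mul c) (hh.integrable hβ le_rfl _ _)
    fun z => ?_
  exact mul_le_mul_of_nonneg_right (hc _) (gaussDensity_pos hβ z).le

/-- The semigroup property, with the heat kernel. -/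
lemma IsCaloric.integral_mul_heatKernel {h : ℝ → Rd d → ℝ} (hh : IsCaloric β T h) {t : ℝ}
    (ht : 0 < t) (htT : t ≤ T) (y : Rd d) : ∫ x, h t x * heatKernel β t (x - y) = h 0 y := by
  rw [WProx.integral_mul_heatKernel ht]
  simpa using hh.semigroup 0 t ht.le (by linarith) y

end Caloric

/-! ### Bounded test functions for the Fokker-Planck equation -/

section TestFunctions

variable {d : ℕ} {β T : ℝ}

lemma slab_eq (d : ℕ) (T : ℝ) :
    slab d T = (volume : Measure (ℝ × Rd d)).restrict (Icc 0 T ×ˢ univ) := by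
  rw [slab, Measure.volume_eq_prod, ← Measure.prod_restrict, Measure.restrict_univ]

lemma ae_slab_of_forall_Icc {P : ℝ × Rd d → Prop} (h : ∀ t ∈ Icc 0 T, ∀ x, P (t, x)) :
    ∀ᵐ p ∂(slab d T), P p := by
  rw [slab_eq, ae_restrict_iff' (measurableSet_Icc.prod MeasurableSet.univ)]
  exact Eventually.of_forall fun p hp => h p.1 hp.1 p.2

lemma ae_slab_of_forall_Ioo {P : ℝ × Rd d → Prop} (h : ∀ t ∈ Ioo 0 T, ∀ x, P (t, x)) :
    ∀ᵐ p ∂(slab d T), P p := by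
  rw [slab, ← Measure.restrict_congr_set Ioo_ae_eq_Icc,
    show (volume : Measure (Rd d)) = volume.restrict univ from Measure.restrict_univ.symm,
    Measure.prod_restrict, ae_restrict_iff' (measurableSet_Ioo.prod MeasurableSet.univ)]
  exact Eventually.of_forall fun p hp => h p.1 hp.1 p.2

/-- The operator `∂ₜφ + v · ∇φ + β Δφ` acting on test functions. -/
def testOp (β : ℝ) (v : ℝ → Rd d → Rd d) (φ : ℝ → Rd d → ℝ) (p : ℝ × Rd d) : ℝ :=
  deriv (fun s => φ s p.2) p.1 + inner ℝ (v p.1 p.2) (gradient (φ p.1) p.2)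
    + β * Laplacian.laplacian (φ p.1) p.2

lemma measurable_testOp {v : ℝ → Rd d → Rd d} (hv : Measurable (Function.uncurry v))
    {φ : ℝ → Rd d → ℝ} (hφ : ContDiff ℝ ∞ (Function.uncurry φ)) :
    Measurable (testOp β v φ) := by
  refine ((contDiff_deriv_time hφ).continuous.measurable.add ?_).add
    ((continuous_laplacian_space hφ).measurable.const_mul β)
  exact Measurable.inner hv (continuous_gradient_space hφ).measurable

lemma abs_testOp_le (hβ : 0 < β) (v : ℝ → Rd d → Rd d) {φ : ℝ → Rd d → ℝ} {p : ℝ × Rd d}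
    {M : ℝ} (h1 : |deriv (fun s => φ s p.2) p.1| ≤ M) (h2 : ‖fderiv ℝ (φ p.1) p.2‖ ≤ M)
    (h3 : |Laplacian.laplacian (φ p.1) p.2| ≤ M) :
    |testOp β v φ p| ≤ M * (1 + β) + M * ‖v p.1 p.2‖ := by
  have h4 : |inner ℝ (v p.1 p.2) (gradient (φ p.1) p.2)| ≤ ‖v p.1 p.2‖ * M :=
    (abs_real_inner_le_norm _ _).trans
      (mul_le_mul_of_nonneg_left (by rwa [norm_gradient]) (norm_nonneg _))
  have h5 : |β * Laplacian.laplacian (φ p.1) p.2| ≤ β * M := by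
    rw [abs_mul, abs_of_pos hβ]
    exact mul_le_mul_of_nonneg_left h3 hβ.le
  have h6 := abs_add_le (deriv (fun s => φ s p.2) p.1 + inner ℝ (v p.1 p.2) (gradient (φ p.1) p.2))
    (β * Laplacian.laplacian (φ p.1) p.2)
  have h7 := abs_add_le (deriv (fun s => φ s p.2) p.1)
    (inner ℝ (v p.1 p.2) (gradient (φ p.1) p.2))
  unfold testOp
  linarith

lemma laplacian_comp_smul {g : Rd d → ℝ} (hg : ContDiff ℝ ∞ g) (c : ℝ) (x : Rd d) :
    Laplacian.laplacian (fun y => g (c • y)) x = c ^ 2 * Laplacian.laplacian g (c • x) := by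
  have hc : ContDiff ℝ ∞ fun y : Rd d => g (c • y) := hg.comp (contDiff_const_smul c)
  rw [laplacian_eq_sum_fderiv hc, laplacian_eq_sum_fderiv hg, Finset.mul_sum]
  refine Finset.sum_congr rfl fun i _ => ?_
  set e := EuclideanSpace.basisFun (Fin d) ℝ i
  have hd := (contDiff_fderiv_apply hg e).differentiable (by simp)
  set G : Rd d → ℝ := fun z => fderiv ℝ g z e
  have h1 : (fun y => fderiv ℝ (fun y => g (c • y)) y e) = fun y => c * G (c • y) := by
    ext y
    rw [fderiv_comp_smul]
    simp [G]
  have hd' : DifferentiableAt ℝ (fun y => G (c • y)) x := (hd (c • x)).comp x (by fun_prop)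
  rw [h1, fderiv_const_mul hd', fderiv_comp_smul]
  simp
  ring

/-- Smooth cut-off functions of time and space, equal to `1` on larger and larger parts of the
slab and with uniformly bounded derivatives. -/
lemma exists_cutoff (d : ℕ) (hT : 0 < T) : ∃ (χ : ℕ → ℝ → Rd d → ℝ) (A : ℝ),
    (∀ n, ContDiff ℝ ∞ (Function.uncurry (χ n))) ∧
    (∀ n, HasCompactSupport (Function.uncurry (χ n))) ∧
    (∀ n t x, |χ n t x| ≤ A ∧ |deriv (fun s => χ n s x) t| ≤ A ∧ ‖fderiv ℝ (χ n t) x‖ ≤ A ∧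
      |Laplacian.laplacian (χ n t) x| ≤ A) ∧
    ∀ x, ∀ᶠ n in atTop, ∀ t ∈ Icc 0 T,
      (∀ᶠ s in 𝓝 t, χ n s x = 1) ∧ ∀ᶠ y in 𝓝 x, χ n t y = 1 := by
  let b : ContDiffBump (0 : Rd d) := ⟨1, 2, by norm_num, by norm_num⟩
  let η : ContDiffBump (T / 2) := ⟨T / 2 + 1, T / 2 + 2, by linarith, by linarith⟩
  let θ : ℝ → Rd d → ℝ := fun t x => η t * b x
  have hθs : ContDiff ℝ ∞ (Function.uncurry θ) :=
    (η.contDiff.comp contDiff_fst).mul (b.contDiff.comp contDiff_snd)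
  have hθc : HasCompactSupport (Function.uncurry θ) := by
    refine HasCompactSupport.intro (η.hasCompactSupport.isCompact.prod
      b.hasCompactSupport.isCompact) fun p hp => ?_
    by_cases h1 : p.1 ∈ tsupport η
    · have h2 : p.2 ∉ tsupport b := fun h2 => hp ⟨h1, h2⟩
      simp [Function.uncurry_def, θ, image_eq_zero_of_notMem_tsupport h2]
    · simp [Function.uncurry_def, θ, image_eq_zero_of_notMem_tsupport h1]
  obtain ⟨A, hA⟩ := exists_bound_of_hasCompactSupport hθs hθc
  have hn : ∀ n : ℕ, 0 < ((n : ℝ) + 1)⁻¹ := fun n => by positivity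
  have hn1 : ∀ n : ℕ, ((n : ℝ) + 1)⁻¹ ≤ 1 := fun n => inv_le_one_of_one_le₀ (by
    have : (0 : ℝ) ≤ n := n.cast_nonneg
    linarith)
  refine ⟨fun n t x => θ t (((n : ℝ) + 1)⁻¹ • x), A, fun n => ?_, fun n => ?_,
    fun n t x => ⟨(hA _ _).1, (hA _ _).2.1, ?_, ?_⟩, fun x => ?_⟩
  · exact hθs.comp (contDiff_fst.prodMk (contDiff_snd.const_smul _))
  · have h1 := hθc.comp_homeomorph ((Homeomorph.refl ℝ).prodCongr
      (Homeomorph.smulOfNeZero ((n : ℝ) + 1)⁻¹ (hn n).ne' (α := Rd d)))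
    exact h1
  · rw [fderiv_comp_smul (f := θ t), norm_smul, Real.norm_of_nonneg (hn n).le]
    exact (mul_le_of_le_one_left (norm_nonneg _) (hn1 n)).trans (hA _ _).2.2.1
  · rw [laplacian_comp_smul (contDiff_slice_space hθs t), abs_mul, abs_of_nonneg (by positivity)]
    exact (mul_le_of_le_one_left (abs_nonneg _) (pow_le_one₀ (hn n).le (hn1 n))).trans
      (hA _ _).2.2.2.1
  · obtain ⟨N, hN⟩ := exists_nat_gt ‖x‖
    filter_upwards [eventually_ge_atTop N] with n hnN t ht
    have hx : ‖((n : ℝ) + 1)⁻¹ • x‖ < 1 := by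
      rw [norm_smul, Real.norm_of_nonneg (hn n).le, inv_mul_lt_iff₀ (by positivity), mul_one]
      have : (N : ℝ) ≤ n := by exact_mod_cast hnN
      linarith
    have hη : ∀ s, dist s (T / 2) < T / 2 + 1 → η s = 1 := fun s hs =>
      η.one_of_mem_closedBall (by simpa using hs.le)
    have hb : ∀ z : Rd d, ‖z‖ < 1 → b z = 1 := fun z hz =>
      b.one_of_mem_closedBall (by simpa using hz.le)
    have htd : dist t (T / 2) < T / 2 + 1 := by
      rw [Real.dist_eq, abs_lt]
      constructor <;> linarith [ht.1, ht.2]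
    constructor
    · have : ∀ᶠ s in 𝓝 t, dist s (T / 2) < T / 2 + 1 :=
        (continuous_id.dist continuous_const).continuousAt.eventually_lt_const htd
      filter_upwards [this] with s hs
      simp only [θ, hη s hs, hb _ hx, mul_one]
    · have : ∀ᶠ y in 𝓝 x, ‖((n : ℝ) + 1)⁻¹ • y‖ < 1 :=
        (continuous_id.const_smul (((n : ℝ) + 1)⁻¹)).norm.continuousAt.eventually_lt_const hx
      filter_upwards [this] with y hy
      simp only [θ, hη t htd, hb _ hy, mul_one]

/-- The weak Fokker-Planck equation may be tested against smooth functions which are bounded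
together with their derivatives, without compact support. -/
lemma SolvesFokkerPlanck.integral_testOp {ρ₀ q : Rd d → ℝ} {ρ : ℝ → Rd d → ℝ}
    {v : ℝ → Rd d → Rd d} (h : SolvesFokkerPlanck T β ρ₀ q ρ v) (hT : 0 < T) (hβ : 0 < β)
    (hρ₀ : Integrable ρ₀) (hq : Integrable q) (hv : Measurable (Function.uncurry v))
    (hρ : Integrable (fun p : ℝ × Rd d => ρ p.1 p.2) (slab d T))
    (hvρ : Integrable (fun p : ℝ × Rd d => ‖v p.1 p.2‖ * ρ p.1 p.2) (slab d T))
    {φ : ℝ → Rd d → ℝ} (hφ : ContDiff ℝ ∞ (Function.uncurry φ)) {M : ℝ}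
    (hM : ∀ t ∈ Icc 0 T, ∀ x, |φ t x| ≤ M ∧ |deriv (fun s => φ s x) t| ≤ M ∧
      ‖fderiv ℝ (φ t) x‖ ≤ M ∧ |Laplacian.laplacian (φ t) x| ≤ M) :
    (∫ x, φ T x * q x) - ∫ x, φ 0 x * ρ₀ x
      = ∫ p, testOp β v φ p * ρ p.1 p.2 ∂(slab d T) := by
  obtain ⟨χ, A, hχs, hχc, hχA, hχ1⟩ := exists_cutoff d hT
  have h0T : (0 : ℝ) ∈ Icc 0 T := ⟨le_rfl, hT.le⟩
  have hTT : T ∈ Icc 0 T := ⟨hT.le, le_rfl⟩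
  have hM0 : 0 ≤ M := (abs_nonneg _).trans (hM 0 h0T 0).1
  have hA0 : 0 ≤ A := (abs_nonneg _).trans (hχA 0 0 0).1
  set ψ : ℕ → ℝ → Rd d → ℝ := fun n t x => χ n t x * φ t x with hψ
  have hψs : ∀ n, ContDiff ℝ ∞ (Function.uncurry (ψ n)) := fun n => (hχs n).mul hφ
  have hψc : ∀ n, HasCompactSupport (Function.uncurry (ψ n)) := fun n => (hχc n).mul_right
  have hψb : ∀ n, ∀ t ∈ Icc 0 T, ∀ x, |ψ n t x| ≤ 4 * (A * M) ∧
      |deriv (fun s => ψ n s x) t| ≤ 4 * (A * M) ∧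
      ‖fderiv ℝ (ψ n t) x‖ ≤ 4 * (A * M) ∧ |Laplacian.laplacian (ψ n t) x| ≤ 4 * (A * M) := by
    intro n t ht x
    obtain ⟨a1, a2, a3, a4⟩ := hχA n t x
    obtain ⟨b1, b2, b3, b4⟩ := hM t ht x
    have hm : ∀ {a b : ℝ}, |a| ≤ A → |b| ≤ M → |a * b| ≤ A * M := fun ha hb => by
      rw [abs_mul]; exact mul_le_mul ha hb (abs_nonneg _) hA0
    have hAM : 0 ≤ A * M := mul_nonneg hA0 hM0
    have ct := contDiff_slice_time (hχs n) x
    have cx := contDiff_slice_space (hχs n) t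
    have pt := contDiff_slice_time hφ x
    have px := contDiff_slice_space hφ t
    refine ⟨(hm a1 b1).trans (by linarith), ?_, ?_, ?_⟩
    · rw [hψ, deriv_fun_mul (ct.differentiable (by simp) t) (pt.differentiable (by simp) t)]
      have := abs_add_le (deriv (fun s => χ n s x) t * φ t x) (χ n t x * deriv (fun s => φ s x) t)
      linarith [hm a2 b1, hm a1 b2]
    · rw [← norm_gradient] at a3 b3 ⊢
      rw [hψ, gradient_mul cx px]
      refine (norm_add_le _ _).trans ?_
      rw [norm_smul, norm_smul, Real.norm_eq_abs, Real.norm_eq_abs]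
      have e1 := mul_le_mul a1 b3 (norm_nonneg _) hA0
      have e2 := mul_le_mul b1 a3 (norm_nonneg _) hM0
      linarith
    · rw [hψ, laplacian_mul cx px]
      rw [← norm_gradient] at a3 b3
      have e1 := (abs_real_inner_le_norm (gradient (χ n t) x) (gradient (φ t) x)).trans
        (mul_le_mul a3 b3 (norm_nonneg _) hA0)
      have e2 := hm a1 b4
      have e3 := hm a4 b1
      have e4 := abs_add_le (χ n t x * Laplacian.laplacian (φ t) x
        + 2 * inner ℝ (gradient (χ n t) x) (gradient (φ t) x))
        (φ t x * Laplacian.laplacian (χ n t) x)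
      have e5 := abs_add_le (χ n t x * Laplacian.laplacian (φ t) x)
        (2 * inner ℝ (gradient (χ n t) x) (gradient (φ t) x))
      rw [abs_mul 2, abs_two] at e5
      rw [mul_comm (φ t x)] at e4 ⊢
      linarith
  -- near any given point the cutoff is eventually `1`, so the equation for `ψ n` is that for `φ`
  have hψ1 : ∀ x, ∀ᶠ n in atTop, ∀ t ∈ Icc 0 T, ψ n t x = φ t x ∧
      testOp β v (ψ n) (t, x) = testOp β v φ (t, x) := by
    intro x
    filter_upwards [hχ1 x] with n hn t ht
    have e1 : (fun s => ψ n s x) =ᶠ[𝓝 t] fun s => φ s x := by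
      filter_upwards [(hn t ht).1] with s hs
      simp [hψ, hs]
    have e2 : ψ n t =ᶠ[𝓝 x] φ t := by
      filter_upwards [(hn t ht).2] with y hy
      simp [hψ, hy]
    refine ⟨e1.eq_of_nhds, ?_⟩
    simp only [testOp]
    rw [e1.deriv_eq, (laplacian_congr_nhds e2).eq_of_nhds, gradient, gradient, e2.fderiv_eq]
  have hlim : ∀ t ∈ Icc 0 T, ∀ g : Rd d → ℝ, Integrable g →
      Tendsto (fun n => ∫ x, ψ n t x * g x) atTop (𝓝 (∫ x, φ t x * g x)) := by
    intro t ht g hg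
    refine tendsto_integral_of_dominated_convergence (fun x => 4 * (A * M) * ‖g x‖) ?_
      (hg.norm.const_mul _) ?_ ?_
    · exact fun n => (contDiff_slice_space (hψs n) t).continuous.aestronglyMeasurable.mul
        hg.aestronglyMeasurable
    · refine fun n => Eventually.of_forall fun x => ?_
      rw [norm_mul]
      exact mul_le_mul_of_nonneg_right (hψb n t ht x).1 (norm_nonneg _)
    · refine Eventually.of_forall fun x => tendsto_const_nhds.congr' ?_
      filter_upwards [hψ1 x] with n hn
      rw [(hn t ht).1]
  have hlim2 : Tendsto (fun n => ∫ p, testOp β v (ψ n) p * ρ p.1 p.2 ∂(slab d T)) atTop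
      (𝓝 (∫ p, testOp β v φ p * ρ p.1 p.2 ∂(slab d T))) := by
    refine tendsto_integral_of_dominated_convergence
      (fun p => 4 * (A * M) * (1 + β) * ‖ρ p.1 p.2‖
        + 4 * (A * M) * ‖‖v p.1 p.2‖ * ρ p.1 p.2‖) ?_
      ((hρ.norm.const_mul _).add (hvρ.norm.const_mul _)) ?_ ?_
    · exact fun n => (measurable_testOp hv (hψs n)).aestronglyMeasurable.mul
        hρ.aestronglyMeasurable
    · refine fun n => ae_slab_of_forall_Icc fun t ht x => ?_
      obtain ⟨_, b2, b3, b4⟩ := hψb n t ht x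
      have := abs_testOp_le hβ v (p := (t, x)) b2 b3 b4
      rw [norm_mul, norm_mul, norm_norm]
      calc _ ≤ (4 * (A * M) * (1 + β) + 4 * (A * M) * ‖v t x‖) * ‖ρ t x‖ :=
            mul_le_mul_of_nonneg_right this (norm_nonneg _)
        _ = _ := by ring
    · refine ae_slab_of_forall_Icc fun t ht x => tendsto_const_nhds.congr' ?_
      filter_upwards [hψ1 x] with n hn
      rw [(hn t ht).2]
  exact tendsto_nhds_unique ((hlim T hTT q hq).sub (hlim 0 h0T ρ₀ hρ₀))
    (hlim2.congr fun n => (h (ψ n) (hψs n) (hψc n)).symm)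

end TestFunctions

/-! ### The logarithm of a positive caloric function -/

section HopfCole

variable {d : ℕ} {β T : ℝ}

/-- The logarithm on `[c / 2, ∞)` extends to a smooth function on the line. -/
lemma exists_contDiff_eq_log {c : ℝ} (hc : 0 < c) :
    ∃ L : ℝ → ℝ, ContDiff ℝ ∞ L ∧ ∀ s, c / 2 ≤ s → L s = Real.log s := by
  set τ : ℝ → ℝ := fun s => Real.smoothTransition ((s - c / 4) / (c / 4)) with hτ
  have hτs : ContDiff ℝ ∞ τ := Real.smoothTransition.contDiff.comp
    ((contDiff_id.sub contDiff_const).div_const _)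
  have hpos : ∀ s, 0 < τ s * s + (1 - τ s) * c := by
    intro s
    have h0 : 0 ≤ τ s := Real.smoothTransition.nonneg _
    have h1 : τ s ≤ 1 := Real.smoothTransition.le_one _
    rcases le_or_gt s (c / 4) with hs | hs
    · have : τ s = 0 := Real.smoothTransition.zero_of_nonpos
        (div_nonpos_of_nonpos_of_nonneg (by linarith) (by linarith))
      rw [this]; linarith
    · rcases h0.eq_or_lt with h | h
      · rw [← h]; linarith
      · have : 0 < τ s * s := mul_pos h (by linarith)
        have : 0 ≤ (1 - τ s) * c := mul_nonneg (by linarith) hc.le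
        linarith
  refine ⟨fun s => Real.log (τ s * s + (1 - τ s) * c), ?_, fun s hs => ?_⟩
  · exact ((hτs.mul contDiff_id).add ((contDiff_const.sub hτs).mul contDiff_const)).log
      fun s => (hpos s).ne'
  · have : τ s = 1 := Real.smoothTransition.one_of_one_le (by
      rw [le_div_iff₀ (by linarith)]; linarith)
    simp [this]

/-- The Hopf-Cole transform: `φ = 2β log h` solves the Hamilton-Jacobi equation
`∂ₜφ + β Δφ + ½ ‖∇φ‖² = 0` up to time `T`, and is bounded with its derivatives on the slab. -/
lemma IsCaloric.exists_hopfCole (hβ : 0 < β) (hT : 0 < T) {h : ℝ → Rd d → ℝ}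
    (hh : IsCaloric β T h) {c : ℝ} (hc : 0 < c) (hcw : ∀ x, c ≤ h T x) :
    ∃ φ : ℝ → Rd d → ℝ, ContDiff ℝ ∞ (Function.uncurry φ) ∧
      (∀ t ≤ T, ∀ x, φ t x = 2 * β * Real.log (h t x)) ∧
      (∀ t ≤ T, ∀ x, h t x • gradient (φ t) x = (2 * β) • gradient (h t) x) ∧
      (∀ t ≤ T, ∀ x, deriv (fun s => φ s x) t + β * Laplacian.laplacian (φ t) x
        = -(1 / 2) * ‖gradient (φ t) x‖ ^ 2) ∧
      ∃ M, ∀ t ≤ T, ∀ x, |φ t x| ≤ M ∧ |deriv (fun s => φ s x) t| ≤ M ∧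
        ‖fderiv ℝ (φ t) x‖ ≤ M ∧ |Laplacian.laplacian (φ t) x| ≤ M := by
  -- `h` is positive only up to time `T`, whereas a test function is smooth for all times, so the
  -- logarithm is replaced by a smooth function on the line
  obtain ⟨L, hL, hLlog⟩ := exists_contDiff_eq_log hc
  obtain ⟨M, hM⟩ := hh.bound
  have hM0 : 0 ≤ M := (abs_nonneg _).trans (hM 0 hT.le 0).1
  have hge : ∀ t ≤ T, ∀ x, c ≤ h t x := fun t ht x => hh.le_of_le hβ hcw ht x
  have hLe : ∀ s, c ≤ s → L =ᶠ[𝓝 s] Real.log := fun s hs => by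
    filter_upwards [Ioi_mem_nhds (show c / 2 < s by linarith)] with r hr using hLlog r (le_of_lt hr)
  have hL1 : ∀ s, c ≤ s → deriv L s = s⁻¹ := fun s hs => by
    rw [(hLe s hs).deriv_eq, Real.deriv_log]
  have hL2 : ∀ s, c ≤ s → deriv (deriv L) s = -(s ^ 2)⁻¹ := fun s hs => by
    have h1 := (hLe s hs).deriv
    have h2 : deriv Real.log = fun x => x⁻¹ := by ext x; exact Real.deriv_log x
    rw [h2] at h1
    rw [h1.deriv_eq, deriv_inv]
  set φ : ℝ → Rd d → ℝ := fun t x => 2 * β * L (h t x) with hφ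
  have hφs : ContDiff ℝ ∞ (Function.uncurry φ) := contDiff_const.mul (hL.comp hh.smooth)
  have hgrad : ∀ t ≤ T, ∀ x, gradient (φ t) x = (2 * β * (h t x)⁻¹) • gradient (h t) x := by
    intro t ht x
    have h1 := gradient_comp_real (L := fun s => 2 * β * L s) (contDiff_const.mul hL)
      (contDiff_slice_space hh.smooth t) x
    rw [deriv_const_mul_field, hL1 _ (hge t ht x)] at h1
    exact h1
  have hlap : ∀ t ≤ T, ∀ x, Laplacian.laplacian (φ t) x
      = 2 * β * ((h t x)⁻¹ * Laplacian.laplacian (h t) x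
        - ((h t x) ^ 2)⁻¹ * ‖gradient (h t) x‖ ^ 2) := by
    intro t ht x
    have h1 := laplacian_comp_real (L := fun s => 2 * β * L s) (contDiff_const.mul hL)
      (contDiff_slice_space hh.smooth t) x
    have h2 : deriv (fun s => 2 * β * L s) = fun s => 2 * β * deriv L s := by
      ext s; rw [deriv_const_mul_field]
    rw [h2, deriv_const_mul_field, hL2 _ (hge t ht x)] at h1
    beta_reduce at h1
    rw [hL1 _ (hge t ht x)] at h1
    refine h1.trans ?_
    ring
  have hdt : ∀ t ≤ T, ∀ x, deriv (fun s => φ s x) t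
      = 2 * β * ((h t x)⁻¹ * deriv (fun s => h s x) t) := by
    intro t ht x
    have h1 := (hL.differentiable (by simp) (h t x)).hasDerivAt.comp t
      ((contDiff_slice_time hh.smooth x).differentiable (by simp) t).hasDerivAt
    have h2 := (h1.const_mul (2 * β)).deriv
    rw [hL1 _ (hge t ht x)] at h2
    exact h2
  have hHJ : ∀ t ≤ T, ∀ x, deriv (fun s => φ s x) t + β * Laplacian.laplacian (φ t) x
        = -(1 / 2) * ‖gradient (φ t) x‖ ^ 2 := by
    intro t ht x
    have hp : h t x ≠ 0 := (hc.trans_le (hge t ht x)).ne'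
    rw [hdt t ht, hlap t ht, hgrad t ht, norm_smul, mul_pow, Real.norm_eq_abs, sq_abs]
    have h1 := hh.heat t x
    have h2 : deriv (fun s => h s x) t = -(β * Laplacian.laplacian (h t) x) := by linarith
    rw [h2]
    field_simp
    ring
  refine ⟨φ, hφs, fun t ht x => ?_, fun t ht x => ?_, hHJ, ?_⟩
  · rw [hφ]
    simp only
    rw [hLlog _ (by linarith [hge t ht x])]
  · have hp : h t x ≠ 0 := (hc.trans_le (hge t ht x)).ne'
    rw [hgrad t ht, smul_smul]
    congr 1
    field_simp
  · set B := 2 * β * (c⁻¹ * M) with hB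
    have hB0 : 0 ≤ B := by positivity
    have hinv : ∀ t ≤ T, ∀ x, |(h t x)⁻¹| ≤ c⁻¹ := fun t ht x => by
      rw [abs_of_pos (inv_pos.2 (hc.trans_le (hge t ht x)))]
      exact inv_anti₀ hc (hge t ht x)
    have hb1 : ∀ t ≤ T, ∀ x, |deriv (fun s => φ s x) t| ≤ B := fun t ht x => by
      rw [hdt t ht, abs_mul (2 * β), abs_mul (h t x)⁻¹, abs_of_pos (by positivity : 0 < 2 * β)]
      exact mul_le_mul_of_nonneg_left (mul_le_mul (hinv t ht x) (hM t ht x).2.1 (abs_nonneg _)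
        (by positivity)) (by positivity)
    have hb2 : ∀ t ≤ T, ∀ x, ‖gradient (φ t) x‖ ≤ B := fun t ht x => by
      rw [hgrad t ht, norm_smul, Real.norm_eq_abs, abs_mul (2 * β), abs_of_pos (by positivity : 0 < 2 * β),
        mul_assoc]
      refine mul_le_mul_of_nonneg_left (mul_le_mul (hinv t ht x) ?_ (norm_nonneg _)
        (by positivity)) (by positivity)
      rw [norm_gradient]
      exact (hM t ht x).2.2
    set N := 2 * β * max |Real.log c| |Real.log M| with hN
    have hN0 : 0 ≤ N := mul_nonneg (by positivity) ((abs_nonneg _).trans (le_max_left _ _))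
    have hC0 : 0 ≤ (B + B ^ 2) / β := by positivity
    refine ⟨N + B + (B + B ^ 2) / β, fun t ht x => ⟨?_, ?_, ?_, ?_⟩⟩
    · have h1 : |φ t x| ≤ N := by
        rw [hφ]
        simp only
        rw [hLlog _ (by linarith [hge t ht x]), abs_mul (2 * β), abs_of_pos (by positivity : 0 < 2 * β), hN]
        refine mul_le_mul_of_nonneg_left (abs_le_max_abs_abs
          (Real.log_le_log hc (hge t ht x)) (Real.log_le_log (hc.trans_le (hge t ht x)) ?_))
          (by positivity)
        exact (le_abs_self _).trans (hM t ht x).1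
      linarith
    · linarith [hb1 t ht x]
    · rw [← norm_gradient]
      linarith [hb2 t ht x]
    · -- the bound on the Laplacian comes from the equation itself
      have h1 : Laplacian.laplacian (φ t) x
          = (-(1 / 2) * ‖gradient (φ t) x‖ ^ 2 - deriv (fun s => φ s x) t) / β := by
        rw [← hHJ t ht x]
        field_simp
        ring
      have h2 : |Laplacian.laplacian (φ t) x| ≤ (B + B ^ 2) / β := by
        rw [h1, abs_div, abs_of_pos hβ]
        refine div_le_div_of_nonneg_right ((abs_sub _ _).trans ?_) hβ.le
        have h3 := pow_le_pow_left₀ (norm_nonneg _) (hb2 t ht x) 2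
        rw [abs_mul, abs_neg, abs_of_nonneg (by positivity : 0 ≤ ‖gradient (φ t) x‖ ^ 2),
          abs_of_pos (by norm_num : (0 : ℝ) < 1 / 2)]
        nlinarith [hb1 t ht x, sq_nonneg ‖gradient (φ t) x‖]
      linarith

end HopfCole

/-! ### The dual lower bound for the kinetic energy -/

section LowerBound

variable {d : ℕ} {β T : ℝ} {ρ₀ q : Rd d → ℝ} {ρ : ℝ → Rd d → ℝ} {v : ℝ → Rd d → Rd d}

lemma ae_mem_Ioo (T : ℝ) : ∀ᵐ t ∂(volume.restrict (Icc (0 : ℝ) T)), t ∈ Ioo 0 T := by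
  rw [← Measure.restrict_congr_set (Ioo_ae_eq_Icc (a := (0 : ℝ)) (b := T))]
  exact ae_restrict_mem measurableSet_Ioo

/-- A measurable curve of densities is integrable on the slab. -/
lemma integrable_slab_of_isDensity (hρ : Measurable (Function.uncurry ρ))
    (hd : ∀ t ∈ Ioo 0 T, IsDensity (ρ t)) :
    Integrable (fun p : ℝ × Rd d => ρ p.1 p.2) (slab d T) := by
  have hρ' : Measurable fun p : ℝ × Rd d => ρ p.1 p.2 := hρ
  rw [slab, integrable_prod_iff hρ'.aestronglyMeasurable]
  refine ⟨?_, ?_⟩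
  · filter_upwards [ae_mem_Ioo T] with t ht using (hd t ht).integrable
  · refine (integrable_const (1 : ℝ)).congr ?_
    filter_upwards [ae_mem_Ioo T] with t ht
    simp_rw [Real.norm_of_nonneg ((hd t ht).nonneg _)]
    exact (hd t ht).integral_eq_one.symm

lemma IsAdmissible.integrable_density (h : IsAdmissible T β ρ₀ q ρ v) :
    Integrable (fun p : ℝ × Rd d => ρ p.1 p.2) (slab d T) :=
  integrable_slab_of_isDensity h.measurable_density h.isDensity

lemma IsAdmissible.ae_nonneg (h : IsAdmissible T β ρ₀ q ρ v) :
    ∀ᵐ p : ℝ × Rd d ∂(slab d T), 0 ≤ ρ p.1 p.2 :=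
  ae_slab_of_forall_Ioo fun t ht x => (h.isDensity t ht).nonneg x

lemma IsAdmissible.integrable_norm_field (h : IsAdmissible T β ρ₀ q ρ v) :
    Integrable (fun p : ℝ × Rd d => ‖v p.1 p.2‖ * ρ p.1 p.2) (slab d T) := by
  refine (h.integrable_density.add h.finite_energy).mono'
    (h.measurable_field.norm.mul h.measurable_density).aestronglyMeasurable ?_
  filter_upwards [h.ae_nonneg] with p hp
  rw [Real.norm_of_nonneg (mul_nonneg (norm_nonneg _) hp)]
  simp only [Pi.add_apply]
  nlinarith [mul_nonneg (sq_nonneg (‖v p.1 p.2‖ - 1)) hp, mul_nonneg (norm_nonneg (v p.1 p.2)) hp]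

/-- The average of `w` over the heat kernel centred at `y`. -/
def heatAvg {d : ℕ} (β T : ℝ) (w : Rd d → ℝ) (y : Rd d) : ℝ :=
  ∫ z, w z * heatKernel β T (z - y)

lemma IsCaloric.heatAvg_eq {h : ℝ → Rd d → ℝ} (hh : IsCaloric β T h) (hT : 0 < T) (y : Rd d) :
    heatAvg β T (h T) y = h 0 y :=
  hh.integral_mul_heatKernel hT le_rfl y

/-- Duality bound: testing the Fokker-Planck equation against the solution `2β log h` of the
Hamilton-Jacobi equation bounds the kinetic energy from below. -/
lemma IsAdmissible.le_kineticEnergy (h : IsAdmissible T β ρ₀ q ρ v) (hT : 0 < T) (hβ : 0 < β)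
    (hρ₀ : Integrable ρ₀) (hq : Integrable q) {w : Rd d → ℝ} (hw : w ∈ trigPoly d) {c : ℝ}
    (hc : 0 < c) (hcw : ∀ x, c ≤ w x) :
    2 * β * (∫ x, Real.log (w x) * q x) - 2 * β * (∫ y, Real.log (heatAvg β T w y) * ρ₀ y)
      ≤ kineticEnergy T ρ v := by
  obtain ⟨g, hg, rfl⟩ := exists_isCaloric_of_mem_trigPoly (T := T) hβ hw
  obtain ⟨φ, hφs, hφ, -, hHJ, M, hM⟩ := hg.exists_hopfCole hβ hT hc hcw
  have key := h.equation.integral_testOp hT hβ hρ₀ hq h.measurable_field h.integrable_density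
    h.integrable_norm_field hφs (fun t ht x => hM t ht.2 x)
  simp_rw [hφ T le_rfl, hφ 0 hT.le, mul_assoc (2 * β)] at key
  rw [integral_const_mul, integral_const_mul] at key
  simp_rw [hg.heatAvg_eq hT]
  rw [key, kineticEnergy]
  have hfe : Integrable (fun p : ℝ × Rd d => 1 / 2 * ‖v p.1 p.2‖ ^ 2 * ρ p.1 p.2) (slab d T) := by
    simp_rw [mul_assoc]
    exact h.finite_energy.const_mul _
  refine integral_mono_ae ?_ hfe ?_
  · refine ((h.integrable_density.norm.const_mul (M * (1 + β))).add
      (h.integrable_norm_field.norm.const_mul M)).mono'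
      ((measurable_testOp h.measurable_field hφs).mul h.measurable_density).aestronglyMeasurable ?_
    refine ae_slab_of_forall_Icc fun t ht x => ?_
    have := abs_testOp_le hβ v (p := (t, x)) (hM t ht.2 x).2.1 (hM t ht.2 x).2.2.1
      (hM t ht.2 x).2.2.2
    simp only [Pi.add_apply]
    rw [norm_mul, norm_mul, norm_norm]
    calc _ ≤ (M * (1 + β) + M * ‖v t x‖) * ‖ρ t x‖ :=
          mul_le_mul_of_nonneg_right this (norm_nonneg _)
      _ = _ := by ring
  · filter_upwards [h.ae_nonneg, ae_slab_of_forall_Icc (T := T)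
      (P := fun p : ℝ × Rd d => p.1 ≤ T) fun t ht x => ht.2] with p hp hpT
    refine mul_le_mul_of_nonneg_right ?_ hp
    have h1 := hHJ p.1 hpT p.2
    have h2 := norm_sub_sq_real (v p.1 p.2) (gradient (φ p.1) p.2)
    have h3 := sq_nonneg ‖v p.1 p.2 - gradient (φ p.1) p.2‖
    unfold testOp
    linarith

end LowerBound

/-! ### The heat flow of an integrable function -/

/-- The solution at time `t` of the heat equation `∂ₜu = β Δu` with initial value `r`. -/
def heatFlow {d : ℕ} (β t : ℝ) (r : Rd d → ℝ) (x : Rd d) : ℝ :=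
  ∫ y, heatKernel β t (x - y) * r y

section HeatFlow

variable {d : ℕ} {β t : ℝ} {r : Rd d → ℝ}

instance (T : ℝ) : SFinite (slab d T) := by unfold slab; infer_instance

/-- Integrability on the product from a bound on the mass of a nonnegative kernel (Tonelli). -/
lemma integrable_kernel_mul {α : Type*} [MeasurableSpace α] {μ : Measure α} [SFinite μ]
    {k : α → Rd d → ℝ} (hk : Measurable (Function.uncurry k)) (h0 : ∀ a y, 0 ≤ k a y)
    (hi : ∀ y, Integrable (fun a => k a y) μ) {b : Rd d → ℝ} (hb : ∀ y, ∫ a, k a y ∂μ ≤ b y)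
    (hr : Measurable r) (hbr : Integrable (fun y => b y * r y)) :
    Integrable (fun z : α × Rd d => k z.1 z.2 * r z.2) (μ.prod volume) := by
  have hk' : Measurable fun z : α × Rd d => k z.1 z.2 := hk
  have hm : Measurable fun z : α × Rd d => k z.1 z.2 * r z.2 := hk'.mul (hr.comp measurable_snd)
  rw [integrable_prod_iff' hm.aestronglyMeasurable]
  refine ⟨Eventually.of_forall fun y => (hi y).mul_const (r y), ?_⟩
  refine hbr.mono (hm.norm.stronglyMeasurable.integral_prod_left').aestronglyMeasurable
    (Eventually.of_forall fun y => ?_)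
  have h1 : ∀ a, ‖k a y * r y‖ = k a y * |r y| := fun a => by
    rw [norm_mul, Real.norm_of_nonneg (h0 a y), Real.norm_eq_abs]
  simp only [h1]
  have h2 : 0 ≤ ∫ a, k a y ∂μ := integral_nonneg fun a => h0 a y
  rw [integral_mul_const, norm_mul, norm_mul, Real.norm_of_nonneg h2,
    Real.norm_of_nonneg (h2.trans (hb y)), Real.norm_eq_abs, abs_abs]
  exact mul_le_mul_of_nonneg_right (hb y) (abs_nonneg _)

lemma measurable_heatKernel_sub (t : ℝ) :
    Measurable (Function.uncurry fun x y : Rd d => heatKernel β t (x - y)) :=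
  (continuous_heatKernel t).measurable.comp (measurable_fst.sub measurable_snd)

lemma measurable_heatFlow (hr : Measurable r) :
    Measurable (fun p : ℝ × Rd d => heatFlow β p.1 r p.2) := by
  have h : Measurable fun z : (ℝ × Rd d) × Rd d => heatKernel β z.1.1 (z.1.2 - z.2) * r z.2 :=
    (measurable_heatKernel.comp ((measurable_fst.comp measurable_fst).prodMk
      ((measurable_snd.comp measurable_fst).sub measurable_snd))).mul (hr.comp measurable_snd)
  exact (h.stronglyMeasurable.integral_prod_right').measurable

lemma measurable_heatFlow_apply (hr : Measurable r) : Measurable (heatFlow β t r) :=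
  (measurable_heatFlow hr).comp (measurable_const.prodMk measurable_id)

lemma heatFlow_nonneg (hβ : 0 < β) (hr : ∀ y, 0 ≤ r y) (x : Rd d) : 0 ≤ heatFlow β t r x :=
  integral_nonneg fun y => mul_nonneg (heatKernel_nonneg hβ _ _) (hr y)

lemma integrable_heatKernel_mul (hβ : 0 < β) (hr : Integrable r) (x : Rd d) :
    Integrable fun y => heatKernel β t (x - y) * r y := by
  refine hr.bdd_mul (c := (√t ^ d)⁻¹ * gaussDensity β (0 : Rd d))
    ((continuous_heatKernel t).comp (continuous_const.sub continuous_id)).aestronglyMeasurable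
    (Eventually.of_forall fun y => ?_)
  rw [Real.norm_of_nonneg (heatKernel_nonneg hβ _ _)]
  exact heatKernel_le hβ t _

lemma heatFlow_le (hβ : 0 < β) (hr : Integrable r) (h0 : ∀ y, 0 ≤ r y) (x : Rd d) :
    heatFlow β t r x ≤ (√t ^ d)⁻¹ * gaussDensity β (0 : Rd d) * ∫ y, r y := by
  rw [heatFlow, ← integral_const_mul]
  exact integral_mono (integrable_heatKernel_mul hβ hr x) (hr.const_mul _)
    fun y => mul_le_mul_of_nonneg_right (heatKernel_le hβ t _) (h0 y)

lemma integrable_prod_heatKernel (hβ : 0 < β) (ht : 0 < t) (hm : Measurable r)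
    (hr : Integrable r) : Integrable
      (fun z : Rd d × Rd d => heatKernel β t (z.1 - z.2) * r z.2) (volume.prod volume) :=
  integrable_kernel_mul (measurable_heatKernel_sub t) (fun _ _ => heatKernel_nonneg hβ _ _)
    (fun y => integrable_heatKernel hβ ht y) (b := fun _ => 1)
    (fun y => (integral_heatKernel hβ ht y).le) hm (by simpa using hr)

lemma integrable_bdd_mul_prod_heatKernel (hβ : 0 < β) (ht : 0 < t) (hm : Measurable r)
    (hr : Integrable r) {a : Rd d → ℝ} (ha : Measurable a) {M : ℝ} (hM : ∀ x, |a x| ≤ M) :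
    Integrable (fun z : Rd d × Rd d => a z.1 * (heatKernel β t (z.1 - z.2) * r z.2))
      (volume.prod volume) :=
  (integrable_prod_heatKernel hβ ht hm hr).bdd_mul (c := M)
    (ha.comp measurable_fst).aestronglyMeasurable (Eventually.of_forall fun z => hM z.1)

lemma integrable_mul_heatFlow (hβ : 0 < β) (ht : 0 < t) (hm : Measurable r)
    (hr : Integrable r) {a : Rd d → ℝ} (ha : Measurable a) {M : ℝ} (hM : ∀ x, |a x| ≤ M) :
    Integrable fun x => a x * heatFlow β t r x := by
  refine (integrable_bdd_mul_prod_heatKernel hβ ht hm hr ha hM).integral_prod_left.congr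
    (Eventually.of_forall fun x => ?_)
  simp only [heatFlow]
  rw [integral_const_mul]

/-- The heat flow is symmetric: it can be moved onto a bounded factor. -/
lemma integral_mul_heatFlow (hβ : 0 < β) (ht : 0 < t) (hm : Measurable r)
    (hr : Integrable r) {a : Rd d → ℝ} (ha : Measurable a) {M : ℝ} (hM : ∀ x, |a x| ≤ M) :
    ∫ x, a x * heatFlow β t r x = ∫ y, heatAvg β t a y * r y := by
  have h := integral_integral_swap (f := fun x y => a x * (heatKernel β t (x - y) * r y))
    (integrable_bdd_mul_prod_heatKernel hβ ht hm hr ha hM)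
  simp only [heatFlow, heatAvg, ← integral_const_mul, ← integral_mul_const]
  simp only [mul_assoc]
  exact h

/-- The heat flow preserves finiteness of second moments. -/
lemma integrable_sq_norm_mul_heatFlow (hβ : 0 < β) (ht : 0 < t) (hm : Measurable r)
    (hr : Integrable r) (hr2 : Integrable fun x => ‖x‖ ^ 2 * r x) :
    Integrable fun x => ‖x‖ ^ 2 * heatFlow β t r x := by
  have hG := integrable_gaussDensity (d := d) hβ
  have hG2 := integrable_sq_norm_mul_gaussDensity (d := d) hβ
  set m := ∫ z : Rd d, ‖z‖ ^ 2 * gaussDensity β z with hmdef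
  have hbd : ∀ y z : Rd d, ‖y + √t • z‖ ^ 2 * gaussDensity β z
      ≤ 2 * ‖y‖ ^ 2 * gaussDensity β z + 2 * t * (‖z‖ ^ 2 * gaussDensity β z) := by
    intro y z
    have h1 : ‖y + √t • z‖ ^ 2 ≤ 2 * ‖y‖ ^ 2 + 2 * t * ‖z‖ ^ 2 := by
      have h2 := pow_le_pow_left₀ (norm_nonneg _) (norm_add_le y (√t • z)) 2
      have h3 : ‖√t • z‖ ^ 2 = t * ‖z‖ ^ 2 := by
        rw [norm_smul, mul_pow, Real.norm_eq_abs, sq_abs, Real.sq_sqrt ht.le]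
      nlinarith [sq_nonneg (‖y‖ - ‖√t • z‖)]
    have := mul_le_mul_of_nonneg_right h1 (gaussDensity_pos hβ z).le
    linarith
  have hdom : ∀ y : Rd d, Integrable fun z : Rd d =>
      2 * ‖y‖ ^ 2 * gaussDensity β z + 2 * t * (‖z‖ ^ 2 * gaussDensity β z) :=
    fun y => (hG.const_mul _).add (hG2.const_mul _)
  have hint : ∀ y : Rd d, Integrable fun z : Rd d => ‖y + √t • z‖ ^ 2 * gaussDensity β z := by
    intro y
    refine (hdom y).mono' ?_ (Eventually.of_forall fun z => ?_)
    · have := continuous_gaussDensity (d := d) (β := β)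
      exact (by fun_prop : Continuous fun z : Rd d =>
        ‖y + √t • z‖ ^ 2 * gaussDensity β z).aestronglyMeasurable
    · rw [Real.norm_of_nonneg (mul_nonneg (by positivity) (gaussDensity_pos hβ z).le)]
      exact hbd y z
  have key := integrable_kernel_mul (μ := (volume : Measure (Rd d))) (r := r)
    (k := fun x y => ‖x‖ ^ 2 * heatKernel β t (x - y))
    ((measurable_fst.norm.pow_const 2).mul (measurable_heatKernel_sub t))
    (fun x y => mul_nonneg (by positivity) (heatKernel_nonneg hβ _ _))
    (fun y => (integrable_mul_heatKernel_iff ht (fun x => ‖x‖ ^ 2) y).2 (hint y))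
    (b := fun y => 2 * ‖y‖ ^ 2 + 2 * t * m)
    (fun y => by
      rw [integral_mul_heatKernel ht (fun x => ‖x‖ ^ 2) y]
      refine (integral_mono (hint y) (hdom y) (hbd y)).trans_eq ?_
      rw [integral_add (hG.const_mul _) (hG2.const_mul _), integral_const_mul, integral_const_mul,
        integral_gaussDensity hβ, mul_one])
    hm (((hr2.const_mul 2).add (hr.const_mul (2 * t * m))).congr
      (Eventually.of_forall fun y => by simp only [Pi.add_apply]; ring))
  refine key.integral_prod_left.congr (Eventually.of_forall fun x => ?_)
  simp only [heatFlow, mul_assoc]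
  rw [integral_const_mul]

end HeatFlow

/-! ### The optimal flow for a trigonometric weight -/

/-- The marginal at time `T` of the coupling `w(x) G(x - y) / ∫ w(z) G(z - y) dz · ρ₀(y)`,
where `G` is the heat kernel at time `T`. -/
def gibbsDensity {d : ℕ} (β T : ℝ) (ρ₀ w : Rd d → ℝ) (x : Rd d) : ℝ :=
  w x * heatFlow β T (fun y => ρ₀ y / heatAvg β T w y) x

section Competitor

variable {d : ℕ} {β T : ℝ} {ρ₀ : Rd d → ℝ}

/-- The curve `ρ(t) = h(t) · heatFlow t (ρ₀ / h(0))` driven by the field `v = 2β ∇ log h`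
(both for a positive solution `h` of the backward heat equation) is a weak solution of the
Fokker-Planck equation. -/
lemma IsCaloric.solvesFokkerPlanck (hβ : 0 < β) (hT : 0 < T) (hm : Measurable ρ₀)
    (hi : Integrable ρ₀) {h : ℝ → Rd d → ℝ} (hh : IsCaloric β T h) {c : ℝ} (hc : 0 < c)
    (hcw : ∀ x, c ≤ h T x) {v : ℝ → Rd d → Rd d}
    (hv : ∀ t ≤ T, ∀ x, h t x • v t x = (2 * β) • gradient (h t) x) :
    SolvesFokkerPlanck T β ρ₀ (fun x => h T x * heatFlow β T (fun y => ρ₀ y / h 0 y) x)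
      (fun t x => h t x * heatFlow β t (fun y => ρ₀ y / h 0 y) x) v := by
  intro ψ hψ hψc
  have hh0 : ∀ y, 0 < h 0 y := fun y => hc.trans_le (hh.le_of_le hβ hcw hT.le y)
  set r : Rd d → ℝ := fun y => ρ₀ y / h 0 y with hr
  have hrm : Measurable r := hm.div (contDiff_slice_space hh.smooth 0).continuous.measurable
  have hri : Integrable r := by
    refine (hi.norm.const_mul c⁻¹).mono' hrm.aestronglyMeasurable (Eventually.of_forall fun y => ?_)
    rw [hr, norm_div, Real.norm_of_nonneg (hh0 y).le, div_eq_inv_mul]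
    exact mul_le_mul_of_nonneg_right (inv_anti₀ hc (hh.le_of_le hβ hcw hT.le y)) (norm_nonneg _)
  set θ : ℝ → Rd d → ℝ := fun t x => ψ t x * h t x with hθ
  have hθs : ContDiff ℝ ∞ (Function.uncurry θ) := hψ.mul hh.smooth
  have hθc : HasCompactSupport (Function.uncurry θ) := hψc.mul_right
  obtain ⟨M, hM⟩ := exists_bound_of_hasCompactSupport hθs hθc
  set D : ℝ × Rd d → ℝ := fun p =>
    deriv (fun s => θ s p.2) p.1 + β * Laplacian.laplacian (θ p.1) p.2 with hD
  have hDc : Continuous D :=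
    (contDiff_deriv_time hθs).continuous.add (continuous_const.mul (continuous_laplacian_space hθs))
  have hDb : ∀ p, |D p| ≤ M + β * M := fun p => by
    refine (abs_add_le _ _).trans (add_le_add (hM _ _).2.1 ?_)
    rw [abs_mul, abs_of_pos hβ]
    exact mul_le_mul_of_nonneg_left (hM _ _).2.2.2.1 hβ.le
  -- Doob transform: the generator conjugated by `h` is the heat operator
  have hconj : ∀ t ≤ T, ∀ x, testOp β v ψ (t, x) * h t x = D (t, x) := by
    intro t ht x
    have e1 : deriv (fun s => θ s x) t
        = deriv (fun s => ψ s x) t * h t x + ψ t x * deriv (fun s => h s x) t :=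
      deriv_fun_mul ((contDiff_slice_time hψ x).differentiable (by simp) t)
        ((contDiff_slice_time hh.smooth x).differentiable (by simp) t)
    have e2 := laplacian_mul (contDiff_slice_space hψ t) (contDiff_slice_space hh.smooth t) x
    have e3 : h t x * inner ℝ (v t x) (gradient (ψ t) x)
        = 2 * β * inner ℝ (gradient (ψ t) x) (gradient (h t) x) := by
      rw [← real_inner_smul_left, hv t ht, real_inner_smul_left, real_inner_comm]
    have e4 := hh.heat t x
    change _ = deriv (fun s => θ s x) t
      + β * Laplacian.laplacian (fun y => ψ t y * h t y) x
    rw [e1, e2]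
    unfold testOp
    linear_combination e3 - ψ t x * e4
  have hkm : Measurable (Function.uncurry fun (p : ℝ × Rd d) (y : Rd d) =>
      heatKernel β p.1 (p.2 - y)) :=
    measurable_heatKernel.comp ((measurable_fst.comp measurable_fst).prodMk
      ((measurable_snd.comp measurable_fst).sub measurable_snd))
  have hslab : ∀ y : Rd d, ∫ p : ℝ × Rd d, heatKernel β p.1 (p.2 - y) ∂(slab d T) ≤ T := by
    intro y
    have h1 := integrable_heatKernel_slab (T := T) hβ y
    rw [slab] at h1 ⊢
    rw [integral_prod _ h1, integral_congr_ae (g := fun _ => (1 : ℝ))]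
    · simp [hT.le]
    · filter_upwards [ae_mem_Ioo T] with t ht using integral_heatKernel hβ ht.1 y
  have hF : Integrable (fun z : (ℝ × Rd d) × Rd d =>
      D z.1 * (heatKernel β z.1.1 (z.1.2 - z.2) * r z.2)) ((slab d T).prod volume) := by
    refine (integrable_kernel_mul hkm (fun p y => heatKernel_nonneg hβ _ _)
      (fun y => integrable_heatKernel_slab hβ y) (b := fun _ => T) hslab hrm
      (hri.const_mul T)).bdd_mul (c := M + β * M)
      (hDc.measurable.comp measurable_fst).aestronglyMeasurable
      (Eventually.of_forall fun z => hDb z.1)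
  have hR : ∫ p, testOp β v ψ p * (h p.1 p.2 * heatFlow β p.1 r p.2) ∂(slab d T)
      = ∫ y, ((∫ x, θ T x * heatKernel β T (x - y)) - θ 0 y) * r y := by
    have e1 : ∫ p, testOp β v ψ p * (h p.1 p.2 * heatFlow β p.1 r p.2) ∂(slab d T)
        = ∫ p, (∫ y, D p * (heatKernel β p.1 (p.2 - y) * r y)) ∂(slab d T) := by
      refine integral_congr_ae (ae_slab_of_forall_Icc fun t ht x => ?_)
      simp only
      rw [← mul_assoc, hconj t ht.2, integral_const_mul, heatFlow]
    rw [e1, integral_integral_swap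
      (f := fun (p : ℝ × Rd d) (y : Rd d) => D p * (heatKernel β p.1 (p.2 - y) * r y)) hF]
    refine integral_congr_ae (Eventually.of_forall fun y => ?_)
    simp only
    rw [heatKernel_weak_solution hβ hT hθs hθc y, ← integral_mul_const]
    simp only [hD, mul_assoc]
  have hb1 : ∀ x, |θ T x| ≤ M := fun x => (hM T x).1
  have hθTm : Measurable (θ T) := (contDiff_slice_space hθs T).continuous.measurable
  have h0 : Integrable fun y => θ 0 y * r y :=
    hri.bdd_mul (c := M) (contDiff_slice_space hθs 0).continuous.aestronglyMeasurable
      (Eventually.of_forall fun x => (hM 0 x).1)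
  have h1 : Integrable fun y => (∫ x, θ T x * heatKernel β T (x - y)) * r y := by
    refine (integrable_bdd_mul_prod_heatKernel hβ hT hrm hri hθTm hb1).integral_prod_right.congr
      (Eventually.of_forall fun y => ?_)
    simp only [← mul_assoc]
    rw [integral_mul_const]
  change _ = ∫ p, testOp β v ψ p * (h p.1 p.2 * heatFlow β p.1 r p.2) ∂(slab d T)
  rw [hR]
  simp_rw [sub_mul]
  rw [integral_sub h1 h0]
  congr 1
  · have := integral_mul_heatFlow hβ hT hrm hri hθTm hb1
    simp only [hθ, heatAvg, mul_assoc] at this ⊢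
    exact this
  · refine integral_congr_ae (Eventually.of_forall fun y => ?_)
    simp only [hθ, hr]
    have := (hh0 y).ne'
    field_simp

lemma IsCaloric.isDensity (hβ : 0 < β) (hρ₀ : ρ₀ ∈ P2 d) {h : ℝ → Rd d → ℝ}
    (hh : IsCaloric β T h) {c : ℝ} (hc : 0 < c) (hcw : ∀ x, c ≤ h T x) {t : ℝ} (ht : 0 < t)
    (htT : t ≤ T) : IsDensity (fun x => h t x * heatFlow β t (fun y => ρ₀ y / h 0 y) x) := by
  obtain ⟨hm, ⟨hpos, hi, h1⟩, -⟩ := hρ₀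
  have hge : ∀ t ≤ T, ∀ x, 0 < h t x := fun t ht x => hc.trans_le (hh.le_of_le hβ hcw ht x)
  have hrm : Measurable fun y => ρ₀ y / h 0 y :=
    hm.div (contDiff_slice_space hh.smooth 0).continuous.measurable
  have h0T : 0 ≤ T := ht.le.trans htT
  have hri : Integrable fun y => ρ₀ y / h 0 y := by
    refine (hi.norm.const_mul c⁻¹).mono' hrm.aestronglyMeasurable (Eventually.of_forall fun y => ?_)
    rw [norm_div, Real.norm_of_nonneg (hge 0 h0T y).le, div_eq_inv_mul]
    exact mul_le_mul_of_nonneg_right (inv_anti₀ hc (hh.le_of_le hβ hcw h0T y)) (norm_nonneg _)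
  obtain ⟨M, hM⟩ := hh.bound
  have hhm : Measurable (h t) := (contDiff_slice_space hh.smooth t).continuous.measurable
  have hb : ∀ x, |h t x| ≤ M := fun x => (hM t htT x).1
  refine ⟨fun x => mul_nonneg (hge t htT x).le (heatFlow_nonneg hβ (fun y => div_nonneg (hpos y)
    (hge 0 h0T y).le) x), integrable_mul_heatFlow hβ ht hrm hri hhm hb, ?_⟩
  rw [integral_mul_heatFlow hβ ht hrm hri hhm hb, ← h1]
  refine integral_congr_ae (Eventually.of_forall fun y => ?_)
  simp only [heatAvg]
  rw [hh.integral_mul_heatKernel ht htT, mul_div_cancel₀ _ (hge 0 h0T y).ne']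

/-- The competitor attached to a positive trigonometric weight `w`: its terminal density is the
Gibbs density of `w`, and it attains the duality bound for `w`. -/
lemma exists_isAdmissible_gibbsDensity (hβ : 0 < β) (hT : 0 < T) (hρ₀ : ρ₀ ∈ P2 d)
    {w : Rd d → ℝ} (hw : w ∈ trigPoly d) {c : ℝ} (hc : 0 < c) (hcw : ∀ x, c ≤ w x) :
    gibbsDensity β T ρ₀ w ∈ P2 d ∧ (∃ M, ∀ x, gibbsDensity β T ρ₀ w x ≤ M) ∧
    ∃ (ρ : ℝ → Rd d → ℝ) (v : ℝ → Rd d → Rd d),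
      IsAdmissible T β ρ₀ (gibbsDensity β T ρ₀ w) ρ v ∧
      kineticEnergy T ρ v = 2 * β * (∫ x, Real.log (w x) * gibbsDensity β T ρ₀ w x)
        - 2 * β * (∫ y, Real.log (heatAvg β T w y) * ρ₀ y) := by
  obtain ⟨h, hh, rfl⟩ := exists_isCaloric_of_mem_trigPoly (T := T) hβ hw
  obtain ⟨φ, hφs, hφ, hgrad, hHJ, M, hM⟩ := hh.exists_hopfCole hβ hT hc hcw
  obtain ⟨N, hN⟩ := hh.bound
  have hq : gibbsDensity β T ρ₀ (h T) = fun x => h T x * heatFlow β T (fun y => ρ₀ y / h 0 y) x := by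
    ext x
    simp only [gibbsDensity, hh.heatAvg_eq hT]
  have hdens := hh.isDensity hβ hρ₀ hc hcw hT le_rfl
  have hρ₀' := hρ₀
  obtain ⟨hm, ⟨hpos, hi, h1⟩, h2⟩ := hρ₀
  have hge0 : ∀ y, c ≤ h 0 y := fun y => hh.le_of_le hβ hcw hT.le y
  have hrm : Measurable fun y => ρ₀ y / h 0 y :=
    hm.div (contDiff_slice_space hh.smooth 0).continuous.measurable
  have hrpos : ∀ y, 0 ≤ ρ₀ y / h 0 y := fun y => div_nonneg (hpos y) (hc.trans_le (hge0 y)).le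
  have hrle : ∀ y, ρ₀ y / h 0 y ≤ c⁻¹ * ρ₀ y := fun y => by
    rw [div_eq_inv_mul]
    exact mul_le_mul_of_nonneg_right (inv_anti₀ hc (hge0 y)) (hpos y)
  have hri : Integrable fun y => ρ₀ y / h 0 y :=
    (hi.const_mul c⁻¹).mono' hrm.aestronglyMeasurable (Eventually.of_forall fun y => by
      rw [Real.norm_of_nonneg (hrpos y)]; exact hrle y)
  have hhm : Measurable (h T) := (contDiff_slice_space hh.smooth T).continuous.measurable
  have hr2 : Integrable fun y => ‖y‖ ^ 2 * (ρ₀ y / h 0 y) := by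
    refine (h2.const_mul c⁻¹).mono' ((measurable_norm.pow_const 2).mul hrm).aestronglyMeasurable
      (Eventually.of_forall fun y => ?_)
    rw [Real.norm_of_nonneg (mul_nonneg (by positivity) (hrpos y)), mul_left_comm]
    exact mul_le_mul_of_nonneg_left (hrle y) (by positivity)
  have hP2 : gibbsDensity β T ρ₀ (h T) ∈ P2 d := by
    rw [hq]
    refine ⟨hhm.mul (measurable_heatFlow_apply hrm), hdens, ?_⟩
    refine ((integrable_sq_norm_mul_heatFlow hβ hT hrm hri hr2).bdd_mul (c := N)
      hhm.aestronglyMeasurable (Eventually.of_forall fun x => (hN T le_rfl x).1)).congr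
      (Eventually.of_forall fun x => ?_)
    simp only
    ring
  refine ⟨hP2, ?_, fun t x => h t x * heatFlow β t (fun y => ρ₀ y / h 0 y) x,
    fun t x => gradient (φ t) x, ?_⟩
  · refine ⟨N * ((√T ^ d)⁻¹ * gaussDensity β (0 : Rd d) * ∫ y, ρ₀ y / h 0 y), fun x => ?_⟩
    rw [hq]
    refine mul_le_mul ((le_abs_self _).trans (hN T le_rfl x).1) (heatFlow_le hβ hri hrpos x)
      (heatFlow_nonneg hβ hrpos x) ((abs_nonneg _).trans (hN T le_rfl x).1)
  · have hρm : Measurable (Function.uncurry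
        fun t x => h t x * heatFlow β t (fun y => ρ₀ y / h 0 y) x) :=
      hh.smooth.continuous.measurable.mul (measurable_heatFlow hrm)
    have hvm : Measurable (Function.uncurry fun t x => gradient (φ t) x) :=
      (continuous_gradient_space hφs).measurable
    have hd : ∀ t ∈ Ioo 0 T, IsDensity fun x => h t x * heatFlow β t (fun y => ρ₀ y / h 0 y) x :=
      fun t ht => hh.isDensity hβ hρ₀' hc hcw ht.1 ht.2.le
    have hadm : IsAdmissible T β ρ₀ (gibbsDensity β T ρ₀ (h T))
        (fun t x => h t x * heatFlow β t (fun y => ρ₀ y / h 0 y) x)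
        (fun t x => gradient (φ t) x) := by
      refine ⟨hρm, hvm, hd, ?_, ?_⟩
      · refine (integrable_slab_of_isDensity hρm hd).bdd_mul (c := M ^ 2)
          (hvm.norm.pow_const 2).aestronglyMeasurable (ae_slab_of_forall_Icc fun t ht x => ?_)
        rw [Real.norm_of_nonneg (by positivity), norm_gradient]
        exact pow_le_pow_left₀ (norm_nonneg _) (hM t ht.2 x).2.2.1 2
      · rw [hq]
        exact hh.solvesFokkerPlanck hβ hT hm hi hc hcw hgrad
    refine ⟨hadm, ?_⟩
    -- testing with `φ` itself is the equality case of the duality bound, since `v = ∇φ`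
    have key := hadm.equation.integral_testOp hT hβ hi hP2.2.1.integrable hvm
      hadm.integrable_density hadm.integrable_norm_field hφs (fun t ht x => hM t ht.2 x)
    simp_rw [hφ T le_rfl, hφ 0 hT.le, mul_assoc (2 * β)] at key
    rw [integral_const_mul, integral_const_mul] at key
    simp_rw [hh.heatAvg_eq hT]
    rw [key, kineticEnergy]
    refine integral_congr_ae (ae_slab_of_forall_Icc fun t ht x => ?_)
    have e1 := hHJ t ht.2 x
    simp only [testOp]
    rw [real_inner_self_eq_norm_sq]
    linear_combination (-(h t x * heatFlow β t (fun y => ρ₀ y / h 0 y) x)) * e1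

end Competitor

/-! ### Convexity of the kinetic energy and the first-order condition -/

section Mixing

variable {d : ℕ} {β T : ℝ} {ρ₀ q₀ q₁ : Rd d → ℝ} {ρ ρ' : ℝ → Rd d → ℝ} {v v' : ℝ → Rd d → Rd d}

lemma add_smul_inv_smul {a b : ℝ} (ha : 0 ≤ a) (hb : 0 ≤ b) (v w : Rd d) :
    (a + b) • ((a + b)⁻¹ • (a • v + b • w)) = a • v + b • w := by
  rcases (add_nonneg ha hb).eq_or_lt with h | h
  · have h1 : a = 0 := by linarith
    have h2 : b = 0 := by linarith
    simp [h1, h2]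
  · rw [smul_smul, mul_inv_cancel₀ h.ne', one_smul]

/-- Convexity of `(ρ, m) ↦ ‖m‖² / ρ`. -/
lemma norm_sq_inv_smul_mul_le {a b : ℝ} (ha : 0 ≤ a) (hb : 0 ≤ b) (v w : Rd d) :
    ‖(a + b)⁻¹ • (a • v + b • w)‖ ^ 2 * (a + b) ≤ a * ‖v‖ ^ 2 + b * ‖w‖ ^ 2 := by
  rcases (add_nonneg ha hb).eq_or_lt with h | h
  · rw [← h, mul_zero]
    positivity
  · rw [norm_smul, mul_pow, norm_inv, Real.norm_of_nonneg h.le]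
    have h1 : (a + b)⁻¹ ^ 2 * ‖a • v + b • w‖ ^ 2 * (a + b) = ‖a • v + b • w‖ ^ 2 / (a + b) := by
      field_simp
    rw [h1, div_le_iff₀ h, norm_add_sq_real, norm_smul, norm_smul, real_inner_smul_left,
      real_inner_smul_right, Real.norm_of_nonneg ha, Real.norm_of_nonneg hb]
    have h2 := norm_sub_sq_real v w
    have h3 := mul_nonneg (mul_nonneg ha hb) (sq_nonneg ‖v - w‖)
    rw [h2] at h3
    linarith

lemma testOp_mul_smul {φ : ℝ → Rd d → ℝ} {p : ℝ × Rd d} {a b c : ℝ} {u : ℝ → Rd d → Rd d}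
    (h : c = a + b) (h' : c • u p.1 p.2 = a • v p.1 p.2 + b • v' p.1 p.2) :
    testOp β u φ p * c = testOp β v φ p * a + testOp β v' φ p * b := by
  have h1 : c * inner ℝ (u p.1 p.2) (gradient (φ p.1) p.2)
      = a * inner ℝ (v p.1 p.2) (gradient (φ p.1) p.2)
        + b * inner ℝ (v' p.1 p.2) (gradient (φ p.1) p.2) := by
    rw [← real_inner_smul_left, h', inner_add_left, real_inner_smul_left, real_inner_smul_left]
  unfold testOp
  rw [h] at h1 ⊢
  linear_combination h1

lemma IsAdmissible.integrable_testOp_mul (h : IsAdmissible T β ρ₀ q₀ ρ v) (hβ : 0 < β)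
    {φ : ℝ → Rd d → ℝ} (hφ : ContDiff ℝ ∞ (Function.uncurry φ))
    (hφc : HasCompactSupport (Function.uncurry φ)) :
    Integrable (fun p : ℝ × Rd d => testOp β v φ p * ρ p.1 p.2) (slab d T) := by
  obtain ⟨M, hM⟩ := exists_bound_of_hasCompactSupport hφ hφc
  refine ((h.integrable_density.norm.const_mul (M * (1 + β))).add
      (h.integrable_norm_field.norm.const_mul M)).mono'
      ((measurable_testOp h.measurable_field hφ).mul h.measurable_density).aestronglyMeasurable
      (Eventually.of_forall fun p => ?_)
  have := abs_testOp_le hβ v (p := p) (hM p.1 p.2).2.1 (hM p.1 p.2).2.2.1 (hM p.1 p.2).2.2.2.1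
  simp only [Pi.add_apply]
  rw [norm_mul, norm_mul, norm_norm]
  calc _ ≤ (M * (1 + β) + M * ‖v p.1 p.2‖) * ‖ρ p.1 p.2‖ :=
        mul_le_mul_of_nonneg_right this (norm_nonneg _)
    _ = _ := by ring

lemma IsAdmissible.kineticEnergy_eq :
    kineticEnergy T ρ v
      = 1 / 2 * ∫ p : ℝ × Rd d, ‖v p.1 p.2‖ ^ 2 * ρ p.1 p.2 ∂(slab d T) := by
  rw [kineticEnergy, ← integral_const_mul]
  simp only [mul_assoc]

/-- Admissible triples with the same initial density can be mixed: densities and momenta are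
averaged, and the kinetic energy is convex in them. -/
lemma IsAdmissible.exists_mix (h : IsAdmissible T β ρ₀ q₀ ρ v) (h' : IsAdmissible T β ρ₀ q₁ ρ' v')
    (hβ : 0 < β) (hq₀ : Integrable q₀) (hq₁ : Integrable q₁) {ε : ℝ} (h0 : 0 ≤ ε) (h1 : ε ≤ 1) :
    ∃ (ρ'' : ℝ → Rd d → ℝ) (v'' : ℝ → Rd d → Rd d),
      IsAdmissible T β ρ₀ (fun x => (1 - ε) * q₀ x + ε * q₁ x) ρ'' v'' ∧
      kineticEnergy T ρ'' v'' ≤ (1 - ε) * kineticEnergy T ρ v + ε * kineticEnergy T ρ' v' := by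
  have h1' : 0 ≤ 1 - ε := by linarith
  set r : ℝ → Rd d → ℝ := fun t x => (1 - ε) * ρ t x + ε * ρ' t x with hr
  -- where `r` vanishes both momenta vanish, and the value `0⁻¹ = 0` is harmless
  set u : ℝ → Rd d → Rd d := fun t x => (r t x)⁻¹ •
    (((1 - ε) * ρ t x) • v t x + (ε * ρ' t x) • v' t x) with hu
  have hrm : Measurable (Function.uncurry r) :=
    (h.measurable_density.const_mul _).add (h'.measurable_density.const_mul _)
  have hum : Measurable (Function.uncurry u) :=
    hrm.inv.smul (((h.measurable_density.const_mul _).smul h.measurable_field).add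
      ((h'.measurable_density.const_mul _).smul h'.measurable_field))
  have hnn : ∀ᵐ p : ℝ × Rd d ∂(slab d T), 0 ≤ (1 - ε) * ρ p.1 p.2 ∧ 0 ≤ ε * ρ' p.1 p.2 := by
    filter_upwards [h.ae_nonneg, h'.ae_nonneg] with p hp hp'
    exact ⟨mul_nonneg h1' hp, mul_nonneg h0 hp'⟩
  have hdom : Integrable (fun p : ℝ × Rd d => (1 - ε) * (‖v p.1 p.2‖ ^ 2 * ρ p.1 p.2)
      + ε * (‖v' p.1 p.2‖ ^ 2 * ρ' p.1 p.2)) (slab d T) :=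
    (h.finite_energy.const_mul _).add (h'.finite_energy.const_mul _)
  have hle : ∀ᵐ p : ℝ × Rd d ∂(slab d T), ‖u p.1 p.2‖ ^ 2 * r p.1 p.2
      ≤ (1 - ε) * (‖v p.1 p.2‖ ^ 2 * ρ p.1 p.2) + ε * (‖v' p.1 p.2‖ ^ 2 * ρ' p.1 p.2) := by
    filter_upwards [hnn] with p hp
    refine (norm_sq_inv_smul_mul_le hp.1 hp.2 (v p.1 p.2) (v' p.1 p.2)).trans_eq ?_
    ring
  have hfe : Integrable (fun p : ℝ × Rd d => ‖u p.1 p.2‖ ^ 2 * r p.1 p.2) (slab d T) := by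
    refine hdom.mono' ((hum.norm.pow_const 2).mul hrm).aestronglyMeasurable ?_
    filter_upwards [hnn, hle] with p hp hpl
    rwa [Real.norm_of_nonneg (mul_nonneg (by positivity) (add_nonneg hp.1 hp.2))]
  refine ⟨r, u, ⟨hrm, hum, fun t ht => ?_, hfe, ?_⟩, ?_⟩
  · have d0 := h.isDensity t ht
    have d1 := h'.isDensity t ht
    refine ⟨fun x => add_nonneg (mul_nonneg h1' (d0.nonneg x)) (mul_nonneg h0 (d1.nonneg x)),
      (d0.integrable.const_mul _).add (d1.integrable.const_mul _), ?_⟩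
    rw [hr, integral_add (d0.integrable.const_mul _) (d1.integrable.const_mul _),
      integral_const_mul, integral_const_mul, d0.integral_eq_one, d1.integral_eq_one]
    ring
  · intro φ hφ hφc
    obtain ⟨M, hM⟩ := exists_bound_of_hasCompactSupport hφ hφc
    have hb : ∀ g : Rd d → ℝ, Integrable g → Integrable fun x => φ T x * g x := fun g hg =>
      hg.bdd_mul (c := M) (contDiff_slice_space hφ T).continuous.aestronglyMeasurable
        (Eventually.of_forall fun x => (hM T x).1)
    have e0 : (∫ x, φ T x * q₀ x) - ∫ x, φ 0 x * ρ₀ x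
        = ∫ p, testOp β v φ p * ρ p.1 p.2 ∂(slab d T) := h.equation φ hφ hφc
    have e1 : (∫ x, φ T x * q₁ x) - ∫ x, φ 0 x * ρ₀ x
        = ∫ p, testOp β v' φ p * ρ' p.1 p.2 ∂(slab d T) := h'.equation φ hφ hφc
    change _ = ∫ p, testOp β u φ p * r p.1 p.2 ∂(slab d T)
    have e2 : ∫ p, testOp β u φ p * r p.1 p.2 ∂(slab d T)
        = ∫ p, (1 - ε) * (testOp β v φ p * ρ p.1 p.2) + ε * (testOp β v' φ p * ρ' p.1 p.2)
          ∂(slab d T) := by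
      refine integral_congr_ae ?_
      filter_upwards [hnn] with p hp
      rw [testOp_mul_smul (u := u) (a := (1 - ε) * ρ p.1 p.2) (b := ε * ρ' p.1 p.2) rfl
        (add_smul_inv_smul hp.1 hp.2 (v p.1 p.2) (v' p.1 p.2))]
      ring
    have e3 : ∫ x, φ T x * ((1 - ε) * q₀ x + ε * q₁ x)
        = (1 - ε) * (∫ x, φ T x * q₀ x) + ε * ∫ x, φ T x * q₁ x := by
      rw [← integral_const_mul, ← integral_const_mul, ← integral_add ((hb _ hq₀).const_mul _)
        ((hb _ hq₁).const_mul _)]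
      congr 1 with x
      ring
    rw [e2, e3, integral_add ((h.integrable_testOp_mul hβ hφ hφc).const_mul _)
      ((h'.integrable_testOp_mul hβ hφ hφc).const_mul _), integral_const_mul, integral_const_mul,
      ← e0, ← e1]
    ring
  · rw [IsAdmissible.kineticEnergy_eq, IsAdmissible.kineticEnergy_eq,
      IsAdmissible.kineticEnergy_eq]
    have := integral_mono_ae hfe hdom hle
    rw [integral_add (h.finite_energy.const_mul _) (h'.finite_energy.const_mul _),
      integral_const_mul, integral_const_mul] at this
    linarith

/-- First-order condition: a minimizer of the control problem also minimizes the problem in which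
the energy is replaced by its linearization `q ↦ ∫ f q`, against bounded terminal densities. -/
lemma first_order_condition {D : Set (Rd d → ℝ)} {𝓕 : (Rd d → ℝ) → ℝ} {ρT f : Rd d → ℝ}
    (hβ : 0 < β) (hρT : Integrable ρT) (hf : IsFirstVariation D 𝓕 ρT f)
    (h : IsAdmissible T β ρ₀ ρT ρ v)
    (hmin : ∀ (q : Rd d → ℝ) (ρ' : ℝ → Rd d → ℝ) (v' : ℝ → Rd d → Rd d),
      q ∈ D → IsAdmissible T β ρ₀ q ρ' v' →
      kineticEnergy T ρ v + 𝓕 ρT ≤ kineticEnergy T ρ' v' + 𝓕 q)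
    {q : Rd d → ℝ} (hq : q ∈ P2 d) (hqb : ∃ M, ∀ x, q x ≤ M)
    (h' : IsAdmissible T β ρ₀ q ρ' v') :
    kineticEnergy T ρ v + ∫ x, f x * ρT x ≤ kineticEnergy T ρ' v' + ∫ x, f x * q x := by
  have hder := hf.hasDeriv q hq hqb
  have hder' := hder.mono (s := Ioi (0 : ℝ)) Ioi_subset_Ici_self
  rw [hasDerivWithinAt_iff_tendsto_slope' (by simp)] at hder'
  have hlim : kineticEnergy T ρ v - kineticEnergy T ρ' v' ≤ ∫ x, f x * (q x - ρT x) := by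
    refine ge_of_tendsto hder' ?_
    have hε1 : ∀ᶠ ε in 𝓝[>] (0 : ℝ), ε < 1 :=
      eventually_nhdsWithin_of_eventually_nhds (eventually_lt_nhds one_pos)
    filter_upwards [hf.segment_mem q hq hqb, hε1, self_mem_nhdsWithin] with ε hε h1 hpos
    have hpos' : 0 < ε := hpos
    obtain ⟨ρ'', v'', hadm, hK⟩ := h.exists_mix h' hβ hρT hq.2.1.integrable hpos'.le h1.le
    have := hmin _ ρ'' v'' hε hadm
    rw [slope_def_field]
    simp only [sub_zero, one_mul, zero_mul, add_zero]
    rw [le_div_iff₀ hpos']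
    change _ ≤ _ - 𝓕 ρT
    linarith
  have e : ∫ x, f x * (q x - ρT x) = (∫ x, f x * q x) - ∫ x, f x * ρT x := by
    rw [← integral_sub (hf.integrable q hq hqb) hf.integrable_self]
    simp only [mul_sub]
  linarith

end Mixing

/-! ### Approximation by trigonometric polynomials -/

section Trig

variable {d : ℕ}

lemma cos_mem_trigPoly (k : Rd d) (a : ℝ) :
    (fun x => Real.cos (inner ℝ k x + a)) ∈ trigPoly d :=
  Submodule.subset_span ⟨(k, a), rfl⟩

lemma one_mem_trigPoly : (1 : Rd d → ℝ) ∈ trigPoly d := by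
  convert cos_mem_trigPoly (0 : Rd d) 0 using 1
  ext; simp

lemma mul_mem_trigPoly {u v : Rd d → ℝ} (hu : u ∈ trigPoly d) (hv : v ∈ trigPoly d) :
    u * v ∈ trigPoly d := by
  unfold trigPoly at hu hv
  induction hu, hv using Submodule.span_induction₂ with
  | mem_mem u v hu hv =>
    obtain ⟨⟨k, a⟩, rfl⟩ := hu
    obtain ⟨⟨l, b⟩, rfl⟩ := hv
    have h : ((fun x => Real.cos (inner ℝ k x + a)) * fun x => Real.cos (inner ℝ l x + b))
        = (1 / 2 : ℝ) • (fun x => Real.cos (inner ℝ (k + l) x + (a + b)))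
          + (1 / 2 : ℝ) • (fun x : Rd d => Real.cos (inner ℝ (k - l) x + (a - b))) := by
      ext x
      simp only [Pi.mul_apply, Pi.add_apply, Pi.smul_apply, smul_eq_mul, inner_add_left,
        inner_sub_left]
      rw [show inner ℝ k x + inner ℝ l x + (a + b) = (inner ℝ k x + a) + (inner ℝ l x + b) by ring,
        show inner ℝ k x - inner ℝ l x + (a - b) = (inner ℝ k x + a) - (inner ℝ l x + b) by ring,
        Real.cos_add (inner ℝ k x + a), Real.cos_sub (inner ℝ k x + a)]
      ring
    simp only
    rw [h]
    exact add_mem (Submodule.smul_mem _ _ (cos_mem_trigPoly _ _))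
      (Submodule.smul_mem _ _ (cos_mem_trigPoly _ _))
  | zero_left v hv => simp
  | zero_right u hu => simp
  | add_left u v w _ _ _ h1 h2 => rw [add_mul]; exact add_mem h1 h2
  | add_right u v w _ _ _ h1 h2 => rw [mul_add]; exact add_mem h1 h2
  | smul_left c u v _ _ h => rw [smul_mul_assoc]; exact Submodule.smul_mem _ _ h
  | smul_right c u v _ _ h => rw [mul_smul_comm]; exact Submodule.smul_mem _ _ h

lemma continuous_of_mem_trigPoly {u : Rd d → ℝ} (hu : u ∈ trigPoly d) : Continuous u := by
  unfold trigPoly at hu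
  induction hu using Submodule.span_induction with
  | mem u hu =>
    obtain ⟨⟨k, a⟩, rfl⟩ := hu
    fun_prop
  | zero => exact continuous_const
  | add u v _ _ hu hv => exact hu.add hv
  | smul c u _ hu => exact hu.const_smul c

lemma bounded_of_mem_trigPoly {u : Rd d → ℝ} (hu : u ∈ trigPoly d) : ∃ B, ∀ x, |u x| ≤ B := by
  unfold trigPoly at hu
  induction hu using Submodule.span_induction with
  | mem u hu =>
    obtain ⟨⟨k, a⟩, rfl⟩ := hu
    exact ⟨1, fun x => Real.abs_cos_le_one _⟩
  | zero => exact ⟨0, fun x => by simp⟩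
  | add u v _ _ hu hv =>
    obtain ⟨A, hA⟩ := hu
    obtain ⟨B, hB⟩ := hv
    exact ⟨A + B, fun x => (abs_add_le _ _).trans (add_le_add (hA x) (hB x))⟩
  | smul c u _ hu =>
    obtain ⟨A, hA⟩ := hu
    exact ⟨|c| * A, fun x => by
      simp only [Pi.smul_apply, smul_eq_mul, abs_mul]
      exact mul_le_mul_of_nonneg_left (hA x) (abs_nonneg c)⟩

/-- The algebra of trigonometric polynomials. -/
def trigAlgebra (d : ℕ) : Subalgebra ℝ (Rd d → ℝ) :=
  (trigPoly d).toSubalgebra one_mem_trigPoly fun _ _ => mul_mem_trigPoly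

lemma aeval_mem_trigPoly (p : Polynomial ℝ) {u : Rd d → ℝ} (hu : u ∈ trigPoly d) :
    (fun x => p.eval (u x)) ∈ trigPoly d := by
  have h : Polynomial.aeval u p ∈ trigAlgebra d :=
    Algebra.adjoin_le (singleton_subset_iff.2 (show u ∈ trigAlgebra d from hu))
      (Polynomial.aeval_mem_adjoin_singleton ℝ u)
  have e : (fun x => p.eval (u x)) = Polynomial.aeval u p := by
    ext x
    rw [Polynomial.aeval_fn_apply]
    simp
  rw [e]
  exact h

/-- Restrictions of trigonometric polynomials to a set, as an algebra of continuous functions. -/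
def trigRestrict (K : Set (Rd d)) : Subalgebra ℝ C(K, ℝ) where
  carrier := {g | ∃ u ∈ trigPoly d, ∀ x : K, g x = u x}
  mul_mem' := by
    rintro f g ⟨u, hu, hfu⟩ ⟨v, hv, hgv⟩
    exact ⟨u * v, mul_mem_trigPoly hu hv, fun x => by simp [hfu, hgv]⟩
  add_mem' := by
    rintro f g ⟨u, hu, hfu⟩ ⟨v, hv, hgv⟩
    exact ⟨u + v, add_mem hu hv, fun x => by simp [hfu, hgv]⟩
  algebraMap_mem' c := ⟨c • 1, Submodule.smul_mem _ _ one_mem_trigPoly, fun x => by simp⟩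

lemma trigRestrict_separatesPoints (K : Set (Rd d)) : (trigRestrict K).SeparatesPoints := by
  intro x y hxy
  have hne : (y : Rd d) - x ≠ 0 := sub_ne_zero.2 fun h => hxy (Subtype.ext h.symm)
  have hn : ‖(y : Rd d) - x‖ ^ 2 ≠ 0 := by positivity
  -- this plane wave equals `1` at `x` and `-1` at `y`
  set k : Rd d := (Real.pi / ‖(y : Rd d) - x‖ ^ 2) • ((y : Rd d) - x) with hk
  set u : Rd d → ℝ := fun z => Real.cos (inner ℝ k z + -inner ℝ k (x : Rd d)) with hu
  have huc : Continuous u := continuous_of_mem_trigPoly (cos_mem_trigPoly _ _)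
  refine ⟨_, ⟨⟨fun z : K => u z, huc.comp continuous_subtype_val⟩,
    ⟨u, cos_mem_trigPoly _ _, fun z => rfl⟩, rfl⟩, ?_⟩
  have h1 : u x = 1 := by simp [hu]
  have h2 : u y = -1 := by
    have : inner ℝ k (y : Rd d) + -inner ℝ k (x : Rd d) = Real.pi := by
      rw [← sub_eq_add_neg, ← inner_sub_right, hk, real_inner_smul_left, real_inner_self_eq_norm_sq]
      field_simp
    simp only [hu]
    rw [this, Real.cos_pi]
  simp only [ContinuousMap.coe_mk, h1, h2]
  norm_num

/-- A continuous function with values in `[c, C]` is approximated on a ball by a trigonometric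
polynomial which almost takes values in `[c, C]` on the whole space: the Stone-Weierstrass
theorem on the ball, followed by composition with a polynomial close to the projection of the
line onto `[c, C]`. -/
lemma exists_trigPoly_near {g : Rd d → ℝ} (hg : Continuous g) {c C : ℝ} (hgc : ∀ x, c ≤ g x)
    (hgC : ∀ x, g x ≤ C) {ε : ℝ} (hε : 0 < ε) (R : ℝ) :
    ∃ w ∈ trigPoly d, (∀ x, c - ε ≤ w x) ∧ (∀ x, w x ≤ C + ε) ∧ ∀ x, ‖x‖ ≤ R →
      |w x - g x| ≤ 2 * ε := by
  set K : Set (Rd d) := Metric.closedBall 0 R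
  have : CompactSpace K := isCompact_iff_compactSpace.1 (isCompact_closedBall 0 R)
  obtain ⟨⟨G, w, hw, hGw⟩, hG⟩ :=
    ContinuousMap.exists_mem_subalgebra_near_continuous_of_separatesPoints (trigRestrict K)
      (trigRestrict_separatesPoints K) (fun x : K => g x) (hg.comp continuous_subtype_val) ε hε
  obtain ⟨B, hB⟩ := bounded_of_mem_trigPoly hw
  set κ : ℝ → ℝ := fun s => max c (min C s) with hκ
  have hκc : Continuous κ := by fun_prop
  have hcC : c ≤ C := (hgc 0).trans (hgC 0)
  have hκ1 : ∀ s, c ≤ κ s := fun s => le_max_left _ _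
  have hκ2 : ∀ s, κ s ≤ C := fun s => max_le hcC (min_le_left _ _)
  have hκg : ∀ x, κ (g x) = g x := fun x => by
    simp only [hκ]
    rw [min_eq_right (hgC x), max_eq_right (hgc x)]
  have hκl : ∀ s t, |κ s - κ t| ≤ |s - t| := fun s t =>
    (abs_max_sub_max_le_max c (min C s) c (min C t)).trans
      (max_le (by simp) ((abs_min_sub_min_le_max C s C t).trans (by simp)))
  obtain ⟨p, hp⟩ := exists_polynomial_near_of_continuousOn (-B) B κ hκc.continuousOn ε hε
  have hpw : ∀ x, |p.eval (w x) - κ (w x)| < ε := fun x => hp _ (abs_le.1 (hB x))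
  refine ⟨_, aeval_mem_trigPoly p hw, fun x => ?_, fun x => ?_, fun x hx => ?_⟩
  · linarith [(abs_lt.1 (hpw x)).1, hκ1 (w x)]
  · linarith [(abs_lt.1 (hpw x)).2, hκ2 (w x)]
  · have h1 := hG ⟨x, by simpa [K] using hx⟩
    simp only at h1
    rw [hGw, Real.norm_eq_abs] at h1
    have h2 := hκl (w x) (g x)
    rw [hκg] at h2
    have h3 := abs_sub_le (p.eval (w x)) (κ (w x)) (g x)
    linarith [hpw x]

/-- A measurable function with values in `[c, C]`, `c > 0`, is an almost everywhere limit of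
trigonometric polynomials with values in `[c / 2, 2 C]`. -/
lemma exists_seq_trigPoly_tendsto {u : Rd d → ℝ} (hu : Measurable u) {c C : ℝ} (hc : 0 < c)
    (huc : ∀ x, c ≤ u x) (huC : ∀ x, u x ≤ C) :
    ∃ w : ℕ → Rd d → ℝ, (∀ n, w n ∈ trigPoly d) ∧ (∀ n x, c / 2 ≤ w n x) ∧
      (∀ n x, w n x ≤ 2 * C) ∧ ∀ᵐ x, Tendsto (fun n => w n x) atTop (𝓝 (u x)) := by
  have hcC : c ≤ C := (huc 0).trans (huC 0)
  set φ : ℕ → ContDiffBump (0 : Rd d) := fun n =>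
    ⟨((n : ℝ) + 1)⁻¹, 2 * ((n : ℝ) + 1)⁻¹, by positivity, by
      have : (0 : ℝ) < ((n : ℝ) + 1)⁻¹ := by positivity
      linarith⟩ with hφ
  have hinv : Tendsto (fun n : ℕ => ((n : ℝ) + 1)⁻¹) atTop (𝓝 0) := by
    simpa [one_div] using tendsto_one_div_add_atTop_nhds_zero_nat (𝕜 := ℝ)
  have hul : LocallyIntegrable u volume := by
    refine (locallyIntegrable_const C).mono hu.aestronglyMeasurable (Eventually.of_forall fun x => ?_)
    rw [Real.norm_of_nonneg (hc.le.trans (huc x)), Real.norm_of_nonneg (hc.le.trans hcC)]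
    exact huC x
  have hconv := ContDiffBump.ae_convolution_tendsto_right_of_locallyIntegrable
    (μ := (volume : Measure (Rd d))) (φ := φ) (l := atTop) (K := 2)
    (by simpa [hφ] using hinv.const_mul 2) (Eventually.of_forall fun n => le_rfl) hul
  set G : ℕ → Rd d → ℝ := fun n =>
    convolution ((φ n).normed volume) u (ContinuousLinearMap.lsmul ℝ ℝ) volume with hG
  have hGc : ∀ n, Continuous (G n) := fun n =>
    (φ n).hasCompactSupport_normed.continuous_convolution_left _ (φ n).continuous_normed hul
  set κ : ℝ → ℝ := fun s => max c (min C s) with hκ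
  have hκc : Continuous κ := by fun_prop
  have hε : ∀ n : ℕ, 0 < c / 2 * ((n : ℝ) + 1)⁻¹ := fun n => by positivity
  have hε' : ∀ n : ℕ, c / 2 * ((n : ℝ) + 1)⁻¹ ≤ c / 2 := fun n =>
    mul_le_of_le_one_right (by linarith) (inv_le_one_of_one_le₀ (by
      have : (0 : ℝ) ≤ n := n.cast_nonneg
      linarith))
  choose w hw hwc hwC hwG using fun n : ℕ => exists_trigPoly_near (hκc.comp (hGc n))
    (fun x => le_max_left c (min C (G n x))) (fun x => max_le hcC (min_le_left C (G n x)))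
    (hε n) (n : ℝ)
  refine ⟨w, hw, fun n x => ?_, fun n x => ?_, ?_⟩
  · linarith [hwc n x, hε' n]
  · linarith [hwC n x, hε' n]
  · filter_upwards [hconv] with x hx
    have h1 : Tendsto (fun n => κ (G n x)) atTop (𝓝 (κ (u x))) :=
      (hκc.tendsto _).comp hx
    have h2 : κ (u x) = u x := by
      simp only [hκ]
      rw [min_eq_right (huC x), max_eq_right (huc x)]
    rw [h2] at h1
    have h3 : Tendsto (fun n => w n x - κ (G n x)) atTop (𝓝 0) := by
      refine squeeze_zero_norm' (a := fun n : ℕ => 2 * (c / 2 * ((n : ℝ) + 1)⁻¹)) ?_ ?_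
      · obtain ⟨N, hN⟩ := exists_nat_ge ‖x‖
        filter_upwards [eventually_ge_atTop N] with n hn
        exact hwG n x (hN.trans (by exact_mod_cast hn))
      · simpa using (hinv.const_mul (c / 2)).const_mul 2
    simpa using h3.add h1

end Trig

/-! ### Passing to measurable weights -/

section Limits

variable {d : ℕ} {β T : ℝ} {ρ₀ u : Rd d → ℝ} {c C : ℝ}

lemma measurable_heatAvg (hu : Measurable u) : Measurable (heatAvg β T u) := by
  have h : Measurable fun z : Rd d × Rd d => u z.2 * heatKernel β T (z.2 - z.1) :=
    (hu.comp measurable_snd).mul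
      ((continuous_heatKernel T).measurable.comp (measurable_snd.sub measurable_fst))
  exact (h.stronglyMeasurable.integral_prod_right').measurable

lemma integrable_bdd_mul_heatKernel (hβ : 0 < β) (hT : 0 < T) (hu : Measurable u)
    (huC : ∀ x, |u x| ≤ C) (y : Rd d) : Integrable fun z => u z * heatKernel β T (z - y) :=
  (integrable_heatKernel hβ hT y).bdd_mul hu.aestronglyMeasurable (Eventually.of_forall huC)

lemma le_heatAvg (hβ : 0 < β) (hT : 0 < T) (hu : Measurable u) (hc : 0 ≤ c)
    (huc : ∀ x, c ≤ u x) (huC : ∀ x, u x ≤ C) (y : Rd d) : c ≤ heatAvg β T u y := by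
  have h := integral_mono ((integrable_heatKernel hβ hT y).const_mul c)
    (integrable_bdd_mul_heatKernel hβ hT hu
      (fun x => by rw [abs_of_nonneg (hc.trans (huc x))]; exact huC x) y)
    fun z => mul_le_mul_of_nonneg_right (huc z) (heatKernel_nonneg hβ T _)
  rwa [integral_const_mul, integral_heatKernel hβ hT, mul_one] at h

lemma heatAvg_le (hβ : 0 < β) (hT : 0 < T) (hu : Measurable u) (hc : 0 ≤ c)
    (huc : ∀ x, c ≤ u x) (huC : ∀ x, u x ≤ C) (y : Rd d) : heatAvg β T u y ≤ C := by
  have h := integral_mono (integrable_bdd_mul_heatKernel hβ hT hu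
      (fun x => by rw [abs_of_nonneg (hc.trans (huc x))]; exact huC x) y)
    ((integrable_heatKernel hβ hT y).const_mul C)
    fun z => mul_le_mul_of_nonneg_right (huC z) (heatKernel_nonneg hβ T _)
  rwa [integral_const_mul, integral_heatKernel hβ hT, mul_one] at h

lemma abs_log_le (hc : 0 < c) {s : ℝ} (h1 : c ≤ s) (h2 : s ≤ C) :
    |Real.log s| ≤ max |Real.log c| |Real.log C| :=
  abs_le_max_abs_abs (Real.log_le_log hc h1) (Real.log_le_log (hc.trans_le h1) h2)

lemma measurable_gibbsDensity (hm : Measurable ρ₀) (hu : Measurable u) :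
    Measurable (gibbsDensity β T ρ₀ u) :=
  hu.mul (measurable_heatFlow_apply (hm.div (measurable_heatAvg hu)))

lemma gibbsDensity_nonneg (hβ : 0 < β) (hpos : ∀ y, 0 ≤ ρ₀ y) (hu : ∀ x, 0 ≤ u x) (x : Rd d) :
    0 ≤ gibbsDensity β T ρ₀ u x :=
  mul_nonneg (hu x) (heatFlow_nonneg hβ (fun y => div_nonneg (hpos y)
    (integral_nonneg fun z => mul_nonneg (hu z) (heatKernel_nonneg hβ _ _))) x)

/-- Where `u` equals its lower bound, the Gibbs density is at most the heat flow; in general it is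
at most `u x / c` times the heat flow. -/
lemma gibbsDensity_le (hβ : 0 < β) (hT : 0 < T) (hi : Integrable ρ₀) (hm : Measurable ρ₀)
    (hpos : ∀ y, 0 ≤ ρ₀ y) (hu : Measurable u) (hc : 0 < c) (huc : ∀ x, c ≤ u x)
    (huC : ∀ x, u x ≤ C) (x : Rd d) :
    gibbsDensity β T ρ₀ u x ≤ u x / c * heatFlow β T ρ₀ x := by
  have h1 : ∀ y, ρ₀ y / heatAvg β T u y ≤ c⁻¹ * ρ₀ y := fun y => by
    rw [div_eq_inv_mul]
    exact mul_le_mul_of_nonneg_right (inv_anti₀ hc (le_heatAvg hβ hT hu hc.le huc huC y)) (hpos y)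
  have h2 : ∀ y, 0 ≤ ρ₀ y / heatAvg β T u y := fun y =>
    div_nonneg (hpos y) (hc.le.trans (le_heatAvg hβ hT hu hc.le huc huC y))
  have hri : Integrable fun y => ρ₀ y / heatAvg β T u y :=
    (hi.const_mul c⁻¹).mono' (hm.div (measurable_heatAvg hu)).aestronglyMeasurable
      (Eventually.of_forall fun y => by rw [Real.norm_of_nonneg (h2 y)]; exact h1 y)
  have h3 : heatFlow β T (fun y => ρ₀ y / heatAvg β T u y) x ≤ c⁻¹ * heatFlow β T ρ₀ x := by
    rw [heatFlow, heatFlow, ← integral_const_mul]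
    refine integral_mono (integrable_heatKernel_mul hβ hri x)
      ((integrable_heatKernel_mul hβ hi x).const_mul _) fun y => ?_
    simp only
    rw [mul_left_comm]
    exact mul_le_mul_of_nonneg_left (h1 y) (heatKernel_nonneg hβ _ _)
  have := mul_le_mul_of_nonneg_left h3 (hc.le.trans (huc x))
  rw [gibbsDensity]
  refine this.trans_eq ?_
  ring

variable {w : ℕ → Rd d → ℝ}

lemma tendsto_heatAvg (hβ : 0 < β) (hT : 0 < T) (hw : ∀ n, Measurable (w n))
    (hwC : ∀ n x, |w n x| ≤ C)
    (hlim : ∀ᵐ x, Tendsto (fun n => w n x) atTop (𝓝 (u x))) (y : Rd d) :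
    Tendsto (fun n => heatAvg β T (w n) y) atTop (𝓝 (heatAvg β T u y)) := by
  refine tendsto_integral_of_dominated_convergence (fun z => C * heatKernel β T (z - y)) ?_
    ((integrable_heatKernel hβ hT y).const_mul C) ?_ ?_
  · exact fun n => (integrable_bdd_mul_heatKernel hβ hT (hw n) (hwC n) y).aestronglyMeasurable
  · refine fun n => Eventually.of_forall fun z => ?_
    rw [norm_mul, Real.norm_of_nonneg (heatKernel_nonneg hβ T _)]
    exact mul_le_mul_of_nonneg_right (hwC n z) (heatKernel_nonneg hβ T _)
  · filter_upwards [hlim] with z hz using hz.mul_const _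

lemma tendsto_integral_log_mul (hc : 0 < c) (hw : ∀ n, Measurable (w n))
    (hwc : ∀ n x, c ≤ w n x) (hwC : ∀ n x, w n x ≤ C)
    (hlim : ∀ᵐ x, Tendsto (fun n => w n x) atTop (𝓝 (u x))) (huc : ∀ x, c ≤ u x)
    {q : Rd d → ℝ} (hq : Integrable q) :
    Tendsto (fun n => ∫ x, Real.log (w n x) * q x) atTop (𝓝 (∫ x, Real.log (u x) * q x)) := by
  refine tendsto_integral_of_dominated_convergence
    (fun x => max |Real.log c| |Real.log C| * ‖q x‖) ?_ (hq.norm.const_mul _) ?_ ?_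
  · exact fun n => (hw n).log.aestronglyMeasurable.mul hq.aestronglyMeasurable
  · refine fun n => Eventually.of_forall fun x => ?_
    rw [norm_mul]
    exact mul_le_mul_of_nonneg_right (abs_log_le hc (hwc n x) (hwC n x)) (norm_nonneg _)
  · filter_upwards [hlim] with x hx
    exact (((Real.continuousAt_log (hc.trans_le (huc x)).ne').tendsto.comp hx)).mul_const _

lemma tendsto_integral_mul_gibbsDensity (hβ : 0 < β) (hT : 0 < T) (hi : Integrable ρ₀)
    (hm : Measurable ρ₀) (hpos : ∀ y, 0 ≤ ρ₀ y) (hc : 0 < c) (hw : ∀ n, Measurable (w n))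
    (hwc : ∀ n x, c ≤ w n x) (hwC : ∀ n x, w n x ≤ C)
    (hlim : ∀ᵐ x, Tendsto (fun n => w n x) atTop (𝓝 (u x))) (hu : Measurable u)
    (huc : ∀ x, c ≤ u x) (huC : ∀ x, u x ≤ C) {a : ℕ → Rd d → ℝ} {b A : Rd d → ℝ}
    (ha : ∀ n, Measurable (a n)) (haA : ∀ n x, |a n x| ≤ A x)
    (hA : Integrable fun x => A x * heatFlow β T ρ₀ x)
    (hab : ∀ᵐ x, Tendsto (fun n => a n x) atTop (𝓝 (b x))) :
    Tendsto (fun n => ∫ x, a n x * gibbsDensity β T ρ₀ (w n) x) atTop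
      (𝓝 (∫ x, b x * gibbsDensity β T ρ₀ u x)) := by
  have hA0 : ∀ x, 0 ≤ A x := fun x => (abs_nonneg _).trans (haA 0 x)
  have hwabs : ∀ n x, |w n x| ≤ C := fun n x => by
    rw [abs_of_nonneg (hc.le.trans (hwc n x))]; exact hwC n x
  refine tendsto_integral_of_dominated_convergence
    (fun x => C / c * (A x * heatFlow β T ρ₀ x)) ?_ (hA.const_mul _) ?_ ?_
  · exact fun n => ((ha n).mul (measurable_gibbsDensity hm (hw n))).aestronglyMeasurable
  · refine fun n => Eventually.of_forall fun x => ?_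
    have h1 := gibbsDensity_nonneg (T := T) hβ hpos (fun x => hc.le.trans (hwc n x)) x
    have hF := heatFlow_nonneg (t := T) hβ hpos x
    rw [norm_mul, Real.norm_of_nonneg h1]
    calc |a n x| * gibbsDensity β T ρ₀ (w n) x
        ≤ A x * (C / c * heatFlow β T ρ₀ x) := by
          refine mul_le_mul (haA n x) ?_ h1 (hA0 x)
          refine (gibbsDensity_le hβ hT hi hm hpos (hw n) hc (hwc n) (hwC n) x).trans ?_
          exact mul_le_mul_of_nonneg_right (div_le_div_of_nonneg_right (hwC n x) hc.le) hF
      _ = _ := by ring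
  · filter_upwards [hlim, hab] with x hx hax
    refine hax.mul (hx.mul ?_)
    refine tendsto_integral_of_dominated_convergence
      (fun y => c⁻¹ * (heatKernel β T (x - y) * ρ₀ y)) ?_
      ((integrable_heatKernel_mul hβ hi x).const_mul _) ?_ ?_
    · refine fun n => Measurable.aestronglyMeasurable ?_
      exact ((continuous_heatKernel T).comp (continuous_const.sub continuous_id)).measurable.mul
        (hm.div (measurable_heatAvg (hw n)))
    · refine fun n => Eventually.of_forall fun y => ?_
      have h2 := le_heatAvg hβ hT (hw n) hc.le (hwc n) (hwC n) y
      rw [Real.norm_of_nonneg (mul_nonneg (heatKernel_nonneg hβ _ _)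
        (div_nonneg (hpos y) (hc.le.trans h2))), mul_left_comm]
      refine mul_le_mul_of_nonneg_left ?_ (heatKernel_nonneg hβ _ _)
      rw [div_eq_inv_mul]
      exact mul_le_mul_of_nonneg_right (inv_anti₀ hc h2) (hpos y)
    · refine Eventually.of_forall fun y => ?_
      exact (tendsto_const_nhds.div (tendsto_heatAvg hβ hT hw hwabs hlim y)
        (hc.trans_le (le_heatAvg hβ hT hu hc.le huc huC y)).ne').const_mul _

/-- The duality bound together with the first-order condition: the weight `u` produces a
competitor, the weight `u'` a lower bound. -/
def TwoWeightBound {d : ℕ} (β T : ℝ) (ρ₀ ρT f u u' : Rd d → ℝ) : Prop :=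
  2 * β * (∫ x, Real.log (u' x) * ρT x) - 2 * β * (∫ y, Real.log (heatAvg β T u' y) * ρ₀ y)
    + ∫ x, f x * ρT x ≤
  2 * β * (∫ x, Real.log (u x) * gibbsDensity β T ρ₀ u x)
    - 2 * β * (∫ y, Real.log (heatAvg β T u y) * ρ₀ y) + ∫ x, f x * gibbsDensity β T ρ₀ u x

/-- By approximation, `TwoWeightBound` passes from trigonometric polynomials to measurable weights
which are bounded and bounded away from zero. -/
lemma TwoWeightBound.of_trigPoly (hβ : 0 < β) (hT : 0 < T) (hi : Integrable ρ₀)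
    (hm : Measurable ρ₀) (hpos : ∀ y, 0 ≤ ρ₀ y) {ρT f : Rd d → ℝ} (hρT : Integrable ρT)
    (hf : Measurable f) (hfF : Integrable fun x => f x * heatFlow β T ρ₀ x)
    (h : ∀ w ∈ trigPoly d, ∀ w' ∈ trigPoly d, ∀ c > 0, (∀ x, c ≤ w x) → (∀ x, c ≤ w' x) →
      TwoWeightBound β T ρ₀ ρT f w w')
    {u u' : Rd d → ℝ} (hu : Measurable u) (hu' : Measurable u') (hc : 0 < c)
    (huc : ∀ x, c ≤ u x) (huC : ∀ x, u x ≤ C) (huc' : ∀ x, c ≤ u' x) (huC' : ∀ x, u' x ≤ C) :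
    TwoWeightBound β T ρ₀ ρT f u u' := by
  obtain ⟨w, hw, hwc, hwC, hlim⟩ := exists_seq_trigPoly_tendsto hu hc huc huC
  obtain ⟨w', hw', hwc', hwC', hlim'⟩ := exists_seq_trigPoly_tendsto hu' hc huc' huC'
  have hc2 : 0 < c / 2 := by linarith
  have hC : 0 < C := hc.trans_le ((huc 0).trans (huC 0))
  have hwm : ∀ n, Measurable (w n) := fun n => (continuous_of_mem_trigPoly (hw n)).measurable
  have hwm' : ∀ n, Measurable (w' n) := fun n => (continuous_of_mem_trigPoly (hw' n)).measurable
  have hu1 : ∀ x, c / 2 ≤ u x := fun x => by linarith [huc x]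
  have hu2 : ∀ x, u x ≤ 2 * C := fun x => by linarith [huC x]
  have hu1' : ∀ x, c / 2 ≤ u' x := fun x => by linarith [huc' x]
  have hu2' : ∀ x, u' x ≤ 2 * C := fun x => by linarith [huC' x]
  have habs : ∀ n x, |w n x| ≤ 2 * C := fun n x => by
    rw [abs_of_nonneg (hc2.le.trans (hwc n x))]; exact hwC n x
  have habs' : ∀ n x, |w' n x| ≤ 2 * C := fun n x => by
    rw [abs_of_nonneg (hc2.le.trans (hwc' n x))]; exact hwC' n x
  have hF : Integrable fun x => heatFlow β T ρ₀ x := by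
    simpa using integrable_mul_heatFlow hβ hT hm hi (measurable_const (a := (1 : ℝ))) (M := 1)
      (by simp)
  have t1 := tendsto_integral_log_mul hc2 hwm' hwc' hwC' hlim' hu1' hρT
  have t2 := tendsto_integral_log_mul hc2 (fun n => measurable_heatAvg (β := β) (T := T) (hwm' n))
    (fun n => le_heatAvg hβ hT (hwm' n) hc2.le (hwc' n) (hwC' n))
    (fun n => heatAvg_le hβ hT (hwm' n) hc2.le (hwc' n) (hwC' n))
    (Eventually.of_forall (tendsto_heatAvg hβ hT hwm' habs' hlim'))
    (le_heatAvg hβ hT hu' hc2.le hu1' hu2') hi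
  have t3 := tendsto_integral_log_mul hc2 (fun n => measurable_heatAvg (β := β) (T := T) (hwm n))
    (fun n => le_heatAvg hβ hT (hwm n) hc2.le (hwc n) (hwC n))
    (fun n => heatAvg_le hβ hT (hwm n) hc2.le (hwc n) (hwC n))
    (Eventually.of_forall (tendsto_heatAvg hβ hT hwm habs hlim))
    (le_heatAvg hβ hT hu hc2.le hu1 hu2) hi
  have t4 := tendsto_integral_mul_gibbsDensity hβ hT hi hm hpos hc2 hwm hwc hwC hlim hu hu1 hu2
    (a := fun n x => Real.log (w n x)) (b := fun x => Real.log (u x))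
    (A := fun _ => max |Real.log (c / 2)| |Real.log (2 * C)|) (fun n => (hwm n).log)
    (fun n x => abs_log_le hc2 (hwc n x) (hwC n x)) (hF.const_mul _)
    (by filter_upwards [hlim] with x hx using
      ((Real.continuousAt_log (hc.trans_le (huc x)).ne').tendsto.comp hx))
  have t5 := tendsto_integral_mul_gibbsDensity hβ hT hi hm hpos hc2 hwm hwc hwC hlim hu hu1 hu2
    (a := fun _ => f) (b := f) (A := fun x => |f x|) (fun _ => hf) (fun _ _ => le_rfl)
    (by
      refine hfF.norm.congr (Eventually.of_forall fun x => ?_)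
      simp only
      rw [norm_mul, Real.norm_of_nonneg (heatFlow_nonneg hβ hpos x), Real.norm_eq_abs])
    (Eventually.of_forall fun x => tendsto_const_nhds)
  exact le_of_tendsto_of_tendsto'
    (((t1.const_mul (2 * β)).sub (t2.const_mul (2 * β))).add_const _)
    (((t4.const_mul (2 * β)).sub (t3.const_mul (2 * β))).add t5)
    fun n => h _ (hw n) _ (hw' n) _ hc2 (hwc n) (hwc' n)

end Limits

/-! ### Identification of the terminal density -/

section Identification

variable {d : ℕ} {β T : ℝ} {ρ₀ ρT f : Rd d → ℝ}

/-- Projection of the line onto `[-N, N]`. -/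
def clip (N : ℕ) (s : ℝ) : ℝ := max (-(N : ℝ)) (min N s)

lemma neg_le_clip (N : ℕ) (s : ℝ) : -(N : ℝ) ≤ clip N s := le_max_left _ _

lemma clip_le (N : ℕ) (s : ℝ) : clip N s ≤ N :=
  max_le (by have : (0 : ℝ) ≤ N := N.cast_nonneg
             linarith) (min_le_left _ _)

lemma clip_eq_of_lt {N : ℕ} {s : ℝ} (h : s < clip N s) : clip N s = -N := by
  unfold clip at h ⊢
  rcases lt_max_iff.1 h with h | h
  · exact max_eq_left ((min_le_right _ _).trans h.le)
  · exact absurd (min_le_right (N : ℝ) s) (not_le.2 h)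

lemma clip_eq_self {N : ℕ} {s : ℝ} (h : |s| ≤ N) : clip N s = s := by
  rw [abs_le] at h
  rw [clip, min_eq_right h.2, max_eq_right h.1]

lemma abs_clip_sub_le (N : ℕ) (s : ℝ) : |clip N s - s| ≤ |s| := by
  have hN : (0 : ℝ) ≤ N := N.cast_nonneg
  unfold clip
  rcases le_total s N with h | h
  · rw [min_eq_right h]
    rcases le_total (-(N : ℝ)) s with h' | h'
    · rw [max_eq_right h', sub_self, abs_zero]
      exact abs_nonneg s
    · rw [max_eq_left h', abs_of_nonneg (by linarith), abs_of_nonpos (by linarith)]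
      linarith
  · rw [min_eq_left h, max_eq_right (by linarith), abs_of_nonpos (by linarith),
      abs_of_nonneg (by linarith)]
    linarith

lemma abs_add_clip_le (hβ : 0 < β) (N : ℕ) (s : ℝ) :
    |s + 2 * β * clip N (-s / (2 * β))| ≤ |s| := by
  have h1 := abs_clip_sub_le N (-s / (2 * β))
  have h2 : s + 2 * β * clip N (-s / (2 * β)) = 2 * β * (clip N (-s / (2 * β)) - -s / (2 * β)) := by
    field_simp; ring
  have h3 : |s| = 2 * β * |-s / (2 * β)| := by
    rw [abs_div, abs_neg, abs_of_pos (by positivity : 0 < 2 * β)]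
    field_simp
  rw [h2, h3, abs_mul, abs_of_pos (by positivity : 0 < 2 * β)]
  exact mul_le_mul_of_nonneg_left h1 (by positivity)

lemma tendsto_clip (s : ℝ) : Tendsto (fun N => clip N s) atTop (𝓝 s) := by
  obtain ⟨M, hM⟩ := exists_nat_ge |s|
  refine tendsto_const_nhds.congr' ?_
  filter_upwards [eventually_ge_atTop M] with N hN
  exact (clip_eq_self (hM.trans (by exact_mod_cast hN))).symm

lemma measurable_clip (N : ℕ) : Measurable (clip N) :=
  (by unfold clip; fun_prop : Continuous (clip N)).measurable

lemma exp_clip_le (N : ℕ) (s : ℝ) : Real.exp (clip N s) ≤ Real.exp s + 1 := by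
  rcases le_or_gt (clip N s) s with h | h
  · linarith [Real.exp_le_exp.2 h]
  · have h1 : Real.exp (clip N s) ≤ 1 := by
      rw [clip_eq_of_lt h, Real.exp_le_one_iff]
      linarith [(N.cast_nonneg : (0 : ℝ) ≤ N)]
    linarith [Real.exp_pos s]

/-- The comparison of `e^{g_N}` and `e^{g_N + s 1_A}`, where `g_N` is `-f / (2β)` clipped to
`[-N, N]`. -/
lemma mul_setIntegral_le_of_twoWeightBound (hβ : 0 < β) (hT : 0 < T) (hi : Integrable ρ₀)
    (hm : Measurable ρ₀) (hpos : ∀ y, 0 ≤ ρ₀ y) (hρT : Integrable ρT) (hρTpos : ∀ x, 0 ≤ ρT x)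
    (hf : Measurable f) (hfρ : Integrable fun x => f x * ρT x)
    (hfF : Integrable fun x => f x * heatFlow β T ρ₀ x) {A : Set (Rd d)} (hA : MeasurableSet A)
    {s : ℝ} (hs : 0 < s) (N : ℕ) {g : Rd d → ℝ} (hg : g = fun x => clip N (-f x / (2 * β)))
    (h : TwoWeightBound β T ρ₀ ρT f (fun x => Real.exp (g x))
      (fun x => Real.exp (g x + s * A.indicator 1 x))) :
    2 * β * s * ∫ x in A, ρT x ≤ (∫ x, |f x + 2 * β * g x| * heatFlow β T ρ₀ x)
      + (∫ x, |f x + 2 * β * g x| * ρT x)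
      + 2 * β * (Real.exp s - 1) * ∫ y, heatAvg β T (fun x => Real.exp (g x) * A.indicator 1 x) y
          / heatAvg β T (fun x => Real.exp (g x)) y * ρ₀ y := by
  set χ : Rd d → ℝ := A.indicator 1 with hχ
  have hχm : Measurable χ := measurable_one.indicator hA
  have hχ0 : ∀ x, 0 ≤ χ x := fun x => indicator_nonneg (fun _ _ => zero_le_one) x
  have hχ1 : ∀ x, χ x ≤ 1 := fun x => indicator_le_self' (fun _ _ => zero_le_one) x
  have hgm : Measurable g := by
    rw [hg]; exact (measurable_clip N).comp (hf.neg.div_const _)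
  have hg1 : ∀ x, -(N : ℝ) ≤ g x := fun x => by rw [hg]; exact neg_le_clip _ _
  have hg2 : ∀ x, g x ≤ N := fun x => by rw [hg]; exact clip_le _ _
  have hgabs : ∀ x, |g x| ≤ N := fun x => abs_le.2 ⟨hg1 x, hg2 x⟩
  set u : Rd d → ℝ := fun x => Real.exp (g x) with hu
  set u' : Rd d → ℝ := fun x => Real.exp (g x + s * χ x) with hu'
  set c := Real.exp (-N) with hcdef
  set C := Real.exp (N + s) with hCdef
  have hc : 0 < c := Real.exp_pos _
  have hum : Measurable u := hgm.exp
  have hum' : Measurable u' := (hgm.add (hχm.const_mul s)).exp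
  have hsχ0 : ∀ x, 0 ≤ s * χ x := fun x => mul_nonneg hs.le (hχ0 x)
  have hsχ1 : ∀ x, s * χ x ≤ s := fun x => mul_le_of_le_one_right hs.le (hχ1 x)
  have huc : ∀ x, c ≤ u x := fun x => Real.exp_le_exp.2 (hg1 x)
  have huC : ∀ x, u x ≤ C := fun x => Real.exp_le_exp.2 (by linarith [hg2 x])
  have huc' : ∀ x, c ≤ u' x := fun x => Real.exp_le_exp.2 (by linarith [hg1 x, hsχ0 x])
  have huC' : ∀ x, u' x ≤ C := fun x => Real.exp_le_exp.2 (by linarith [hg2 x, hsχ1 x])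
  have huabs : ∀ x, |u x| ≤ C := fun x => by
    rw [abs_of_nonneg (hc.le.trans (huc x))]; exact huC x
  set Z := heatAvg β T u with hZ
  set Z' := heatAvg β T u' with hZ'
  set Y := heatAvg β T (fun x => u x * χ x) with hY
  have hZc : ∀ y, c ≤ Z y := le_heatAvg hβ hT hum hc.le huc huC
  have hZC : ∀ y, Z y ≤ C := heatAvg_le hβ hT hum hc.le huc huC
  have hZc' : ∀ y, c ≤ Z' y := le_heatAvg hβ hT hum' hc.le huc' huC'
  have hZC' : ∀ y, Z' y ≤ C := heatAvg_le hβ hT hum' hc.le huc' huC'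
  have iu := fun y => integrable_bdd_mul_heatKernel hβ hT hum huabs y
  have huχ : ∀ x, |u x * χ x| ≤ C := fun x => by
    rw [abs_mul, abs_of_nonneg (hχ0 x)]
    exact (mul_le_of_le_one_right (abs_nonneg _) (hχ1 x)).trans (huabs x)
  have iuχ : ∀ y, Integrable fun z => u z * χ z * heatKernel β T (z - y) :=
    fun y => integrable_bdd_mul_heatKernel hβ hT (hum.mul hχm) huχ y
  have hexp : ∀ x, u' x = u x + (Real.exp s - 1) * (u x * χ x) := by
    intro x
    simp only [hu', hu, hχ]
    by_cases hx : x ∈ A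
    · simp [hx, Real.exp_add]
      ring
    · simp [hx]
  have hZY : ∀ y, Z' y = Z y + (Real.exp s - 1) * Y y := by
    intro y
    simp only [hZ', hZ, hY, heatAvg]
    rw [← integral_const_mul, ← integral_add (iu y) ((iuχ y).const_mul _)]
    congr 1 with x
    rw [hexp]
    ring
  have hY0 : ∀ y, 0 ≤ Y y := fun y => integral_nonneg fun z =>
    mul_nonneg (mul_nonneg (hc.le.trans (huc z)) (hχ0 z)) (heatKernel_nonneg hβ _ _)
  have hYZ : ∀ y, Y y ≤ Z y := fun y => integral_mono (iuχ y) (iu y) fun z =>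
    mul_le_mul_of_nonneg_right (mul_le_of_le_one_right (hc.le.trans (huc z)) (hχ1 z))
      (heatKernel_nonneg hβ _ _)
  have hZm : Measurable Z := measurable_heatAvg hum
  have hZm' : Measurable Z' := measurable_heatAvg hum'
  have hYm : Measurable Y := measurable_heatAvg (hum.mul hχm)
  have hq0 := gibbsDensity_nonneg (T := T) hβ hpos (fun x => hc.le.trans (huc x))
  have hqle := gibbsDensity_le hβ hT hi hm hpos hum hc huc huC
  have hqm : Measurable (gibbsDensity β T ρ₀ u) := measurable_gibbsDensity hm hum
  have hF0 := heatFlow_nonneg (t := T) hβ hpos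
  have hF : Integrable fun x => heatFlow β T ρ₀ x := by
    simpa using integrable_mul_heatFlow hβ hT hm hi (measurable_const (a := (1 : ℝ))) (M := 1)
      (by simp)
  have hqC : ∀ x, gibbsDensity β T ρ₀ u x ≤ C / c * heatFlow β T ρ₀ x := fun x =>
    (hqle x).trans (mul_le_mul_of_nonneg_right (div_le_div_of_nonneg_right (huC x) hc.le) (hF0 x))
  have igq : Integrable fun x => g x * gibbsDensity β T ρ₀ u x := by
    refine (hF.const_mul (N * (C / c))).mono' (hgm.mul hqm).aestronglyMeasurable
      (Eventually.of_forall fun x => ?_)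
    rw [norm_mul, Real.norm_of_nonneg (hq0 x), mul_assoc]
    exact mul_le_mul (hgabs x) (hqC x) (hq0 x) N.cast_nonneg
  have ifq : Integrable fun x => f x * gibbsDensity β T ρ₀ u x := by
    refine (hfF.norm.const_mul (C / c)).mono' (hf.mul hqm).aestronglyMeasurable
      (Eventually.of_forall fun x => ?_)
    rw [norm_mul, norm_mul, Real.norm_of_nonneg (hq0 x), Real.norm_of_nonneg (hF0 x),
      mul_left_comm]
    exact mul_le_mul_of_nonneg_left (hqC x) (norm_nonneg _)
  have igρ : Integrable fun x => g x * ρT x :=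
    hρT.bdd_mul hgm.aestronglyMeasurable (Eventually.of_forall hgabs)
  have iχρ : Integrable fun x => χ x * ρT x :=
    hρT.bdd_mul (c := 1) hχm.aestronglyMeasurable (Eventually.of_forall fun x => by
      rw [Real.norm_of_nonneg (hχ0 x)]; exact hχ1 x)
  have ilZ : Integrable fun y => Real.log (Z y) * ρ₀ y :=
    hi.bdd_mul hZm.log.aestronglyMeasurable
      (Eventually.of_forall fun y => abs_log_le hc (hZc y) (hZC y))
  have ilZ' : Integrable fun y => Real.log (Z' y) * ρ₀ y :=
    hi.bdd_mul hZm'.log.aestronglyMeasurable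
      (Eventually.of_forall fun y => abs_log_le hc (hZc' y) (hZC' y))
  have iYZ : Integrable fun y => Y y / Z y * ρ₀ y := by
    refine hi.bdd_mul (c := 1) (hYm.div hZm).aestronglyMeasurable (Eventually.of_forall fun y => ?_)
    rw [Real.norm_of_nonneg (div_nonneg (hY0 y) (hc.le.trans (hZc y)))]
    exact div_le_one_of_le₀ (hYZ y) (hc.le.trans (hZc y))
  have herr : ∀ x, |f x + 2 * β * g x| ≤ |f x| := fun x => by
    rw [hg]; exact abs_add_clip_le hβ N (f x)
  have hem : Measurable fun x => |f x + 2 * β * g x| := (hf.add (hgm.const_mul _)).abs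
  have ieF : Integrable fun x => |f x + 2 * β * g x| * heatFlow β T ρ₀ x := by
    refine hfF.mono (hem.aestronglyMeasurable.mul hF.aestronglyMeasurable)
      (Eventually.of_forall fun x => ?_)
    rw [norm_mul, norm_mul, Real.norm_eq_abs, abs_abs]
    exact mul_le_mul_of_nonneg_right (herr x) (norm_nonneg _)
  have ieρ : Integrable fun x => |f x + 2 * β * g x| * ρT x := by
    refine hfρ.mono (hem.aestronglyMeasurable.mul hρT.aestronglyMeasurable)
      (Eventually.of_forall fun x => ?_)
    rw [norm_mul, norm_mul, Real.norm_eq_abs, abs_abs]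
    exact mul_le_mul_of_nonneg_right (herr x) (norm_nonneg _)
  -- where `f + 2β g` is positive, `u` equals its lower bound `c`
  have hfg : (∫ x, f x * gibbsDensity β T ρ₀ u x) + 2 * β * ∫ x, g x * gibbsDensity β T ρ₀ u x
      ≤ ∫ x, |f x + 2 * β * g x| * heatFlow β T ρ₀ x := by
    rw [← integral_const_mul, ← integral_add ifq (igq.const_mul _)]
    refine integral_mono (ifq.add (igq.const_mul _)) ieF fun x => ?_
    have e : f x * gibbsDensity β T ρ₀ u x + 2 * β * (g x * gibbsDensity β T ρ₀ u x)
        = (f x + 2 * β * g x) * gibbsDensity β T ρ₀ u x := by ring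
    beta_reduce
    rw [e]
    rcases le_or_gt (f x + 2 * β * g x) 0 with hx | hx
    · exact (mul_nonpos_of_nonpos_of_nonneg hx (hq0 x)).trans
        (mul_nonneg (abs_nonneg _) (hF0 x))
    · have h1 : -f x / (2 * β) < clip N (-f x / (2 * β)) := by
        rw [hg] at hx
        simp only at hx
        rw [div_lt_iff₀ (by positivity)]
        linarith
      have h2 : u x = c := by
        simp only [hu, hg]
        rw [clip_eq_of_lt h1]
      have h3 := hqle x
      rw [h2, div_self hc.ne', one_mul] at h3
      rw [abs_of_pos hx]
      exact mul_le_mul_of_nonneg_left h3 hx.le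
  have hρ1 : 2 * β * ∫ x, Real.log (u' x) * ρT x
      = 2 * β * (∫ x, g x * ρT x) + 2 * β * s * ∫ x in A, ρT x := by
    have e1 : ∫ x in A, ρT x = ∫ x, χ x * ρT x := by
      rw [← integral_indicator hA]
      congr 1 with x
      by_cases hx : x ∈ A <;> simp [hχ, hx]
    rw [e1, mul_assoc (2 * β) s, ← integral_const_mul s, ← mul_add,
      ← integral_add igρ (iχρ.const_mul s)]
    congr 2 with x
    simp only [hu', Real.log_exp]
    ring
  have hρ2 : -(∫ x, |f x + 2 * β * g x| * ρT x)
      ≤ (∫ x, f x * ρT x) + 2 * β * ∫ x, g x * ρT x := by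
    rw [← integral_const_mul, ← integral_add hfρ (igρ.const_mul _), ← integral_neg]
    refine integral_mono ieρ.neg (hfρ.add (igρ.const_mul _)) fun x => ?_
    have e : f x * ρT x + 2 * β * (g x * ρT x) = (f x + 2 * β * g x) * ρT x := by ring
    beta_reduce
    rw [e, ← neg_mul]
    exact mul_le_mul_of_nonneg_right (neg_abs_le _) (hρTpos x)
  have hlog : (∫ y, Real.log (Z' y) * ρ₀ y) - ∫ y, Real.log (Z y) * ρ₀ y
      ≤ (Real.exp s - 1) * ∫ y, Y y / Z y * ρ₀ y := by
    rw [← integral_sub ilZ' ilZ, ← integral_const_mul]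
    refine integral_mono (ilZ'.sub ilZ) (iYZ.const_mul _) fun y => ?_
    have hZ0 := hc.trans_le (hZc y)
    have hZ0' := hc.trans_le (hZc' y)
    have h1 := Real.log_le_sub_one_of_pos (div_pos hZ0' hZ0)
    rw [Real.log_div hZ0'.ne' hZ0.ne', hZY y] at h1
    have h2 : (Z y + (Real.exp s - 1) * Y y) / Z y - 1 = (Real.exp s - 1) * (Y y / Z y) := by
      field_simp; ring
    rw [h2, ← hZY y] at h1
    beta_reduce
    rw [← sub_mul, ← mul_assoc]
    exact mul_le_mul_of_nonneg_right h1 (hpos y)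
  have hqlog : ∫ x, Real.log (u x) * gibbsDensity β T ρ₀ u x
      = ∫ x, g x * gibbsDensity β T ρ₀ u x := by
    simp only [hu, Real.log_exp]
  unfold TwoWeightBound at h
  rw [hρ1, hqlog] at h
  have h4 := mul_le_mul_of_nonneg_left hlog (by positivity : 0 ≤ 2 * β)
  rw [mul_sub, ← mul_assoc] at h4
  linarith

/-- Division by `s` and the limit `s → 0⁺`, in which `(eˢ - 1) / s → 1`. -/
lemma le_of_forall_mul_le_exp_sub_one_mul {a b : ℝ}
    (h : ∀ s > 0, s * a ≤ (Real.exp s - 1) * b) : a ≤ b := by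
  have h1 := (Real.hasDerivAt_exp 0).hasDerivWithinAt (s := Ioi (0 : ℝ))
  rw [hasDerivWithinAt_iff_tendsto_slope' (by simp), Real.exp_zero] at h1
  have h2 := h1.mul_const b
  rw [one_mul] at h2
  refine ge_of_tendsto h2 ?_
  filter_upwards [self_mem_nhdsWithin] with s hs
  have hs' : 0 < s := hs
  rw [slope_def_field, sub_zero, Real.exp_zero, div_mul_eq_mul_div, le_div_iff₀ hs', mul_comm a]
  exact h s hs'

lemma heatAvg_pos (hβ : 0 < β) (hT : 0 < T) {w : Rd d → ℝ} (hw : ∀ x, 0 < w x) {y : Rd d}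
    (hi : Integrable fun z => w z * heatKernel β T (z - y)) : 0 < heatAvg β T w y := by
  have hp : ∀ z, 0 < w z * heatKernel β T (z - y) := fun z =>
    mul_pos (hw z) (heatKernel_pos hβ hT _)
  rw [heatAvg, integral_pos_iff_support_of_nonneg (fun z => (hp z).le) hi]
  have : Function.support (fun z => w z * heatKernel β T (z - y)) = univ :=
    eq_univ_of_forall fun z => (hp z).ne'
  rw [this]
  exact Measure.measure_univ_pos.2 (NeZero.ne _)

/-- The mass of the optimal density on a set is bounded by the mass of the Gibbs coupling. -/
lemma setIntegral_le_of_twoWeightBound (hβ : 0 < β) (hT : 0 < T) (hi : Integrable ρ₀)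
    (hm : Measurable ρ₀) (hpos : ∀ y, 0 ≤ ρ₀ y) (hρT : Integrable ρT) (hρTpos : ∀ x, 0 ≤ ρT x)
    (hf : Measurable f) (hfρ : Integrable fun x => f x * ρT x)
    (hfF : Integrable fun x => f x * heatFlow β T ρ₀ x)
    (h : ∀ (u u' : Rd d → ℝ) (c C : ℝ), Measurable u → Measurable u' → 0 < c →
      (∀ x, c ≤ u x) → (∀ x, u x ≤ C) → (∀ x, c ≤ u' x) → (∀ x, u' x ≤ C) →
      TwoWeightBound β T ρ₀ ρT f u u') {w : Rd d → ℝ}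
    (hw : w = fun x => Real.exp (-f x / (2 * β)))
    (hwi : ∀ y, Integrable fun z => w z * heatKernel β T (z - y))
    {A : Set (Rd d)} (hA : MeasurableSet A) :
    ∫ x in A, ρT x ≤ ∫ y, heatAvg β T (fun x => w x * A.indicator 1 x) y / heatAvg β T w y
      * ρ₀ y := by
  refine le_of_forall_mul_le_exp_sub_one_mul fun s hs => ?_
  set χ : Rd d → ℝ := A.indicator 1 with hχ
  have hχm : Measurable χ := measurable_one.indicator hA
  have hχ0 : ∀ x, 0 ≤ χ x := fun x => indicator_nonneg (fun _ _ => zero_le_one) x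
  have hχ1 : ∀ x, χ x ≤ 1 := fun x => indicator_le_self' (fun _ _ => zero_le_one) x
  set g : ℕ → Rd d → ℝ := fun N x => clip N (-f x / (2 * β)) with hg
  have hgm : ∀ N, Measurable (g N) := fun N => (measurable_clip N).comp (hf.neg.div_const _)
  have hfin : ∀ N, 2 * β * s * ∫ x in A, ρT x
      ≤ (∫ x, |f x + 2 * β * g N x| * heatFlow β T ρ₀ x) + (∫ x, |f x + 2 * β * g N x| * ρT x)
      + 2 * β * (Real.exp s - 1) * ∫ y, heatAvg β T (fun x => Real.exp (g N x) * χ x) y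
          / heatAvg β T (fun x => Real.exp (g N x)) y * ρ₀ y := by
    intro N
    refine mul_setIntegral_le_of_twoWeightBound hβ hT hi hm hpos hρT hρTpos hf hfρ hfF hA hs N rfl
      (h _ _ (Real.exp (-N)) (Real.exp (N + s)) (hgm N).exp
        ((hgm N).add (hχm.const_mul s)).exp (Real.exp_pos _) (fun x => ?_) (fun x => ?_)
        (fun x => ?_) fun x => ?_)
    · exact Real.exp_le_exp.2 (neg_le_clip _ _)
    · exact Real.exp_le_exp.2 ((clip_le _ _).trans (by linarith))
    · exact Real.exp_le_exp.2 ((neg_le_clip N _).trans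
        (le_add_of_nonneg_right (mul_nonneg hs.le (hχ0 x))))
    · exact Real.exp_le_exp.2 (add_le_add (clip_le N _) (mul_le_of_le_one_right hs.le (hχ1 x)))
  have hgl : ∀ x, Tendsto (fun N => g N x) atTop (𝓝 (-f x / (2 * β))) := fun x => tendsto_clip _
  have hel : ∀ x, Tendsto (fun N => |f x + 2 * β * g N x|) atTop (𝓝 0) := fun x => by
    have h1 := (((hgl x).const_mul (2 * β)).const_add (f x)).abs
    have h2 : f x + 2 * β * (-f x / (2 * β)) = 0 := by field_simp; ring
    rwa [h2, abs_zero] at h1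
  have herr : ∀ N x, |f x + 2 * β * g N x| ≤ |f x| := fun N x => abs_add_clip_le hβ N (f x)
  have hzero : ∀ r : Rd d → ℝ, AEStronglyMeasurable r → Integrable (fun x => f x * r x) →
      Tendsto (fun N => ∫ x, |f x + 2 * β * g N x| * r x) atTop (𝓝 0) := by
    intro r hr hfr
    have h0 : (0 : ℝ) = ∫ x, (0 : ℝ) * r x := by simp
    rw [h0]
    refine tendsto_integral_of_dominated_convergence (fun x => ‖f x * r x‖) (fun N => ?_) hfr.norm
      (fun N => Eventually.of_forall fun x => ?_)
      (Eventually.of_forall fun x => (hel x).mul_const _)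
    · exact ((hf.add ((hgm N).const_mul _)).abs).aestronglyMeasurable.mul hr
    · rw [norm_mul, norm_mul, Real.norm_eq_abs, abs_abs]
      exact mul_le_mul_of_nonneg_right (herr N x) (norm_nonneg _)
  have hwpos : ∀ x, 0 < w x := fun x => by rw [hw]; exact Real.exp_pos _
  have hule : ∀ N x, Real.exp (g N x) ≤ w x + 1 := fun N x => by rw [hw]; exact exp_clip_le _ _
  have hul : ∀ x, Tendsto (fun N => Real.exp (g N x)) atTop (𝓝 (w x)) := fun x => by
    rw [hw]; exact (Real.continuous_exp.tendsto _).comp (hgl x)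
  -- `exp g_N ≤ w + 1`, so dominated convergence applies although `w` may be unbounded
  have havg : ∀ (a : Rd d → ℝ), Measurable a → (∀ x, 0 ≤ a x) → (∀ x, a x ≤ 1) → ∀ y,
      Tendsto (fun N => heatAvg β T (fun x => Real.exp (g N x) * a x) y) atTop
        (𝓝 (heatAvg β T (fun x => w x * a x) y)) := by
    intro a ha ha0 ha1 y
    refine tendsto_integral_of_dominated_convergence
      (fun z => w z * heatKernel β T (z - y) + heatKernel β T (z - y)) (fun N => ?_)
      ((hwi y).add (integrable_heatKernel hβ hT y)) (fun N => Eventually.of_forall fun z => ?_)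
      (Eventually.of_forall fun z => ((hul z).mul_const _).mul_const _)
    · exact (((hgm N).exp.mul ha).mul ((continuous_heatKernel T).measurable.comp
        (measurable_id.sub_const y))).aestronglyMeasurable
    · have hk := heatKernel_nonneg hβ T (z - y)
      have he := (Real.exp_pos (g N z)).le
      rw [Real.norm_of_nonneg (mul_nonneg (mul_nonneg he (ha0 z)) hk), ← add_one_mul]
      exact mul_le_mul_of_nonneg_right ((mul_le_of_le_one_right he (ha1 z)).trans (hule N z)) hk
  have havg1 : ∀ y, Tendsto (fun N => heatAvg β T (fun x => Real.exp (g N x)) y) atTop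
      (𝓝 (heatAvg β T w y)) := fun y => by
    simpa using havg (fun _ => 1) measurable_const (fun _ => zero_le_one) (fun _ => le_rfl) y
  have hratio : Tendsto (fun N => ∫ y, heatAvg β T (fun x => Real.exp (g N x) * χ x) y
      / heatAvg β T (fun x => Real.exp (g N x)) y * ρ₀ y) atTop
      (𝓝 (∫ y, heatAvg β T (fun x => w x * χ x) y / heatAvg β T w y * ρ₀ y)) := by
    refine tendsto_integral_of_dominated_convergence (fun y => ρ₀ y) (fun N => ?_) hi
      (fun N => Eventually.of_forall fun y => ?_) (Eventually.of_forall fun y => ?_)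
    · exact (((measurable_heatAvg ((hgm N).exp.mul hχm)).div
        (measurable_heatAvg (hgm N).exp)).mul hm).aestronglyMeasurable
    · have hk := fun z : Rd d => heatKernel_nonneg hβ T (z - y)
      have hub : ∀ z, |Real.exp (g N z)| ≤ Real.exp N := fun z => by
        rw [Real.abs_exp]; exact Real.exp_le_exp.2 (clip_le _ _)
      have hub' : ∀ z, |Real.exp (g N z) * χ z| ≤ Real.exp N := fun z => by
        rw [abs_mul, abs_of_nonneg (hχ0 z)]
        exact (mul_le_of_le_one_right (abs_nonneg _) (hχ1 z)).trans (hub z)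
      have h1 : heatAvg β T (fun x => Real.exp (g N x) * χ x) y
          ≤ heatAvg β T (fun x => Real.exp (g N x)) y :=
        integral_mono (integrable_bdd_mul_heatKernel hβ hT ((hgm N).exp.mul hχm) hub' y)
          (integrable_bdd_mul_heatKernel hβ hT (hgm N).exp hub y) fun z =>
          mul_le_mul_of_nonneg_right (mul_le_of_le_one_right (Real.exp_pos _).le (hχ1 z)) (hk z)
      have h2 : 0 ≤ heatAvg β T (fun x => Real.exp (g N x) * χ x) y :=
        integral_nonneg fun z => mul_nonneg (mul_nonneg (Real.exp_pos _).le (hχ0 z)) (hk z)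
      rw [Real.norm_of_nonneg (mul_nonneg (div_nonneg h2 (h2.trans h1)) (hpos y))]
      exact mul_le_of_le_one_left (hpos y) (div_le_one_of_le₀ h1 (h2.trans h1))
    · exact ((havg χ hχm hχ0 hχ1 y).div (havg1 y) (heatAvg_pos hβ hT hwpos (hwi y)).ne').mul_const _
  have hlim := ge_of_tendsto' (((hzero _ (measurable_heatFlow_apply hm).aestronglyMeasurable
    hfF).add (hzero _ hρT.aestronglyMeasurable hfρ)).add
    (hratio.const_mul (2 * β * (Real.exp s - 1)))) hfin
  rw [add_zero, zero_add, mul_assoc (2 * β), mul_assoc (2 * β)] at hlim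
  exact le_of_mul_le_mul_left hlim (by positivity)

/-- The optimal density is the marginal of the Gibbs coupling. -/
lemma ae_eq_of_twoWeightBound (hβ : 0 < β) (hT : 0 < T) (hρ₀ : ρ₀ ∈ P2 d) (hρT : ρT ∈ P2 d)
    (hf : Measurable f) (hfρ : Integrable fun x => f x * ρT x)
    (hfF : Integrable fun x => f x * heatFlow β T ρ₀ x)
    (h : ∀ (u u' : Rd d → ℝ) (c C : ℝ), Measurable u → Measurable u' → 0 < c →
      (∀ x, c ≤ u x) → (∀ x, u x ≤ C) → (∀ x, c ≤ u' x) → (∀ x, u' x ≤ C) →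
      TwoWeightBound β T ρ₀ ρT f u u') {w : Rd d → ℝ}
    (hw : w = fun x => Real.exp (-f x / (2 * β)))
    (hwi : ∀ y, Integrable fun z => w z * heatKernel β T (z - y)) :
    ∀ᵐ x, Integrable (fun y => w x * heatKernel β T (x - y) / heatAvg β T w y * ρ₀ y) ∧
      ρT x = ∫ y, w x * heatKernel β T (x - y) / heatAvg β T w y * ρ₀ y := by
  obtain ⟨hm, ⟨hpos, hi, hone⟩, -⟩ := hρ₀
  obtain ⟨-, ⟨hpos', hi', hone'⟩, -⟩ := hρT
  have hwm : Measurable w := by rw [hw]; exact (hf.neg.div_const _).exp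
  have hwpos : ∀ x, 0 < w x := fun x => by rw [hw]; exact Real.exp_pos _
  have hZ : ∀ y, 0 < heatAvg β T w y := fun y => heatAvg_pos hβ hT hwpos (hwi y)
  set k : Rd d → Rd d → ℝ := fun x y => w x * heatKernel β T (x - y) / heatAvg β T w y with hk
  have hk0 : ∀ x y, 0 ≤ k x y := fun x y =>
    div_nonneg (mul_nonneg (hwpos x).le (heatKernel_nonneg hβ _ _)) (hZ y).le
  have hkint : Integrable (fun z : Rd d × Rd d => k z.1 z.2 * ρ₀ z.2) (volume.prod volume) := by
    refine integrable_kernel_mul ?_ hk0 (fun y => (hwi y).div_const _) (b := fun _ => 1)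
      (fun y => ?_) hm (by simpa using hi)
    · exact ((hwm.comp measurable_fst).mul (measurable_heatKernel_sub T)).div
        ((measurable_heatAvg hwm).comp measurable_snd)
    · simp only [hk]
      rw [integral_div]
      exact (div_self (hZ y).ne').le
  set p : Rd d → ℝ := fun x => ∫ y, k x y * ρ₀ y with hp
  have hpi : Integrable p := hkint.integral_prod_left
  have hpA : ∀ A : Set (Rd d), MeasurableSet A → ∫ x in A, p x
      = ∫ y, heatAvg β T (fun x => w x * A.indicator 1 x) y / heatAvg β T w y * ρ₀ y := by
    intro A hA
    have hχm : Measurable (A.indicator (1 : Rd d → ℝ)) := measurable_one.indicator hA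
    have hχ0 : ∀ x, 0 ≤ A.indicator (1 : Rd d → ℝ) x :=
      fun x => indicator_nonneg (fun _ _ => zero_le_one) x
    have hχ1 : ∀ x, A.indicator (1 : Rd d → ℝ) x ≤ 1 :=
      fun x => indicator_le_self' (fun _ _ => zero_le_one) x
    have hki : Integrable (fun z : Rd d × Rd d => A.indicator 1 z.1 * (k z.1 z.2 * ρ₀ z.2))
        (volume.prod volume) :=
      hkint.bdd_mul (c := 1) (hχm.comp measurable_fst).aestronglyMeasurable
        (Eventually.of_forall fun z => by rw [Real.norm_of_nonneg (hχ0 _)]; exact hχ1 _)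
    have hswap := integral_integral_swap
      (f := fun x y : Rd d => A.indicator 1 x * (k x y * ρ₀ y)) hki
    have e1 : ∫ x in A, p x = ∫ x, ∫ y, A.indicator 1 x * (k x y * ρ₀ y) := by
      rw [← integral_indicator hA]
      congr 1 with x
      rw [integral_const_mul]
      by_cases hx : x ∈ A <;> simp [hx, hp]
    rw [e1, hswap]
    congr 1 with y
    rw [heatAvg, ← integral_div, ← integral_mul_const]
    congr 1 with x
    simp only [hk]
    ring
  have hle : ∀ A : Set (Rd d), MeasurableSet A → ∫ x in A, ρT x ≤ ∫ x in A, p x := fun A hA => by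
    rw [hpA A hA]
    exact setIntegral_le_of_twoWeightBound hβ hT hi hm hpos hi' hpos' hf hfρ hfF h hw hwi hA
  have hp1 : ∫ x, p x = 1 := by
    rw [← setIntegral_univ, hpA univ MeasurableSet.univ, ← hone]
    congr 1 with y
    have : heatAvg β T (fun x => w x * (univ : Set (Rd d)).indicator 1 x) y = heatAvg β T w y := by
      simp [heatAvg]
    rw [this, div_self (hZ y).ne', one_mul]
  -- both densities have mass one, so the inequality on `Aᶜ` gives the converse one on `A`
  have heq : ρT =ᵐ[volume] p := by
    refine hi'.ae_eq_of_forall_setIntegral_eq _ _ hpi fun A hA _ => ?_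
    have h1 := hle A hA
    have h2 := hle Aᶜ hA.compl
    have h3 := integral_add_compl hA hi'
    have h4 := integral_add_compl hA hpi
    linarith
  filter_upwards [heq, hkint.prod_right_ae] with x hx hx'
  exact ⟨hx', hx⟩

end Identification

/-! ### First variation of potential, interaction and internal energies -/

section FirstVariation

variable {d : ℕ} {V W : Rd d → ℝ} {U : ℝ → ℝ} {p C : ℝ} {r s ρ q : Rd d → ℝ}

lemma integrable_potential_mul (hV : Continuous V) (hVb : ∀ x, |V x| ≤ C * (1 + ‖x‖ ^ 2))
    (hr : r ∈ P2 d) : Integrable fun x => V x * r x := by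
  refine ((hr.2.1.integrable.add hr.2.2).const_mul C).mono'
    (hV.measurable.mul hr.1).aestronglyMeasurable (Eventually.of_forall fun x => ?_)
  rw [norm_mul, Real.norm_of_nonneg (hr.2.1.nonneg x), Pi.add_apply]
  refine (mul_le_mul_of_nonneg_right (hVb x) (hr.2.1.nonneg x)).trans_eq ?_
  ring

lemma integrable_interaction (hW : Continuous W) (hWb : ∀ x, |W x| ≤ C * (1 + ‖x‖ ^ 2))
    (hr : r ∈ P2 d) (hs : s ∈ P2 d) :
    Integrable (fun z : Rd d × Rd d => W (z.1 - z.2) * r z.1 * s z.2) (volume.prod volume) := by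
  have hC : 0 ≤ C := by
    have := (abs_nonneg _).trans (hWb 0)
    simpa using this
  have i0 := hr.2.1.integrable.mul_prod hs.2.1.integrable
  have i1 := hr.2.2.mul_prod hs.2.1.integrable
  have i2 := hr.2.1.integrable.mul_prod hs.2.2
  refine ((i0.const_mul C).add ((i1.add i2).const_mul (2 * C))).mono' ?_
    (Eventually.of_forall fun z => ?_)
  · exact (((hW.measurable.comp (measurable_fst.sub measurable_snd)).mul
      (hr.1.comp measurable_fst)).mul (hs.1.comp measurable_snd)).aestronglyMeasurable
  · have h1 := hr.2.1.nonneg z.1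
    have h2 := hs.2.1.nonneg z.2
    rw [norm_mul, norm_mul, Real.norm_of_nonneg h1, Real.norm_of_nonneg h2, mul_assoc]
    have h3 : ‖z.1 - z.2‖ ^ 2 ≤ 2 * ‖z.1‖ ^ 2 + 2 * ‖z.2‖ ^ 2 := by
      have := pow_le_pow_left₀ (norm_nonneg _) (norm_sub_le z.1 z.2) 2
      nlinarith [sq_nonneg (‖z.1‖ - ‖z.2‖)]
    have h4 : |W (z.1 - z.2)| ≤ C * (1 + (2 * ‖z.1‖ ^ 2 + 2 * ‖z.2‖ ^ 2)) :=
      (hWb _).trans (mul_le_mul_of_nonneg_left (by linarith) hC)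
    refine (mul_le_mul_of_nonneg_right h4 (mul_nonneg h1 h2)).trans_eq ?_
    simp only [Pi.add_apply]
    ring

lemma measurable_convolution_potential (hW : Continuous W) (hs : Measurable s) :
    Measurable fun x => ∫ y, W (x - y) * s y := by
  have h : Measurable fun z : Rd d × Rd d => W (z.1 - z.2) * s z.2 :=
    (hW.measurable.comp (measurable_fst.sub measurable_snd)).mul (hs.comp measurable_snd)
  exact (h.stronglyMeasurable.integral_prod_right').measurable

lemma convolution_mul_eq (x : Rd d) :
    (∫ y, W (x - y) * s y) * r x = ∫ y, W (x - y) * r x * s y := by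
  rw [← integral_mul_const]
  congr 1 with y
  ring

lemma integrable_convolution_mul (hW : Continuous W) (hWb : ∀ x, |W x| ≤ C * (1 + ‖x‖ ^ 2))
    (hr : r ∈ P2 d) (hs : s ∈ P2 d) : Integrable fun x => (∫ y, W (x - y) * s y) * r x := by
  simp only [convolution_mul_eq]
  exact (integrable_interaction hW hWb hr hs).integral_prod_left

lemma integral_convolution_mul (hW : Continuous W) (hWb : ∀ x, |W x| ≤ C * (1 + ‖x‖ ^ 2))
    (hr : r ∈ P2 d) (hs : s ∈ P2 d) : ∫ x, (∫ y, W (x - y) * s y) * r x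
      = ∫ z : Rd d × Rd d, W (z.1 - z.2) * r z.1 * s z.2 ∂(volume.prod volume) := by
  simp only [convolution_mul_eq]
  rw [integral_prod _ (integrable_interaction hW hWb hr hs)]

lemma integral_interaction_comm (hWs : ∀ z, W (-z) = W z) :
    ∫ z : Rd d × Rd d, W (z.1 - z.2) * r z.1 * s z.2 ∂(volume.prod volume)
      = ∫ z : Rd d × Rd d, W (z.1 - z.2) * s z.1 * r z.2 ∂(volume.prod volume) := by
  rw [← integral_prod_swap]
  congr 1 with z
  simp only [Prod.fst_swap, Prod.snd_swap]
  rw [← neg_sub, hWs]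
  ring

lemma rpow_mul_le {a b : ℝ} (ha : 0 ≤ a) (hb : 0 ≤ b) (hp : 0 ≤ p) :
    a ^ p * b ≤ a ^ (p + 1) + b ^ (p + 1) := by
  have h1 : p + 1 ≠ 0 := by linarith
  rw [Real.rpow_add_one' ha h1, Real.rpow_add_one' hb h1]
  have h2 : 0 ≤ a ^ p * a := by positivity
  have h3 : 0 ≤ b ^ p * b := by positivity
  rcases le_total b a with h | h
  · have := mul_le_mul_of_nonneg_left h (Real.rpow_nonneg ha p)
    linarith
  · have := mul_le_mul_of_nonneg_right (Real.rpow_le_rpow ha h hp) hb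
    linarith

lemma max_rpow_le {a b : ℝ} (ha : 0 ≤ a) (hb : 0 ≤ b) :
    max a b ^ (p + 1) ≤ a ^ (p + 1) + b ^ (p + 1) := by
  rcases max_choice a b with h | h <;> rw [h]
  · linarith [Real.rpow_nonneg hb (p + 1)]
  · linarith [Real.rpow_nonneg ha (p + 1)]

lemma abs_sub_le_of_deriv_le (hU : ContDiff ℝ 1 U) (hC : 0 ≤ C) (hp : 0 ≤ p)
    (hUb : ∀ s, 0 ≤ s → |deriv U s| ≤ C * (1 + s ^ p)) {a b m : ℝ} (ha : 0 ≤ a) (hb : 0 ≤ b)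
    (ham : a ≤ m) (hbm : b ≤ m) : |U a - U b| ≤ C * (1 + m ^ p) * |a - b| := by
  refine (convex_Icc (0 : ℝ) m).norm_image_sub_le_of_norm_deriv_le (f := U)
    (fun x _ => hU.differentiable (by simp) x) (fun x hx => ?_) ⟨hb, hbm⟩ ⟨ha, ham⟩
  refine (hUb x hx.1).trans (mul_le_mul_of_nonneg_left ?_ hC)
  linarith [Real.rpow_le_rpow hx.1 hx.2 hp]

lemma mem_P2Lp_of_le (hp : 0 ≤ p) (hq : q ∈ P2 d) {M : ℝ} (hM : ∀ x, q x ≤ M) :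
    q ∈ P2Lp d p := by
  refine ⟨hq, (hq.2.1.integrable.const_mul (M ^ p)).mono'
    (hq.1.pow_const _).aestronglyMeasurable (Eventually.of_forall fun x => ?_)⟩
  have h0 := hq.2.1.nonneg x
  rw [Real.norm_of_nonneg (Real.rpow_nonneg h0 _), Real.rpow_add_one' h0 (by linarith)]
  exact mul_le_mul_of_nonneg_right (Real.rpow_le_rpow h0 (hM x) hp) h0

lemma P2_convex (hρ : ρ ∈ P2 d) (hq : q ∈ P2 d) {ε : ℝ} (h0 : 0 ≤ ε) (h1 : ε ≤ 1) :
    (fun x => (1 - ε) * ρ x + ε * q x) ∈ P2 d := by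
  obtain ⟨m1, ⟨p1, i1, o1⟩, s1⟩ := hρ
  obtain ⟨m2, ⟨p2, i2, o2⟩, s2⟩ := hq
  refine ⟨(m1.const_mul _).add (m2.const_mul _), ⟨fun x => ?_, (i1.const_mul _).add
    (i2.const_mul _), ?_⟩, ?_⟩
  · exact add_nonneg (mul_nonneg (by linarith) (p1 x)) (mul_nonneg h0 (p2 x))
  · rw [integral_add (i1.const_mul _) (i2.const_mul _), integral_const_mul, integral_const_mul,
      o1, o2]
    ring
  · refine ((s1.const_mul (1 - ε)).add (s2.const_mul ε)).congr (Eventually.of_forall fun x => ?_)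
    simp only [Pi.add_apply]
    ring

lemma P2Lp_convex (hp : 0 ≤ p) (hρ : ρ ∈ P2Lp d p) (hq : q ∈ P2Lp d p) {ε : ℝ} (h0 : 0 ≤ ε)
    (h1 : ε ≤ 1) : (fun x => (1 - ε) * ρ x + ε * q x) ∈ P2Lp d p := by
  have h := P2_convex hρ.1 hq.1 h0 h1
  refine ⟨h, (hρ.2.add hq.2).mono' (h.1.pow_const _).aestronglyMeasurable
    (Eventually.of_forall fun x => ?_)⟩
  have a0 := hρ.1.2.1.nonneg x
  have b0 := hq.1.2.1.nonneg x
  have hle : (1 - ε) * ρ x + ε * q x ≤ max (ρ x) (q x) := by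
    nlinarith [le_max_left (ρ x) (q x), le_max_right (ρ x) (q x)]
  rw [Real.norm_of_nonneg (Real.rpow_nonneg (h.2.1.nonneg x) _)]
  exact (Real.rpow_le_rpow (h.2.1.nonneg x) hle (by linarith)).trans (max_rpow_le a0 b0)

lemma integrable_internal (hU : ContDiff ℝ 1 U) (hC : 0 ≤ C) (hp : 0 ≤ p) (hU0 : U 0 = 0)
    (hUb : ∀ s, 0 ≤ s → |deriv U s| ≤ C * (1 + s ^ p)) (hρ : ρ ∈ P2Lp d p) :
    Integrable fun x => U (ρ x) := by
  refine ((hρ.1.2.1.integrable.add hρ.2).const_mul C).mono'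
    (hU.continuous.measurable.comp hρ.1.1).aestronglyMeasurable (Eventually.of_forall fun x => ?_)
  have h0 := hρ.1.2.1.nonneg x
  have h1 := abs_sub_le_of_deriv_le hU hC hp hUb h0 le_rfl le_rfl h0
  rw [hU0, sub_zero, sub_zero, abs_of_nonneg h0] at h1
  rw [Real.norm_eq_abs, Pi.add_apply, Real.rpow_add_one' h0 (by linarith)]
  refine h1.trans_eq ?_
  ring

lemma integrable_deriv_internal_mul (hU : ContDiff ℝ 1 U) (hC : 0 ≤ C) (hp : 0 ≤ p)
    (hUb : ∀ s, 0 ≤ s → |deriv U s| ≤ C * (1 + s ^ p)) (hρ : ρ ∈ P2Lp d p) (hq : q ∈ P2Lp d p) :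
    Integrable fun x => deriv U (ρ x) * q x := by
  refine ((hq.1.2.1.integrable.add (hρ.2.add hq.2)).const_mul C).mono'
    (((hU.continuous_deriv le_rfl).measurable.comp hρ.1.1).mul hq.1.1).aestronglyMeasurable
    (Eventually.of_forall fun x => ?_)
  have h0 := hρ.1.2.1.nonneg x
  have h1 := hq.1.2.1.nonneg x
  rw [norm_mul, Real.norm_of_nonneg h1]
  refine (mul_le_mul_of_nonneg_right (hUb _ h0) h1).trans ?_
  have h2 := mul_le_mul_of_nonneg_left (rpow_mul_le h0 h1 hp) hC
  simp only [Pi.add_apply]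
  linarith

/-- One-sided derivative of the internal energy along a segment. -/
lemma hasDerivWithinAt_internal (hU : ContDiff ℝ 1 U) (hC : 0 ≤ C) (hp : 0 ≤ p) (hU0 : U 0 = 0)
    (hUb : ∀ s, 0 ≤ s → |deriv U s| ≤ C * (1 + s ^ p)) (hρ : ρ ∈ P2Lp d p) (hq : q ∈ P2Lp d p) :
    HasDerivWithinAt (fun ε : ℝ => ∫ x, U ((1 - ε) * ρ x + ε * q x))
      (∫ x, deriv U (ρ x) * (q x - ρ x)) (Ici 0) 0 := by
  rw [hasDerivWithinAt_iff_tendsto_slope, Ici_sdiff_left]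
  have hU0' := integrable_internal hU hC hp hU0 hUb hρ
  have hlt : ∀ᶠ ε in 𝓝[>] (0 : ℝ), 0 < ε ∧ ε < 1 :=
    Filter.Eventually.and self_mem_nhdsWithin
      (eventually_nhdsWithin_of_eventually_nhds (eventually_lt_nhds one_pos))
  have hslope : ∀ᶠ ε in 𝓝[>] (0 : ℝ), ∫ x, (U ((1 - ε) * ρ x + ε * q x) - U (ρ x)) / ε
      = slope (fun ε : ℝ => ∫ x, U ((1 - ε) * ρ x + ε * q x)) 0 ε := by
    filter_upwards [hlt] with ε hε
    rw [slope_def_field, integral_div, integral_sub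
      (integrable_internal hU hC hp hU0 hUb (P2Lp_convex hp hρ hq hε.1.le hε.2.le)) hU0']
    simp
  refine Tendsto.congr' hslope ?_
  refine tendsto_integral_filter_of_dominated_convergence
    (fun x => C * ((ρ x + q x) + (ρ x ^ (p + 1) + q x ^ (p + 1)))) ?_ ?_ ?_ ?_
  · refine Eventually.of_forall fun ε => Measurable.aestronglyMeasurable ?_
    exact ((hU.continuous.measurable.comp
      ((hρ.1.1.const_mul _).add (hq.1.1.const_mul _))).sub
      (hU.continuous.measurable.comp hρ.1.1)).div_const _
  · filter_upwards [hlt] with ε hε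
    refine Eventually.of_forall fun x => ?_
    have a0 := hρ.1.2.1.nonneg x
    have b0 := hq.1.2.1.nonneg x
    set m := max (ρ x) (q x) with hm
    have am : ρ x ≤ m := le_max_left _ _
    have bm : q x ≤ m := le_max_right _ _
    have m0 : 0 ≤ m := a0.trans am
    have e0 : 0 ≤ (1 - ε) * ρ x + ε * q x :=
      add_nonneg (mul_nonneg (by linarith) a0) (mul_nonneg hε.1.le b0)
    have em : (1 - ε) * ρ x + ε * q x ≤ m := by nlinarith
    have h1 := abs_sub_le_of_deriv_le hU hC hp hUb e0 a0 em am
    have h2 : |(1 - ε) * ρ x + ε * q x - ρ x| = ε * |q x - ρ x| := by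
      rw [show (1 - ε) * ρ x + ε * q x - ρ x = ε * (q x - ρ x) by ring, abs_mul,
        abs_of_pos hε.1]
    have h3 : |q x - ρ x| ≤ m := abs_sub_le_iff.2 ⟨by linarith, by linarith⟩
    rw [h2] at h1
    rw [norm_div, Real.norm_of_nonneg hε.1.le, div_le_iff₀ hε.1, Real.norm_eq_abs]
    have h4 : C * (1 + m ^ p) * |q x - ρ x| ≤ C * (1 + m ^ p) * m :=
      mul_le_mul_of_nonneg_left h3 (mul_nonneg hC (by positivity))
    have h5 : C * (1 + m ^ p) * m = C * (m + m ^ (p + 1)) := by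
      rw [Real.rpow_add_one' m0 (by linarith)]; ring
    have h6 : C * (m + m ^ (p + 1)) ≤ C * ((ρ x + q x) + (ρ x ^ (p + 1) + q x ^ (p + 1))) :=
      mul_le_mul_of_nonneg_left (add_le_add (max_le (by linarith) (by linarith))
        (max_rpow_le a0 b0)) hC
    calc _ ≤ C * (1 + m ^ p) * (ε * |q x - ρ x|) := h1
      _ = C * (1 + m ^ p) * |q x - ρ x| * ε := by ring
      _ ≤ _ := mul_le_mul_of_nonneg_right (h4.trans (h5.le.trans h6)) hε.1.le
  · exact ((hρ.1.2.1.integrable.add hq.1.2.1.integrable).add (hρ.2.add hq.2)).const_mul C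
  · refine Eventually.of_forall fun x => ?_
    have h1 : HasDerivAt (fun ε : ℝ => (1 - ε) * ρ x + ε * q x) (q x - ρ x) 0 := by
      have := (((hasDerivAt_id (0 : ℝ)).const_sub 1).mul_const (ρ x)).add
        ((hasDerivAt_id (0 : ℝ)).mul_const (q x))
      refine this.congr_deriv ?_
      ring
    have h2 : HasDerivAt U (deriv U (ρ x)) ((1 - (0 : ℝ)) * ρ x + 0 * q x) := by
      simpa using (hU.differentiable (by simp) (ρ x)).hasDerivAt
    have h3 := (h2.comp (0 : ℝ) h1).hasDerivWithinAt (s := Ioi 0)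
    rw [hasDerivWithinAt_iff_tendsto_slope' (by simp)] at h3
    refine h3.congr fun ε => ?_
    rw [slope_def_field]
    simp

/-- `V + W * ρ + U'(ρ)` is a first variation of the sum of a potential, an interaction and an
internal energy. -/
lemma isFirstVariation_pwuVariation (hV : ContDiff ℝ 1 V) (hW : ContDiff ℝ 1 W)
    (hWs : ∀ z, W (-z) = W z) (hU : ContDiff ℝ 1 U) (hVb : ∀ x, |V x| ≤ C * (1 + ‖x‖ ^ 2))
    (hWb : ∀ x, |W x| ≤ C * (1 + ‖x‖ ^ 2)) (hU0 : U 0 = 0) (hp : 0 ≤ p)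
    (hUb : ∀ s, 0 ≤ s → |deriv U s| ≤ C * (1 + s ^ p)) (hρ : ρ ∈ P2Lp d p) :
    IsFirstVariation (P2Lp d p) (pwuEnergy V W U) ρ (fun x => pwuVariation V W U x ρ) := by
  have hC : 0 ≤ C := by
    have := (abs_nonneg _).trans (hVb 0)
    simpa using this
  have hVc := hV.continuous
  have hWc := hW.continuous
  have hint : ∀ q ∈ P2Lp d p, Integrable fun x => pwuVariation V W U x ρ * q x := by
    intro q hq
    simp only [pwuVariation, add_mul]
    exact ((integrable_potential_mul hVc hVb hq.1).add
      (integrable_convolution_mul hWc hWb hq.1 hρ.1)).add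
      (integrable_deriv_internal_mul hU hC hp hUb hρ hq)
  have hmem : ∀ q ∈ P2 d, (∃ M, ∀ x, q x ≤ M) → q ∈ P2Lp d p := fun q hq ⟨M, hM⟩ =>
    mem_P2Lp_of_le hp hq hM
  refine ⟨?_, hint ρ hρ, fun q hq hb => hint q (hmem q hq hb), fun q hq hb => ?_,
    fun q hq hb => ?_⟩
  · exact (hVc.measurable.add (measurable_convolution_potential hWc hρ.1.1)).add
      ((hU.continuous_deriv le_rfl).measurable.comp hρ.1.1)
  · filter_upwards [self_mem_nhdsWithin, eventually_nhdsWithin_of_eventually_nhds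
      (eventually_lt_nhds (one_pos : (0 : ℝ) < 1))] with ε h0 h1
    exact P2Lp_convex hp hρ (hmem q hq hb) (le_of_lt h0) h1.le
  · have hqL := hmem q hq hb
    have iVρ := integrable_potential_mul hVc hVb hρ.1
    have iVq := integrable_potential_mul hVc hVb hq
    -- the interaction energy as a quadratic polynomial of the segment parameter
    set B : (Rd d → ℝ) → (Rd d → ℝ) → ℝ := fun r s =>
      ∫ z : Rd d × Rd d, W (z.1 - z.2) * r z.1 * s z.2 ∂(volume.prod volume) with hB
    have iρρ := integrable_interaction hWc hWb hρ.1 hρ.1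
    have iρq := integrable_interaction hWc hWb hρ.1 hq
    have iqρ := integrable_interaction hWc hWb hq hρ.1
    have iqq := integrable_interaction hWc hWb hq hq
    have hcomm : B ρ q = B q ρ := integral_interaction_comm hWs
    have hquad : ∀ ε : ℝ, ∫ x, ∫ y, W (x - y) * ((1 - ε) * ρ x + ε * q x)
        * ((1 - ε) * ρ y + ε * q y)
        = (1 - ε) ^ 2 * B ρ ρ + 2 * (ε * (1 - ε)) * B q ρ + ε ^ 2 * B q q := by
      intro ε
      have iadd : Integrable (fun z : Rd d × Rd d => W (z.1 - z.2) * ρ z.1 * q z.2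
          + W (z.1 - z.2) * q z.1 * ρ z.2) (volume.prod volume) := iρq.add iqρ
      have iadd' : Integrable (fun z : Rd d × Rd d =>
          (1 - ε) ^ 2 * (W (z.1 - z.2) * ρ z.1 * ρ z.2) + ε * (1 - ε)
            * (W (z.1 - z.2) * ρ z.1 * q z.2 + W (z.1 - z.2) * q z.1 * ρ z.2))
          (volume.prod volume) := (iρρ.const_mul _).add (iadd.const_mul _)
      have hsum := iadd'.add (iqq.const_mul (ε ^ 2))
      have hexp : ∀ z : Rd d × Rd d, W (z.1 - z.2) * ((1 - ε) * ρ z.1 + ε * q z.1)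
          * ((1 - ε) * ρ z.2 + ε * q z.2)
          = (1 - ε) ^ 2 * (W (z.1 - z.2) * ρ z.1 * ρ z.2) + ε * (1 - ε)
            * (W (z.1 - z.2) * ρ z.1 * q z.2 + W (z.1 - z.2) * q z.1 * ρ z.2)
            + ε ^ 2 * (W (z.1 - z.2) * q z.1 * q z.2) := fun z => by ring
      have hi : Integrable (fun z : Rd d × Rd d => W (z.1 - z.2)
          * ((1 - ε) * ρ z.1 + ε * q z.1) * ((1 - ε) * ρ z.2 + ε * q z.2))
          (volume.prod volume) := hsum.congr (Eventually.of_forall fun z => (hexp z).symm)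
      rw [← integral_prod _ hi, integral_congr_ae (Eventually.of_forall hexp),
        integral_add iadd' (iqq.const_mul _),
        integral_add (iρρ.const_mul _) (iadd.const_mul _), integral_const_mul,
        integral_const_mul, integral_const_mul, integral_add iρq iqρ]
      change (1 - ε) ^ 2 * B ρ ρ + ε * (1 - ε) * (B ρ q + B q ρ) + ε ^ 2 * B q q = _
      rw [hcomm]
      ring
    have hpot : ∀ ε : ℝ, ∫ x, V x * ((1 - ε) * ρ x + ε * q x)
        = (1 - ε) * (∫ x, V x * ρ x) + ε * ∫ x, V x * q x := by
      intro ε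
      rw [← integral_const_mul, ← integral_const_mul, ← integral_add (iVρ.const_mul _)
        (iVq.const_mul _)]
      congr 1 with x
      ring
    have hd1 : HasDerivAt (fun ε : ℝ => 1 - ε) (-1) 0 := by
      simpa using (hasDerivAt_id (0 : ℝ)).const_sub 1
    have hd2 : HasDerivAt (fun ε : ℝ => ε) 1 0 := hasDerivAt_id 0
    have hdV : HasDerivAt (fun ε : ℝ => ∫ x, V x * ((1 - ε) * ρ x + ε * q x))
        ((∫ x, V x * q x) - ∫ x, V x * ρ x) 0 := by
      simp only [hpot]
      refine ((hd1.mul_const _).add (hd2.mul_const _)).congr_deriv ?_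
      ring
    have hdW : HasDerivAt (fun ε : ℝ => 1 / 2 * ∫ x, ∫ y, W (x - y)
        * ((1 - ε) * ρ x + ε * q x) * ((1 - ε) * ρ y + ε * q y)) (B q ρ - B ρ ρ) 0 := by
      simp only [hquad]
      refine (((((hd1.pow 2).mul_const (B ρ ρ)).add
        (((hd2.mul hd1).const_mul 2).mul_const (B q ρ))).add
        ((hd2.pow 2).mul_const (B q q))).const_mul (1 / 2)).congr_deriv ?_
      norm_num
      ring
    have hdU := hasDerivWithinAt_internal hU hC hp hU0 hUb hρ hqL
    have hval : ∫ x, pwuVariation V W U x ρ * (q x - ρ x)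
        = ((∫ x, V x * q x) - ∫ x, V x * ρ x) + (B q ρ - B ρ ρ)
          + ∫ x, deriv U (ρ x) * (q x - ρ x) := by
      have c1 : _ = B q ρ := integral_convolution_mul hWc hWb hq hρ.1
      have c2 : _ = B ρ ρ := integral_convolution_mul hWc hWb hρ.1 hρ.1
      have j1 := integrable_convolution_mul hWc hWb hq hρ.1
      have j2 := integrable_convolution_mul hWc hWb hρ.1 hρ.1
      have k1 := integrable_deriv_internal_mul hU hC hp hUb hρ hqL
      have k2 := integrable_deriv_internal_mul hU hC hp hUb hρ hρ
      have k3 : Integrable fun x => deriv U (ρ x) * (q x - ρ x) :=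
        (k1.sub k2).congr (Eventually.of_forall fun x => by simp only [Pi.sub_apply]; ring)
      have k4 : Integrable fun x => V x * q x - V x * ρ x := iVq.sub iVρ
      have k5 : Integrable fun x => (∫ y, W (x - y) * ρ y) * q x
          - (∫ y, W (x - y) * ρ y) * ρ x := j1.sub j2
      have k6 : Integrable fun x => V x * q x - V x * ρ x + ((∫ y, W (x - y) * ρ y) * q x
          - (∫ y, W (x - y) * ρ y) * ρ x) := k4.add k5
      rw [← c1, ← c2, ← integral_sub iVq iVρ, ← integral_sub j1 j2,
        ← integral_add k4 k5, ← integral_add k6 k3]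
      congr 1 with x
      simp only [pwuVariation]
      ring
    rw [hval]
    exact ((hdV.hasDerivWithinAt).add hdW.hasDerivWithinAt).add hdU

end FirstVariation

/-! ### The proximal density formula -/

section Formula

variable {d : ℕ} {β T : ℝ} {ρ₀ ρT : Rd d → ℝ}

/-- The Gibbs weight is, up to a normalizing constant, the heat kernel weighted by
`exp (-F / (2β))`. -/
lemma exists_gibbsWeight_eq (hβ : 0 < β) (hT : 0 < T) (F : Rd d → (Rd d → ℝ) → ℝ)
    (ρT : Rd d → ℝ) : ∃ κ : ℝ, κ ≠ 0 ∧ ∀ z y, gibbsWeight F z y β T ρT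
      = κ * (Real.exp (-F z ρT / (2 * β)) * heatKernel β T (z - y)) := by
  have hI := integral_exp_neg_mul_sq_norm_pos (d := d) (b := 1 / (4 * β)) (by positivity)
  have hs : 0 < √T := Real.sqrt_pos.2 hT
  refine ⟨√T ^ d * ∫ y : Rd d, Real.exp (-(1 / (4 * β)) * ‖y‖ ^ 2),
    mul_ne_zero (pow_pos hs d).ne' hI.ne', fun z y => ?_⟩
  have e : Real.exp (-(1 / (2 * β)) * (F z ρT + ‖z - y‖ ^ 2 / (2 * T)))
      = Real.exp (-F z ρT / (2 * β)) * Real.exp (-(1 / (4 * β)) * ‖(√T)⁻¹ • (z - y)‖ ^ 2) := by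
    rw [← Real.exp_add, norm_smul, mul_pow, norm_inv, inv_pow, Real.norm_of_nonneg hs.le,
      Real.sq_sqrt hT.le]
    congr 1
    field_simp
    ring
  rw [gibbsWeight, e, heatKernel, gaussDensity]
  generalize (∫ y : Rd d, Real.exp (-(1 / (4 * β)) * ‖y‖ ^ 2)) = I at hI ⊢
  field_simp

lemma heatFlow_mem_P2 (hβ : 0 < β) (hT : 0 < T) (hρ₀ : ρ₀ ∈ P2 d) :
    heatFlow β T ρ₀ ∈ P2 d ∧ ∃ M, ∀ x, heatFlow β T ρ₀ x ≤ M := by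
  have h := exists_isAdmissible_gibbsDensity hβ hT hρ₀ one_mem_trigPoly one_pos (fun _ => le_rfl)
  have e : gibbsDensity β T ρ₀ 1 = heatFlow β T ρ₀ := by
    have h1 : ∀ y : Rd d, heatAvg β T 1 y = 1 := fun y => by
      simp only [heatAvg, Pi.one_apply, one_mul]
      exact integral_heatKernel hβ hT y
    ext x
    simp [gibbsDensity, h1]
  rw [e] at h
  exact ⟨h.1, h.2.1⟩

/-- The duality bound for `w'`, the first-order condition and the competitor attached to `w`. -/
lemma IsRegWProx.twoWeightBound (hβ : 0 < β) (hT : 0 < T) (hρ₀ : ρ₀ ∈ P2 d)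
    {D : Set (Rd d → ℝ)} {𝓕 : (Rd d → ℝ) → ℝ} {f : Rd d → ℝ} (hρT : Integrable ρT)
    (h : IsRegWProx T β ρ₀ D 𝓕 ρT) (hf : IsFirstVariation D 𝓕 ρT f)
    {w w' : Rd d → ℝ} (hw : w ∈ trigPoly d) (hw' : w' ∈ trigPoly d) {c : ℝ} (hc : 0 < c)
    (hcw : ∀ x, c ≤ w x) (hcw' : ∀ x, c ≤ w' x) : TwoWeightBound β T ρ₀ ρT f w w' := by
  obtain ⟨-, ρ, v, hadm, hmin⟩ := h
  obtain ⟨hq, hqb, ρ', v', hadm', hK⟩ := exists_isAdmissible_gibbsDensity hβ hT hρ₀ hw hc hcw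
  have h1 := hadm.le_kineticEnergy hT hβ hρ₀.2.1.integrable hρT hw' hc hcw'
  have h2 := first_order_condition hβ hρT hf hadm hmin hq hqb hadm'
  rw [hK] at h2
  unfold TwoWeightBound
  linarith

/-- A regularized Wasserstein proximal density is the marginal of the Gibbs coupling attached to
the first variation of the energy. -/
lemma IsRegWProx.ae_eq_integral_gibbsKernel (hβ : 0 < β) (hT : 0 < T) (hρ₀ : ρ₀ ∈ P2 d)
    {D : Set (Rd d → ℝ)} {𝓕 : (Rd d → ℝ) → ℝ} {F : Rd d → (Rd d → ℝ) → ℝ} (hD : D ⊆ P2 d)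
    (h : IsRegWProx T β ρ₀ D 𝓕 ρT) (hf : IsFirstVariation D 𝓕 ρT (fun x => F x ρT))
    (hF : ∀ y, Integrable (fun z => gibbsWeight F z y β T ρT)) :
    ∀ᵐ x, Integrable (fun y => gibbsKernel F x y β T ρT * ρ₀ y) ∧
      ρT x = ∫ y, gibbsKernel F x y β T ρT * ρ₀ y := by
  have hρT := hD h.1
  obtain ⟨κ, hκ, hG⟩ := exists_gibbsWeight_eq hβ hT F ρT
  obtain ⟨hm, ⟨hpos, hi, -⟩, -⟩ := id hρ₀
  obtain ⟨hflow, hflowb⟩ := heatFlow_mem_P2 hβ hT hρ₀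
  have hfF := hf.integrable _ hflow hflowb
  have hwi : ∀ y, Integrable fun z => Real.exp (-F z ρT / (2 * β)) * heatKernel β T (z - y) := by
    intro y
    have := (hF y).const_mul κ⁻¹
    simpa only [hG, inv_mul_cancel_left₀ hκ] using this
  have hK : ∀ x y, gibbsKernel F x y β T ρT = Real.exp (-F x ρT / (2 * β)) * heatKernel β T (x - y)
      / heatAvg β T (fun z => Real.exp (-F z ρT / (2 * β))) y := by
    intro x y
    simp only [gibbsKernel, hG, heatAvg]
    rw [integral_const_mul, mul_div_mul_left _ _ hκ]
  simp only [hK]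
  exact ae_eq_of_twoWeightBound hβ hT hρ₀ hρT hf.measurable hf.integrable_self hfF
    (fun u u' c C hu hu' hc huc huC huc' huC' =>
      TwoWeightBound.of_trigPoly hβ hT hi hm hpos hρT.2.1.integrable hf.measurable hfF
        (fun w hw w' hw' c hc hcw hcw' => h.twoWeightBound hβ hT hρ₀
          hρT.2.1.integrable hf hw hw' hc hcw hcw')
        hu hu' hc huc huC huc' huC') rfl hwi

end Formula

end WProx

end

theorem mainTheorem5 (d : ℕ) (T β : ℝ) (hT : 0 < T) (hβ : 0 < β)
    (ρ₀ : WProx.Rd d → ℝ) (hρ₀ : ρ₀ ∈ WProx.P2 d) :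
    -- general energies
    (∀ (D : Set (WProx.Rd d → ℝ)) (𝓕 : (WProx.Rd d → ℝ) → ℝ)
        (F : WProx.Rd d → (WProx.Rd d → ℝ) → ℝ) (ρT : WProx.Rd d → ℝ),
      D ⊆ WProx.P2 d →
      WProx.IsRegWProx T β ρ₀ D 𝓕 ρT →
      WProx.IsFirstVariation D 𝓕 ρT (fun x => F x ρT) →
      (∀ y, Integrable (fun z => WProx.gibbsWeight F z y β T ρT)) →
      ∀ᵐ x, Integrable (fun y => WProx.gibbsKernel F x y β T ρT * ρ₀ y) ∧
        ρT x = ∫ y, WProx.gibbsKernel F x y β T ρT * ρ₀ y) ∧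
    -- potential, interaction and internal energies
    (∀ (V W : WProx.Rd d → ℝ) (U : ℝ → ℝ) (p C : ℝ),
      ContDiff ℝ 1 V → ContDiff ℝ 1 W → (∀ z, W (-z) = W z) → ContDiff ℝ 1 U →
      (∀ x, |V x| ≤ C * (1 + ‖x‖ ^ 2)) → (∀ x, |W x| ≤ C * (1 + ‖x‖ ^ 2)) →
      U 0 = 0 → 0 ≤ p → (∀ s, 0 ≤ s → |deriv U s| ≤ C * (1 + s ^ p)) →
      (∀ ρ ∈ WProx.P2Lp d p,
        WProx.IsFirstVariation (WProx.P2Lp d p) (WProx.pwuEnergy V W U) ρ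
          (fun x => WProx.pwuVariation V W U x ρ)) ∧
      ∀ ρT : WProx.Rd d → ℝ,
        WProx.IsRegWProx T β ρ₀ (WProx.P2Lp d p) (WProx.pwuEnergy V W U) ρT →
        (∀ y, Integrable
          (fun z => WProx.gibbsWeight (WProx.pwuVariation V W U) z y β T ρT)) →
        ∀ᵐ x, Integrable
            (fun y => WProx.gibbsKernel (WProx.pwuVariation V W U) x y β T ρT * ρ₀ y) ∧
          ρT x = ∫ y, WProx.gibbsKernel (WProx.pwuVariation V W U) x y β T ρT * ρ₀ y) := by
  refine ⟨fun D 𝓕 F ρT hD h hf hF => h.ae_eq_integral_gibbsKernel hβ hT hρ₀ hD hf hF,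
    fun V W U p C hV hW hWs hU hVb hWb hU0 hp hUb => ?_⟩
  have hvar : ∀ ρ ∈ WProx.P2Lp d p, WProx.IsFirstVariation (WProx.P2Lp d p)
      (WProx.pwuEnergy V W U) ρ (fun x => WProx.pwuVariation V W U x ρ) := fun ρ hρ =>
    WProx.isFirstVariation_pwuVariation hV hW hWs hU hVb hWb hU0 hp hUb hρ
  exact ⟨hvar, fun ρT h hF =>
    h.ae_eq_integral_gibbsKernel hβ hT hρ₀ (fun ρ hρ => hρ.1) (hvar ρT h.1) hF⟩
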